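/- **Conventions.** Let $\pi$ be a group and $w:\pi\to\{\pm1\}$ the trivial homomorphism (for instance $\pi=\pi_1(\Sigma)$ for an orientable surface $\Sigma$, where $w$ is its orientation character). A *Gauss diagram on $\pi$* of degree $n$ is an oriented circle, up to orientation-preserving homeomorphism, with $n$ signed oriented arrows joining $2n$ distinct points in pairs. If $n\ge 1$, each of the $2n$ edges of the circle carries an element of $\pi$; if $n=0$, the circle carries a conjugacy class of $\pi$. When arrows are removed, edges that merge receive the product of their decorations (only its conjugacy class if no arrow remains). *Virtual knot types* on $(\pi,w)$ are the classes of Gauss diagrams under the following moves. - $R_1$: creation or removal of an isolated arrow surrounding an edge decorated by $1$. - $R_2$: creation or removal of two arrows of opposite signs with consecutive tails and consecutive heads, the two surrounded edges being decorated by $1$. - $R_3$: for three disjoint edges $e$ decorated by $1$, such that each two are joined by an arrow, exchange of the two ends of each of them. Let $\mathrm w(e)$ be the product of the signs of the two arrows that bound $e$, $\uparrow(e)$ the number of arrowheads that bound $e$, and $\varepsilon(e)=\pm(-1)^{\uparrow(e)}$ with sign $+$ if and only if these two arrows cross. It is required that $\mathrm w(e)\varepsilon(e)$ be the same for the three edges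 and that the numbers $\uparrow(e)$ be pairwise different. - Conjugacy moves: for an arrow and $g\in\pi$, multiply the edges that arrive at its two ends by $g$ on the right and those that leave them by $g^{-1}$ on the left; reverse the arrow if and only if $w(g)=-1$ (which never happens here). An *arrow diagram* is a Gauss diagram without its signs. In every type of diagrams, a diagram is an orbit of rigid diagrams (ends at the $2n$-th roots of unity) under $\mathbb Z/2n$ (the trivial group if $n=0$), and $\operatorname{Aut}$ denotes the stabilizer of a rigid representative. A *Gauss series* (*arrow series*) is a formal series of bounded degree with rational coefficients of Gauss (arrow) diagrams. Let $\langle\,,\rangle$ be the pairing of Gauss series with finite linear combinations of Gauss diagrams for which different diagrams are orthogonal and $\langle G,G\rangle=|\operatorname{Aut}G|$. Let $I(G)$ be the sum of all subdiagrams of $G$, let $T_a(G)$ be $G$ without its signs, let $\operatorname{sign}(G)$ be the product of the signs of the arrows, and put $$S(A)=\sum_{T_a(G)=A}\operatorname{sign}(G)\,\frac{|\operatorname{Aut}A|}{|\operatorname{Aut}G|}\,G ,$$ extended to arrow series. A Gauss series $\mathcal G$ is an *arrow diagram formula for virtual knots* if it lies in the image of $S$ and $G\mapsto\langle\mathcal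 G,I(G)\rangle$ depends only on the virtual knot type of $G$. **The planar chain series.** Let $n\ge0$ and let $\Gamma=(\gamma_1,\dots,\gamma_{n+1})$ be conjugacy classes of $\pi$. A *naked arrow diagram* consists of the circle and the oriented arrows only; it is *planar* if no two arrows intersect. The arrows of a planar diagram of degree $n$ cut the disc (with its circle oriented counterclockwise) into $n+1$ regions. A *chain presentation* is a bijective numbering of the regions by $1,\dots,n+1$ that increases from the left to the right of every arrow. Let $U_n$ be the sum of all chain presentations of planar naked diagrams of degree $n$, up to planar isotopy (rotation), and let $\Phi_\Gamma$ be the sum of decorated planar diagrams obtained from $U_n$ by decorating the region number $i$ with $\gamma_i$, with multiplicities. A planar arrow diagram on $\pi$ induces a decorated planar diagram: each region receives the conjugacy class of the product of the decorations of the edges at its boundary, in the order of the circle. Let $S_\Gamma^a$ be the linear map that sends a decorated planar diagram with a rigid representative $D$ to the formal sum, over all rigid planar arrow diagrams on $\pi$ that induce $D$, of the arrow diagrams that they represent. Put $\widetilde\Phi_\Gamma=S_\Gamma^a(\Phi_\Gamma)$, an arrow series of degree $n$. **Theorem.** For every $n\ge0$ and every system $\Gamma=(\gamma_1,\dots,\gamma_{n+1})$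 of non-trivial conjugacy classes of $\pi$, some of which may coincide, the Gauss series $S(\widetilde\Phi_\Gamma)$ is an arrow diagram formula for virtual knots. In particular $G\mapsto\langle S(\widetilde\Phi_\Gamma),I(G)\rangle$ is an invariant of virtual knots on $(\pi,w)$. -/

import Mathlib

/-!
Gauss diagrams and arrow diagrams decorated by a group, their Reidemeister moves and conjugacy
moves, Gauss diagram formulas, symmetry-preserving maps, and the universal planar chain.
-/

namespace GaussKnot

universe u

/-! ### Symmetry-preserving maps between sets with an action of a finite abelian group -/

section Symmetry

variable (K : Type*) [CommGroup K]

/-- Diagrams of a given type: rigid diagrams up to rotation. -/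
abbrev Diag (X : Type*) [MulAction K X] : Type _ := MulAction.orbitRel.Quotient K X

variable {K} {X Y : Type*} [MulAction K X] [MulAction K Y]

/-- The diagram represented by a rigid diagram. -/
def diag (x : X) : Diag K X := Quotient.mk _ x

/-- The order of the group of symmetries of a diagram: the stabilizer of any rigid
representative. -/
noncomputable def autOrder (D : Diag K X) : ℕ :=
  Quotient.liftOn D (fun x : X => Nat.card (MulAction.stabilizer K x)) (by
    rintro x y ⟨k, rfl⟩
    have : MulAction.stabilizer K (k • y) = MulAction.stabilizer K y := by
      ext g
      simp only [MulAction.mem_stabilizer_iff]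
      rw [smul_comm]
      exact (MulAction.injective k).eq_iff
    simp only [this])

/-- An equivariant map of rigid diagrams induces a map of diagrams. -/
def forget (f : X →[K] Y) : Diag K X → Diag K Y :=
  Quotient.map (sa := MulAction.orbitRel K X) (sb := MulAction.orbitRel K Y) f (by
    rintro x y ⟨k, rfl⟩
    exact ⟨k, (map_smul f k y).symm⟩)

/-- The forgetful projection, on finite linear combinations of diagrams. -/
noncomputable def projection (f : X →[K] Y) : (Diag K X →₀ ℚ) →ₗ[ℚ] (Diag K Y →₀ ℚ) :=
  Finsupp.lmapDomain ℚ ℚ (forget f)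

/-- The number of rigid representatives of `D` lying over one given rigid representative of the
image of `D`: the coefficient of `D` in the sum of everything that projects to that rigid
representative. -/
noncomputable def fibreCount (f : X →[K] Y) (D : Diag K X) : ℕ :=
  Quotient.liftOn D
    (fun x : X => Nat.card {x' : X // x' ∈ MulAction.orbit K x ∧ f x' = f x}) (by
    rintro x y ⟨k, rfl⟩
    refine Nat.card_congr (Equiv.subtypeEquiv (MulAction.toPerm k⁻¹) fun a => ?_)
    have h : MulAction.orbit K (k • y) = MulAction.orbit K y := MulAction.orbit_smul k y
    simp only [MulAction.toPerm_apply, h, map_smul]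
    have h' : k⁻¹ • a ∈ MulAction.orbit K y ↔ a ∈ MulAction.orbit K y := by
      rw [← MulAction.orbit_eq_iff, MulAction.orbit_smul, MulAction.orbit_eq_iff]
    rw [h', inv_smul_eq_iff])

/-- The symmetry-preserving map on formal series: a rigid diagram of the target type is sent to
the formal sum of all rigid diagrams lying over it. -/
noncomputable def symPres (f : X →[K] Y) : (Diag K Y → ℚ) →ₗ[ℚ] (Diag K X → ℚ) where
  toFun s := fun D => fibreCount f D * s (forget f D)
  map_add' s t := by ext D; simp [mul_add]
  map_smul' c s := by ext D; simp; ring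

end Symmetry

/-! ### Rigid diagrams -/

/-- The number of edges of a diagram with `n` arrows: `2 * n`, or `1` (the whole circle) if there
is no arrow. -/
def size (n : ℕ) : ℕ := max 1 (2 * n)

instance (n : ℕ) : NeZero (size n) := ⟨by unfold size; omega⟩

/-- The marked points of the oriented circle, in cyclic order. They are the arrow ends if `n ≠ 0`;
a circle without arrows has one auxiliary marked point. The same type indexes the edges:
the edge `i` goes from the point `i` to the point `i + 1`. -/
abbrev Pt (n : ℕ) : Type := Fin (size n)

/-- The rotations of a rigid diagram of degree `n`. -/
abbrev Rot (n : ℕ) : Type := Multiplicative (Pt n)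

/-- A rigid naked arrow diagram: `partner` exchanges the ends of each arrow, and `dir` is `1` at
the tail and `-1` at the head of an arrow (and `0` only at the auxiliary point of the circle
without arrows). -/
@[ext]
structure Naked (n : ℕ) where
  partner : Pt n → Pt n
  dir : Pt n → SignType
  partner_partner : ∀ i, partner (partner i) = i
  dir_partner : ∀ i, dir (partner i) = -dir i
  dir_eq_zero : ∀ i, dir i = 0 ↔ n = 0

/-- The decorations of the edges by elements of `π`; a diagram without arrows is decorated by a
conjugacy class. -/
def Marking (π : Type u) [Group π] : ℕ → Type u
  | 0 => ConjClasses π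
  | n + 1 => Pt (n + 1) → π

/-- A rigid arrow diagram on `π`. -/
@[ext]
structure RigidArrow (π : Type u) [Group π] (n : ℕ) extends Naked n where
  mark : Marking π n

/-- A rigid Gauss diagram on `π`: a rigid arrow diagram with a sign on each arrow. -/
@[ext]
structure RigidGauss (π : Type u) [Group π] (n : ℕ) extends RigidArrow π n where
  writhe : Pt n → SignType
  writhe_partner : ∀ i, writhe (partner i) = writhe i
  writhe_eq_zero : ∀ i, writhe i = 0 ↔ n = 0

section Marking

variable {π : Type u} [Group π]

/-- The decoration of an edge in a diagram with arrows (the value is irrelevant if `n = 0`). -/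
def Marking.at : {n : ℕ} → Marking π n → Pt n → π
  | 0, _, _ => 1
  | _ + 1, μ, e => μ e

/-- The conjugacy class of the whole circle. -/
def Marking.total : {n : ℕ} → Marking π n → ConjClasses π
  | 0, c => c
  | n + 1, μ => ConjClasses.mk ((List.finRange (size (n + 1))).map μ).prod

/-- Change the decoration of each edge (nothing happens if there is no arrow). -/
def Marking.modify : {n : ℕ} → (Pt n → π → π) → Marking π n → Marking π n
  | 0, _, c => c
  | _ + 1, f, μ => fun e => f e (μ e)

/-- Rotate the decorations. -/
def Marking.rotate : {n : ℕ} → Pt n → Marking π n → Marking π n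
  | 0, _, c => c
  | _ + 1, k, μ => fun e => μ (e - k)

theorem Marking.rotate_zero {n : ℕ} (μ : Marking π n) : μ.rotate 0 = μ := by
  cases n with
  | zero => rfl
  | succ n => funext e; simp [Marking.rotate]

theorem Marking.rotate_add {n : ℕ} (k l : Pt n) (μ : Marking π n) :
    μ.rotate (k + l) = (μ.rotate l).rotate k := by
  cases n with
  | zero => rfl
  | succ n => funext e; simp only [Marking.rotate, sub_sub]

end Marking

/-! ### Rotations -/

/-- Rotate a naked diagram. -/
def Naked.rotate {n : ℕ} (k : Pt n) (D : Naked n) : Naked n where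
  partner i := D.partner (i - k) + k
  dir i := D.dir (i - k)
  partner_partner i := by simp [D.partner_partner]
  dir_partner i := by simp [D.dir_partner]
  dir_eq_zero i := D.dir_eq_zero _

theorem Naked.rotate_zero {n : ℕ} (D : Naked n) : D.rotate 0 = D := by
  ext i <;> simp [Naked.rotate]

theorem Naked.rotate_add {n : ℕ} (k l : Pt n) (D : Naked n) :
    D.rotate (k + l) = (D.rotate l).rotate k := by
  ext i
  · simp only [Naked.rotate, sub_sub, add_assoc, add_comm l k]
  · simp only [Naked.rotate, sub_sub]

instance (n : ℕ) : MulAction (Rot n) (Naked n) where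
  smul k D := D.rotate k.toAdd
  one_smul D := D.rotate_zero
  mul_smul k l D := D.rotate_add k.toAdd l.toAdd

theorem Naked.smul_def {n : ℕ} (k : Rot n) (D : Naked n) : k • D = D.rotate k.toAdd := rfl

section Actions

variable {π : Type u} [Group π]

instance (n : ℕ) : MulAction (Rot n) (RigidArrow π n) where
  smul k A := { toNaked := k • A.toNaked, mark := A.mark.rotate k.toAdd }
  one_smul A := congrArg₂ RigidArrow.mk (one_smul _ A.toNaked) A.mark.rotate_zero
  mul_smul k l A := congrArg₂ RigidArrow.mk (mul_smul k l A.toNaked)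
    (A.mark.rotate_add k.toAdd l.toAdd)

theorem RigidArrow.toNaked_smul {n : ℕ} (k : Rot n) (A : RigidArrow π n) :
    (k • A).toNaked = k • A.toNaked := rfl

theorem RigidArrow.mark_smul {n : ℕ} (k : Rot n) (A : RigidArrow π n) :
    (k • A).mark = A.mark.rotate k.toAdd := rfl

/-- Rotate a Gauss diagram. -/
def RigidGauss.rotate {n : ℕ} (k : Pt n) (G : RigidGauss π n) : RigidGauss π n where
  toRigidArrow := Multiplicative.ofAdd k • G.toRigidArrow
  writhe i := G.writhe (i - k)
  writhe_partner i := by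
    show G.writhe (G.partner (i - k) + k - k) = _
    simp [G.writhe_partner]
  writhe_eq_zero i := G.writhe_eq_zero _

theorem RigidGauss.ext_arrow {n : ℕ} {G H : RigidGauss π n}
    (h : G.toRigidArrow = H.toRigidArrow) (h' : G.writhe = H.writhe) : G = H := by
  obtain ⟨A, v, _, _⟩ := G
  obtain ⟨B, v', _, _⟩ := H
  simp only at h h'
  subst h h'
  rfl

instance (n : ℕ) : MulAction (Rot n) (RigidGauss π n) where
  smul k G := G.rotate k.toAdd
  one_smul G := RigidGauss.ext_arrow (one_smul _ G.toRigidArrow)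
    (funext fun i => congrArg G.writhe (sub_zero i))
  mul_smul k l G := RigidGauss.ext_arrow (mul_smul k l G.toRigidArrow)
    (funext fun i => congrArg G.writhe (sub_sub i k.toAdd l.toAdd).symm)

theorem RigidGauss.smul_def {n : ℕ} (k : Rot n) (G : RigidGauss π n) :
    k • G = G.rotate k.toAdd := rfl

end Actions

/-- Gauss diagrams on `π` of degree `n`. -/
abbrev GaussDiagram (π : Type u) [Group π] (n : ℕ) : Type u := Diag (Rot n) (RigidGauss π n)

/-- Arrow diagrams on `π` of degree `n`. -/
abbrev ArrowDiagram (π : Type u) [Group π] (n : ℕ) : Type u := Diag (Rot n) (RigidArrow π n)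

/-- Formal series of Gauss diagrams of bounded degree. -/
abbrev GaussSeries (π : Type u) [Group π] : Type u :=
  DFinsupp fun n : ℕ => GaussDiagram π n → ℚ

/-- Formal series of arrow diagrams of bounded degree. -/
abbrev ArrowSeries (π : Type u) [Group π] : Type u :=
  DFinsupp fun n : ℕ => ArrowDiagram π n → ℚ

/-- Finite linear combinations of Gauss diagrams. -/
abbrev GaussSpace (π : Type u) [Group π] : Type u :=
  (Σ n : ℕ, GaussDiagram π n) →₀ ℚ

/-! ### Arrow series as Gauss series -/

section Formulas

variable {π : Type u} [Group π]

/-- The product of the signs of the arrows. -/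
def RigidGauss.sign {n : ℕ} (G : RigidGauss π n) : ℚ :=
  ∏ i, if G.dir i = 1 then (G.writhe i : ℚ) else 1

/-- The sign of a Gauss diagram. -/
def gaussSign {n : ℕ} (G : GaussDiagram π n) : ℚ :=
  Quotient.liftOn G RigidGauss.sign (by
    rintro x y ⟨k, rfl⟩
    exact Equiv.prod_comp (Equiv.subRight k.toAdd)
      (fun i => if y.dir i = 1 then (y.writhe i : ℚ) else 1))

/-- Forget the signs of the arrows. -/
def forgetSigns (π : Type u) [Group π] (n : ℕ) : RigidGauss π n →[Rot n] RigidArrow π n where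
  toFun G := G.toRigidArrow
  map_smul' _ _ := rfl

/-- The signed symmetry-preserving map from arrow series to Gauss series: an arrow diagram `A` is
sent to the sum of the `sign G * |Aut A| / |Aut G| • G` over all `G` that become `A` when the
signs are forgotten. -/
noncomputable def signedSymPres (𝒜 : ArrowSeries π) : GaussSeries π :=
  DFinsupp.mapRange
    (fun n (s : ArrowDiagram π n → ℚ) (G : GaussDiagram π n) =>
      gaussSign G * ((autOrder (forget (forgetSigns π n) G) : ℚ) / (autOrder G : ℚ)) *
        s (forget (forgetSigns π n) G))
    (fun n => by funext G; simp) 𝒜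

/-- The normalized pairing, for which the diagrams are orthogonal and the square of a diagram is
the order of its group of symmetries. -/
noncomputable def pairing (𝒢 : GaussSeries π) (x : GaussSpace π) : ℚ :=
  x.sum fun G q => (autOrder G.2 : ℚ) * 𝒢 G.1 G.2 * q

/-! ### Subdiagrams -/

/-- The arrows of a diagram, given by their tails. -/
def Naked.arrows {n : ℕ} (D : Naked n) : Finset (Pt n) := Finset.univ.filter fun i => D.dir i = 1

/-- The ends of a set of arrows. -/
def Naked.ends {n : ℕ} (D : Naked n) (s : Finset (Pt n)) : Finset (Pt n) := s ∪ s.image D.partner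

theorem Naked.partner_mem_ends {n : ℕ} (D : Naked n) (s : Finset (Pt n)) {i : Pt n}
    (hi : i ∈ D.ends s) : D.partner i ∈ D.ends s := by
  simp only [Naked.ends, Finset.mem_union, Finset.mem_image] at hi ⊢
  rcases hi with hi | ⟨j, hj, rfl⟩
  · exact Or.inr ⟨i, hi, rfl⟩
  · exact Or.inl (by rwa [D.partner_partner])

theorem Naked.dir_ne_zero_of_mem_ends {n : ℕ} (D : Naked n) {s : Finset (Pt n)}
    (hs : s ⊆ D.arrows) {i : Pt n} (hi : i ∈ D.ends s) : D.dir i ≠ 0 := by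
  simp only [Naked.ends, Finset.mem_union, Finset.mem_image] at hi
  rcases hi with hi | ⟨j, hj, rfl⟩
  · have := hs hi
    simp only [Naked.arrows, Finset.mem_filter] at this
    simp [this.2]
  · have := hs hj
    simp only [Naked.arrows, Finset.mem_filter] at this
    simp [D.dir_partner, this.2]

theorem Naked.card_ends {n : ℕ} (D : Naked n) {s : Finset (Pt n)} (hs : s ⊆ D.arrows) {m : ℕ}
    (hm : s.card = m + 1) : (D.ends s).card = size (m + 1) := by
  have hinj : Function.Injective D.partner := fun a b h => by
    rw [← D.partner_partner a, h, D.partner_partner]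
  have hdisj : Disjoint s (s.image D.partner) := by
    rw [Finset.disjoint_left]
    intro a ha hb
    obtain ⟨b, hb', rfl⟩ := Finset.mem_image.1 hb
    have h1 := hs ha
    have h2 := hs hb'
    simp only [Naked.arrows, Finset.mem_filter, D.dir_partner] at h1 h2
    rw [h2.2] at h1
    exact absurd h1.2 (by decide)
  rw [Naked.ends, Finset.card_union_of_disjoint hdisj, Finset.card_image_of_injective _ hinj, hm,
    size]
  omega

/-- The subdiagram with `m` given arrows. The points that remain are numbered again in increasing
order; the edges that merge are decorated by the product of their decorations, and only the
conjugacy class of this product is kept if no arrow is left. -/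
noncomputable def RigidGauss.subAux {n : ℕ} (G : RigidGauss π n) (s : Finset (Pt n))
    (hs : s ⊆ G.arrows) : (m : ℕ) → s.card = m → RigidGauss π m
  | 0, _ =>
    { partner := id
      dir := fun _ => 0
      partner_partner := fun _ => rfl
      dir_partner := fun _ => by simp
      dir_eq_zero := fun _ => by simp
      mark := (G.mark.total : ConjClasses π)
      writhe := fun _ => 0
      writhe_partner := fun _ => rfl
      writhe_eq_zero := fun _ => by simp }
  | m + 1, hm =>
    let ι : Pt (m + 1) ≃o G.ends s := (G.ends s).orderIsoOfFin (G.card_ends hs hm)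
    { partner := fun j => ι.symm ⟨G.partner (ι j), G.partner_mem_ends s (ι j).2⟩
      dir := fun j => G.dir (ι j)
      partner_partner := fun j => by simp [G.partner_partner]
      dir_partner := fun j => by simp [G.dir_partner]
      dir_eq_zero := fun j => by simpa using G.dir_ne_zero_of_mem_ends hs (ι j).2
      mark := fun j : Pt (m + 1) =>
        ((List.range ((ι (j + 1) : Pt n) - (ι j : Pt n)).val).map fun k =>
          G.mark.at ((ι j : Pt n) + Fin.ofNat (size n) k)).prod
      writhe := fun j => G.writhe (ι j)
      writhe_partner := fun j => by simp [G.writhe_partner]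
      writhe_eq_zero := fun j => by
        have h := G.dir_ne_zero_of_mem_ends hs (ι j).2
        rw [Ne, G.dir_eq_zero] at h
        simpa [G.writhe_eq_zero] using h }

/-- The subdiagram consisting of the arrows in `s`. -/
noncomputable def RigidGauss.sub {n : ℕ} (G : RigidGauss π n) (s : Finset (Pt n))
    (hs : s ⊆ G.arrows) : RigidGauss π s.card :=
  G.subAux s hs s.card rfl

/-- Remove the arrows in `s`. -/
noncomputable def RigidGauss.remove {n : ℕ} (G : RigidGauss π n) (s : Finset (Pt n)) :
    RigidGauss π (G.arrows \ s).card :=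
  G.sub (G.arrows \ s) Finset.sdiff_subset

/-- The sum of all subdiagrams. -/
noncomputable def subdiagramSum {n : ℕ} (G : RigidGauss π n) : GaussSpace π :=
  ∑ s ∈ G.arrows.powerset.attach,
    Finsupp.single
      (⟨s.1.card, diag (G.sub s.1 (Finset.mem_powerset.1 s.2))⟩ : Σ n : ℕ, GaussDiagram π n) 1

/-! ### Moves -/

/-- The edge `e` lies on the arc that goes, along the orientation of the circle, from the point
`i` to the other end of its arrow. -/
def Naked.OnArc {n : ℕ} (D : Naked n) (i e : Pt n) : Prop := e - i < D.partner i - i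

instance {n : ℕ} (D : Naked n) (i e : Pt n) : Decidable (D.OnArc i e) :=
  inferInstanceAs (Decidable (e - i < D.partner i - i))

/-- The arrows ending at `i` and `j` (two different arrows) intersect: exactly one end of the
second one lies on the arc from `i` to the other end of the first one. -/
def Naked.Cross {n : ℕ} (D : Naked n) (i j : Pt n) : Prop :=
  j ≠ i ∧ j ≠ D.partner i ∧ ¬ (D.OnArc i j ↔ D.OnArc i (D.partner j))

instance {n : ℕ} (D : Naked n) (i j : Pt n) : Decidable (D.Cross i j) :=
  inferInstanceAs (Decidable (j ≠ i ∧ j ≠ D.partner i ∧ ¬ (D.OnArc i j ↔ D.OnArc i (D.partner j))))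

/-- The number of arrowheads at the boundary of the edge `e`. -/
def Naked.heads {n : ℕ} (D : Naked n) (e : Pt n) : ℕ :=
  (if D.dir e = -1 then 1 else 0) + (if D.dir (e + 1) = -1 then 1 else 0)

/-- The sign `ε` of the edge `e`. -/
def Naked.eps {n : ℕ} (D : Naked n) (e : Pt n) : ℤ :=
  (if D.Cross e (e + 1) then 1 else -1) * (-1) ^ D.heads e

/-- The product of the signs of the two arrows at the boundary of the edge `e`. -/
def RigidGauss.edgeWrithe {n : ℕ} (G : RigidGauss π n) (e : Pt n) : ℤ :=
  (G.writhe e : ℤ) * (G.writhe (e + 1) : ℤ)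

/-- Move the arrow ends by a permutation of the points, keeping the decorations of the edges. -/
def RigidGauss.permute {n : ℕ} (G : RigidGauss π n) (σ : Equiv.Perm (Pt n)) : RigidGauss π n where
  partner i := σ (G.partner (σ.symm i))
  dir i := G.dir (σ.symm i)
  partner_partner i := by simp [G.partner_partner]
  dir_partner i := by simp [G.dir_partner]
  dir_eq_zero i := G.dir_eq_zero _
  mark := G.mark
  writhe i := G.writhe (σ.symm i)
  writhe_partner i := by simp [G.writhe_partner]
  writhe_eq_zero i := G.writhe_eq_zero _

/-- The conjugacy move by `g` on the arrow with ends `i` and `partner i`: the incoming edges are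
multiplied by `g` on the right, the outgoing edges by `g⁻¹` on the left, and the arrow is reversed
if and only if `w g = -1`. -/
def RigidGauss.conjugate (w : π →* ℤˣ) {n : ℕ} (G : RigidGauss π n) (i : Pt n) (g : π) :
    RigidGauss π n where
  partner := G.partner
  dir j := if (j = i ∨ j = G.partner i) ∧ w g = -1 then -G.dir j else G.dir j
  partner_partner := G.partner_partner
  dir_partner j := by
    have h1 : G.partner j = G.partner i ↔ j = i :=
      ⟨fun h => by rw [← G.partner_partner j, h, G.partner_partner], fun h => by rw [h]⟩
    have h2 : G.partner j = i ↔ j = G.partner i :=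
      ⟨fun h => by rw [← h, G.partner_partner], fun h => by rw [h, G.partner_partner]⟩
    have h3 : ((G.partner j = i ∨ G.partner j = G.partner i) ∧ w g = -1) ↔
        ((j = i ∨ j = G.partner i) ∧ w g = -1) := by rw [h1, h2, or_comm]
    by_cases h : (j = i ∨ j = G.partner i) ∧ w g = -1
    · rw [if_pos h, if_pos (h3.2 h), G.dir_partner]
    · rw [if_neg h, if_neg (fun h' => h (h3.1 h')), G.dir_partner]
  dir_eq_zero j := by
    split_ifs
    · rw [← G.dir_eq_zero j]; cases G.dir j <;> decide
    · exact G.dir_eq_zero j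
  mark := G.mark.modify fun e x =>
    (if e = i ∨ e = G.partner i then g⁻¹ else 1) * x *
      (if e + 1 = i ∨ e + 1 = G.partner i then g else 1)
  writhe := G.writhe
  writhe_partner := G.writhe_partner
  writhe_eq_zero := G.writhe_eq_zero

/-- The arrow with tail `a` is isolated and surrounds an edge decorated by `1`. -/
def RigidGauss.IsR1 {n : ℕ} (G : RigidGauss π n) (a : Pt n) : Prop :=
  a ∈ G.arrows ∧
    ((G.partner a = a + 1 ∧ G.mark.at a = 1) ∨
      (a = G.partner a + 1 ∧ G.mark.at (G.partner a) = 1))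

/-- The arrows with tails `a` and `b` have opposite signs, their tails are consecutive as well as
their heads, and the two surrounded edges are decorated by `1`. -/
def RigidGauss.IsR2 {n : ℕ} (G : RigidGauss π n) (a b : Pt n) : Prop :=
  a ∈ G.arrows ∧ b ∈ G.arrows ∧ a ≠ b ∧ G.writhe a = -G.writhe b ∧
    (b = a + 1 ∧ G.mark.at a = 1) ∧
    ((G.partner b = G.partner a + 1 ∧ G.mark.at (G.partner a) = 1) ∨
      (G.partner a = G.partner b + 1 ∧ G.mark.at (G.partner b) = 1))

/-- The three disjoint edges `e 0`, `e 1`, `e 2` are decorated by `1`, each two of them are joined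
by an arrow, the product of the signs `w` and `ε` is the same for all three, and their numbers of
arrowheads are pairwise different. -/
def RigidGauss.IsR3 {n : ℕ} (G : RigidGauss π n) (e : Fin 3 → Pt n) : Prop :=
  Function.Injective (fun p : Fin 3 × Bool => if p.2 then e p.1 + 1 else e p.1) ∧
  (∀ k, G.mark.at (e k) = 1) ∧
  (∀ k l, k ≠ l → ∃ a, (a = e k ∨ a = e k + 1) ∧
    (G.partner a = e l ∨ G.partner a = e l + 1)) ∧
  (∀ k l, G.edgeWrithe (e k) * G.eps (e k) = G.edgeWrithe (e l) * G.eps (e l)) ∧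
  (∀ k l, k ≠ l → G.heads (e k) ≠ G.heads (e l))

/-- Exchange the two ends of each of three edges. -/
def swapEnds {n : ℕ} (e : Fin 3 → Pt n) : Equiv.Perm (Pt n) :=
  Equiv.swap (e 0) (e 0 + 1) * Equiv.swap (e 1) (e 1 + 1) * Equiv.swap (e 2) (e 2 + 1)

/-- Rotations, Reidemeister moves and conjugacy moves on Gauss diagrams on the weighted group
`(π, w)`, on rigid representatives. -/
inductive Move (w : π →* ℤˣ) : (Σ n : ℕ, RigidGauss π n) → (Σ n : ℕ, RigidGauss π n) → Prop
  | rotate {n : ℕ} (G : RigidGauss π n) (k : Rot n) : Move w ⟨n, G⟩ ⟨n, k • G⟩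
  | r1 {n : ℕ} (G : RigidGauss π n) (a : Pt n) (h : G.IsR1 a) :
      Move w ⟨n, G⟩ ⟨_, G.remove {a}⟩
  | r2 {n : ℕ} (G : RigidGauss π n) (a b : Pt n) (h : G.IsR2 a b) :
      Move w ⟨n, G⟩ ⟨_, G.remove {a, b}⟩
  | r3 {n : ℕ} (G : RigidGauss π n) (e : Fin 3 → Pt n) (h : G.IsR3 e) :
      Move w ⟨n, G⟩ ⟨n, G.permute (swapEnds e)⟩
  | conj {n : ℕ} (G : RigidGauss π n) (i : Pt n) (hi : i ∈ G.arrows) (g : π) :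
      Move w ⟨n, G⟩ ⟨n, G.conjugate w i g⟩

/-- Virtual knot types on the weighted group `(π, w)`: the quotient by the equivalence relation
generated by the moves. -/
def VirtualKnot (w : π →* ℤˣ) : Type u := Quot (Move w)

/-- The virtual knot type of a Gauss diagram. -/
def knotType (w : π →* ℤˣ) {n : ℕ} (G : RigidGauss π n) : VirtualKnot w := Quot.mk _ ⟨n, G⟩

/-- `𝒢` is a Gauss diagram formula: the weighted count of subdiagrams defines an invariant of
virtual knots. -/
def IsGaussDiagramFormula (w : π →* ℤˣ) (𝒢 : GaussSeries π) : Prop :=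
  ∃ ν : VirtualKnot w → ℚ, ∀ (n : ℕ) (G : RigidGauss π n),
    ν (knotType w G) = pairing 𝒢 (subdiagramSum G)

/-- An arrow diagram formula is a Gauss diagram formula that comes from an arrow series. -/
def IsArrowDiagramFormula (w : π →* ℤˣ) (𝒢 : GaussSeries π) : Prop :=
  IsGaussDiagramFormula w 𝒢 ∧ 𝒢 ∈ Set.range (signedSymPres (π := π))

end Formulas

/-! ### Planar diagrams -/

/-- No two arrows intersect. -/
def Naked.Planar {n : ℕ} (D : Naked n) : Prop := ∀ i j, ¬ D.Cross i j

/-- The edges `e` and `f` are not separated by any arrow. In a planar diagram this means that they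
lie at the boundary of the same complementary region of the arrows in the disc, and the regions
are the equivalence classes. -/
def Naked.SameRegion {n : ℕ} (D : Naked n) (e f : Pt n) : Prop :=
  ∀ i, D.OnArc i e ↔ D.OnArc i f

instance {n : ℕ} (D : Naked n) (e f : Pt n) : Decidable (D.SameRegion e f) :=
  inferInstanceAs (Decidable (∀ i, D.OnArc i e ↔ D.OnArc i f))

theorem Naked.onArc_rotate {n : ℕ} (D : Naked n) (k i e : Pt n) :
    (D.rotate k).OnArc i e ↔ D.OnArc (i - k) (e - k) := by
  simp only [Naked.OnArc, Naked.rotate]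
  have h1 : e - k - (i - k) = e - i := by abel
  have h2 : D.partner (i - k) - (i - k) = D.partner (i - k) + k - i := by abel
  rw [h1, h2]

theorem Naked.sameRegion_rotate {n : ℕ} (D : Naked n) (k e f : Pt n) :
    (D.rotate k).SameRegion e f ↔ D.SameRegion (e - k) (f - k) := by
  simp only [Naked.SameRegion, Naked.onArc_rotate]
  exact ⟨fun h i => by simpa using h (i + k), fun h i => h _⟩

theorem Naked.Planar.rotate {n : ℕ} {D : Naked n} (h : D.Planar) (k : Pt n) :
    (D.rotate k).Planar := by
  intro i j hc
  apply h (i - k) (j - k)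
  obtain ⟨h1, h2, h3⟩ := hc
  refine ⟨fun h => h1 (sub_left_injective h), fun h => h2 ?_, fun h => h3 ?_⟩
  · simp only [Naked.rotate]; rw [← h]; abel
  · rw [Naked.onArc_rotate, Naked.onArc_rotate]
    simpa [Naked.rotate] using h

section Planar

variable {π : Type u} [Group π]

/-- A rigid planar arrow diagram on `π`. -/
def PlanarArrow (π : Type u) [Group π] (n : ℕ) : Type u := {A : RigidArrow π n // A.Planar}

instance (n : ℕ) : MulAction (Rot n) (PlanarArrow π n) where
  smul k A := ⟨k • A.1, A.2.rotate k.toAdd⟩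
  one_smul A := Subtype.ext (one_smul _ A.1)
  mul_smul k l A := Subtype.ext (mul_smul k l A.1)

/-- The inclusion of planar arrow diagrams into arrow diagrams. -/
def planarIncl (π : Type u) [Group π] (n : ℕ) : PlanarArrow π n →[Rot n] RigidArrow π n where
  toFun A := A.1
  map_smul' _ _ := rfl

/-- A rigid planar naked diagram with a conjugacy class assigned to each region, as a function of
the edges at the boundary of the region. -/
@[ext]
structure Decorated (π : Type u) [Group π] (n : ℕ) extends Naked n where
  planar : toNaked.Planar
  label : Pt n → ConjClasses π
  label_eq : ∀ e f, toNaked.SameRegion e f → label e = label f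

theorem Decorated.ext_naked {n : ℕ} {D E : Decorated π n} (h : D.toNaked = E.toNaked)
    (h' : D.label = E.label) : D = E := by
  obtain ⟨A, _, v, _⟩ := D
  obtain ⟨B, _, v', _⟩ := E
  simp only at h h'
  subst h h'
  rfl

instance (n : ℕ) : MulAction (Rot n) (Decorated π n) where
  smul k D :=
    { toNaked := k • D.toNaked
      planar := D.planar.rotate k.toAdd
      label := fun e => D.label (e - k.toAdd)
      label_eq := fun _ _ h => D.label_eq _ _ ((D.toNaked.sameRegion_rotate _ _ _).1 h) }
  one_smul D := Decorated.ext_naked (one_smul _ D.toNaked)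
    (funext fun i => congrArg D.label (sub_zero i))
  mul_smul k l D := Decorated.ext_naked (mul_smul k l D.toNaked)
    (funext fun i => congrArg D.label (sub_sub i k.toAdd l.toAdd).symm)

/-- A rigid chain presentation of a planar naked diagram of degree `n`: a numbering of the regions
from `0` to `n`, increasing from the left to the right of each arrow. The circle is oriented
counterclockwise, so the edge that ends at the tail of an arrow is on its left, and the edge that
starts at the tail is on its right. -/
@[ext]
structure Chain (n : ℕ) extends Naked n where
  planar : toNaked.Planar
  num : Pt n → Fin (n + 1)
  num_eq : ∀ e f, num e = num f ↔ toNaked.SameRegion e f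
  num_surjective : Function.Surjective num
  num_lt : ∀ t, dir t = 1 → num (t - 1) < num t

theorem Chain.ext_naked {n : ℕ} {C C' : Chain n} (h : C.toNaked = C'.toNaked)
    (h' : C.num = C'.num) : C = C' := by
  obtain ⟨A, _, v, _, _, _⟩ := C
  obtain ⟨B, _, v', _, _, _⟩ := C'
  simp only at h h'
  subst h h'
  rfl

instance (n : ℕ) : MulAction (Rot n) (Chain n) where
  smul k C :=
    { toNaked := k • C.toNaked
      planar := C.planar.rotate k.toAdd
      num := fun e => C.num (e - k.toAdd)
      num_eq := fun e f => (C.num_eq _ _).trans (C.toNaked.sameRegion_rotate _ _ _).symm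
      num_surjective := C.num_surjective.comp (Equiv.subRight k.toAdd).surjective
      num_lt := fun t ht => by
        have h := C.num_lt (t - k.toAdd) ht
        rwa [sub_right_comm] at h }
  one_smul C := Chain.ext_naked (one_smul _ C.toNaked)
    (funext fun i => congrArg C.num (sub_zero i))
  mul_smul k l C := Chain.ext_naked (mul_smul k l C.toNaked)
    (funext fun i => congrArg C.num (sub_sub i k.toAdd l.toAdd).symm)

instance (n : ℕ) : Finite (Chain n) :=
  Finite.of_injective (fun C : Chain n => (C.partner, C.dir, C.num)) (by
    intro C C' h
    simp only [Prod.mk.injEq] at h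
    exact Chain.ext_naked (Naked.ext h.1 h.2.1) h.2.2)

instance (n : ℕ) : Finite (Diag (Rot n) (Chain n)) := Quotient.finite _

/-- The edges at the boundary of the region of `e`, in the order of the circle, starting
from `e`. -/
def Naked.regionEdges {n : ℕ} (D : Naked n) (e : Pt n) : List (Pt n) :=
  ((List.finRange (size n)).map (e + ·)).filter fun f => decide (D.SameRegion e f)

/-- The conjugacy class of the product of the decorations at the boundary of the region of `e`,
in the order of the circle. -/
def RigidArrow.regionClass : {n : ℕ} → RigidArrow π n → Pt n → ConjClasses π
  | 0, A, _ => A.mark.total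
  | _ + 1, A, e => ConjClasses.mk ((A.regionEdges e).map A.mark.at).prod

theorem map_add_finRange_isRotated (N : ℕ) [NeZero N] (e f : Fin N) :
    ((List.finRange N).map (e + ·)).IsRotated ((List.finRange N).map (f + ·)) := by
  refine ⟨(f - e).val, List.ext_getElem (by simp) fun i h1 h2 => ?_⟩
  have hN : i < N := by simpa using h2
  simp only [List.getElem_rotate, List.getElem_map, List.getElem_finRange, List.length_map,
    List.length_finRange]
  have : (⟨(i + (f - e).val) % N, Nat.mod_lt _ (NeZero.pos N)⟩ : Fin N) = ⟨i, hN⟩ + (f - e) :=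
    Fin.ext (by rw [Fin.val_add])
  calc e + (⟨(i + (f - e).val) % N, _⟩ : Fin N) = e + (⟨i, hN⟩ + (f - e)) := by rw [this]
    _ = f + ⟨i, hN⟩ := by abel

theorem conjClasses_prod_of_isRotated {l l' : List π} (h : l.IsRotated l') :
    ConjClasses.mk l.prod = ConjClasses.mk l'.prod := by
  obtain ⟨k, rfl⟩ := h
  rw [ConjClasses.mk_eq_mk_iff_isConj, isConj_iff]
  rw [List.rotate_eq_drop_append_take_mod, List.prod_append]
  conv in l.prod => rw [← List.take_append_drop (k % l.length) l, List.prod_append]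
  exact ⟨((l.take (k % l.length)).prod)⁻¹, by group⟩

theorem filter_isRotated {α : Type*} (p : α → Bool) {l l' : List α} (h : l.IsRotated l') :
    (l.filter p).IsRotated (l'.filter p) := by
  obtain ⟨k, rfl⟩ := h
  rw [List.rotate_eq_drop_append_take_mod, List.filter_append]
  conv in l.filter p => rw [← List.take_append_drop (k % l.length) l, List.filter_append]
  exact List.isRotated_append

theorem RigidArrow.regionClass_eq {n : ℕ} (A : RigidArrow π n) (e f : Pt n)
    (h : A.SameRegion e f) : A.regionClass e = A.regionClass f := by
  cases n with
  | zero => rfl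
  | succ n =>
    apply conjClasses_prod_of_isRotated
    apply List.IsRotated.map
    have hp : (fun g => decide (A.SameRegion e g)) = fun g => decide (A.SameRegion f g) := by
      funext g
      exact decide_eq_decide.2
        ⟨fun h' i => (h i).symm.trans (h' i), fun h' i => (h i).trans (h' i)⟩
    rw [Naked.regionEdges, Naked.regionEdges, hp]
    exact filter_isRotated _ (map_add_finRange_isRotated _ e f)

theorem RigidArrow.regionClass_smul {n : ℕ} (k : Rot n) (A : RigidArrow π n) (e : Pt n) :
    (k • A).regionClass e = A.regionClass (e - k.toAdd) := by
  cases n with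
  | zero => rfl
  | succ n =>
    have h : (A.regionEdges (e - k.toAdd)) =
        ((k • A).regionEdges e).map (fun f => f - k.toAdd) := by
      have h1 : (List.finRange (size (n + 1))).map (e - k.toAdd + ·) =
          ((List.finRange (size (n + 1))).map (e + ·)).map (fun f => f - k.toAdd) := by
        rw [List.map_map]
        exact List.map_congr_left fun i _ => sub_add_eq_add_sub _ _ _
      rw [Naked.regionEdges, Naked.regionEdges, h1, List.filter_map]
      congr 2
      funext f
      exact decide_eq_decide.2 (A.toNaked.sameRegion_rotate k.toAdd e f).symm
    show ConjClasses.mk _ = ConjClasses.mk _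
    rw [h, List.map_map]
    rfl

/-- A planar arrow diagram on `π` induces a decoration of its regions. -/
def inducedDecoration (π : Type u) [Group π] (n : ℕ) :
    PlanarArrow π n →[Rot n] Decorated π n where
  toFun A :=
    { toNaked := A.1.toNaked
      planar := A.2
      label := A.1.regionClass
      label_eq := A.1.regionClass_eq }
  map_smul' k A := Decorated.ext_naked rfl (funext fun e => A.1.regionClass_smul k e)

/-- Decorate the region number `i` of a chain presentation by `Γ i`. -/
def chainDecoration {n : ℕ} (Γ : Fin (n + 1) → ConjClasses π) :
    Chain n →[Rot n] Decorated π n where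
  toFun C :=
    { toNaked := C.toNaked
      planar := C.planar
      label := fun e => Γ (C.num e)
      label_eq := fun e f h => by rw [(C.num_eq e f).2 h] }
  map_smul' _ _ := rfl

/-- The universal planar chain of degree `n`: the sum of all chain presentations up to rotation. -/
noncomputable def universalChain (n : ℕ) : Diag (Rot n) (Chain n) →₀ ℚ :=
  Finsupp.equivFunOnFinite.symm fun _ => 1

/-- The planar chain `Φ_Γ`: decorate every diagram of the universal planar chain by `Γ`. -/
noncomputable def planarChain {n : ℕ} (Γ : Fin (n + 1) → ConjClasses π) :
    Diag (Rot n) (Decorated π n) →₀ ℚ :=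
  projection (chainDecoration Γ) (universalChain n)

/-- The lifted planar chain: the image of `Φ_Γ` in the formal series of arrow diagrams on `π`,
under the symmetry-preserving map to planar arrow diagrams (extended by zero to all arrow
diagrams). It is homogeneous of degree `n`. -/
noncomputable def liftedPlanarChain {n : ℕ} (Γ : Fin (n + 1) → ConjClasses π) : ArrowSeries π :=
  DFinsupp.single n
    (Function.extend (forget (planarIncl π n))
      (symPres (inducedDecoration π n) ⇑(planarChain Γ)) 0)

end Planar

end GaussKnot

/-!
A state of a Gauss diagram is a coloring of its edges by the numbers `1, …, n + 1` that, at each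
arrow, either does not change or is smoothed, with a smaller color to the left of the arrow than to
its right; it must have exactly `n` jumps, and the products of the decorations along the color
classes must represent the conjugacy classes `γ_i`. The arrows at which the color jumps are those
of a subdiagram of degree `n`, and the colors are the numbers of its regions. Hence the pairing with
the planar chain series is the state sum, in which a state is weighted by the product of the signs
of its jumps, and it remains to see that the state sum is invariant under each move.

Since every `γ_i` is non-trivial, all colors occur. A surjective coloring with one color more than
jumps makes the colors the vertices of a tree whose edges are the jumps: no two arrows that jump
intersect, and no two of them connect the same colors. Moreover, an edge decorated by `1` cannot
have a color of its own. These facts leave few states near a move. Those in which no moved edge has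
jumps at both of its ends are matched by carrying each jump along with its arrow. In the second
Reidemeister move the other states cancel in pairs because the signs of the two arrows are opposite.
In the third one, two of the three arrows jump; each of the three pairs of arrows contributes a
combination of the same four sums over colorings outside the triangle, and the sign conditions on
the edges of the triangle say precisely that the contributions change by quantities that add up to
zero.
-/

namespace GaussKnot

/-! ### The circle -/

section Circle

variable {M : ℕ}

theorem fin_val_sub (a b : Fin M) :
    (a - b).val = if b.val ≤ a.val then a.val - b.val else M + a.val - b.val := by
  split_ifs with h
  · exact Fin.sub_val_of_le h
  · exact Fin.coe_sub_iff_lt.2 (not_le.1 h)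

theorem ofNat_add [NeZero M] (a b : ℕ) :
    Fin.ofNat M (a + b) = Fin.ofNat M a + Fin.ofNat M b := by
  ext
  simp [Fin.val_add]

variable [NeZero M]

theorem fin_val_pred (a : Fin M) : (a - 1).val = if a = 0 then M - 1 else a.val - 1 := by
  obtain ⟨m, rfl⟩ := Nat.exists_eq_succ_of_ne_zero (NeZero.ne M)
  exact Fin.coe_sub_one a

theorem fin_cyclic_induction {P : Fin M → Prop} {j : Fin M} (base : P j)
    (step : ∀ i, P (i - 1) → P i) (i : Fin M) : P i := by
  suffices key : ∀ k : ℕ, P (j + Fin.ofNat M k) by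
    simpa only [Fin.ofNat_val_eq_self, add_sub_cancel] using key (i - j).val
  intro k
  induction k with
  | zero => simpa using base
  | succ k ih =>
    refine step _ ?_
    rwa [ofNat_add, ← add_assoc, show Fin.ofNat M 1 = 1 from rfl, add_sub_cancel_right]

end Circle

theorem size_eq {N : ℕ} (hN : N ≠ 0) : size N = 2 * N := by
  unfold size
  omega

instance : Subsingleton (Pt 0) := inferInstanceAs (Subsingleton (Fin 1))

namespace Naked

section Arcs

variable {N : ℕ} (D : Naked N)

theorem dir_ne_zero (hN : N ≠ 0) (i : Pt N) : D.dir i ≠ 0 := fun h => hN ((D.dir_eq_zero i).1 h)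

theorem mem_arrows {t : Pt N} : t ∈ D.arrows ↔ D.dir t = 1 := by simp [arrows]

variable {D} in
theorem dir_ne_zero_of_tail {t : Pt N} (ht : D.dir t = 1) : D.dir t ≠ 0 := by
  rw [ht]
  decide

variable {D} in
theorem ne_zero_of_tail {t : Pt N} (ht : D.dir t = 1) : N ≠ 0 :=
  mt (D.dir_eq_zero t).2 (dir_ne_zero_of_tail ht)

theorem dir_partner_ne_zero {i : Pt N} (hi : D.dir i ≠ 0) : D.dir (D.partner i) ≠ 0 := fun h =>
  hi ((D.dir_eq_zero i).2 ((D.dir_eq_zero _).1 h))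

theorem partner_ne {i : Pt N} (hi : D.dir i ≠ 0) : D.partner i ≠ i := by
  intro h
  have hdir := D.dir_partner i
  rw [h] at hdir
  revert hdir hi
  cases D.dir i <;> decide

theorem partner_injective : Function.Injective D.partner :=
  Function.Involutive.injective D.partner_partner

theorem partner_eq_comm {i j : Pt N} : D.partner i = j ↔ i = D.partner j :=
  Function.Involutive.eq_iff D.partner_partner

variable {D} in
theorem partner_ne_tail {t t' : Pt N} (ht : D.dir t = 1) (ht' : D.dir t' = 1) :
    D.partner t ≠ t' := by
  rintro rfl
  rw [D.dir_partner, ht] at ht'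
  exact absurd ht' (by decide)

theorem tail_or_tail_partner (hN : N ≠ 0) (i : Pt N) :
    D.dir i = 1 ∨ D.dir (D.partner i) = 1 := by
  have h := D.dir_ne_zero hN i
  rw [D.dir_partner]
  revert h
  cases D.dir i <;> decide

theorem card_arrows : D.arrows.card = N := by
  obtain rfl | hN := eq_or_ne N 0
  · exact Finset.card_eq_zero.2 (Finset.eq_empty_of_forall_notMem fun t ht =>
      ne_zero_of_tail (D.mem_arrows.1 ht) rfl)
  have hunion : D.arrows ∪ D.arrows.image D.partner = Finset.univ := by
    refine Finset.eq_univ_of_forall fun i => ?_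
    rw [Finset.mem_union, Finset.mem_image]
    exact (D.tail_or_tail_partner hN i).imp D.mem_arrows.2 fun h =>
      ⟨_, D.mem_arrows.2 h, D.partner_partner i⟩
  obtain ⟨m, hm⟩ : ∃ m, D.arrows.card = m + 1 := by
    refine Nat.exists_eq_succ_of_ne_zero fun h => ?_
    rw [Finset.card_eq_zero.1 h, Finset.image_empty, Finset.union_empty] at hunion
    exact Finset.notMem_empty (0 : Pt N) (hunion ▸ Finset.mem_univ 0)
  have hcard := D.card_ends subset_rfl hm
  rw [ends, hunion, Finset.card_univ, Fintype.card_fin, size_eq hN, size_eq m.succ_ne_zero] at hcard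
  omega

theorem onArc_self {t : Pt N} (ht : D.dir t ≠ 0) : D.OnArc t t := by
  rw [OnArc, sub_self]
  exact Fin.pos_iff_ne_zero.2 (sub_ne_zero.2 (D.partner_ne ht))

theorem not_onArc_partner (t : Pt N) : ¬ D.OnArc t (D.partner t) := lt_irrefl _

theorem onArc_pred {t i : Pt N} (ht : i ≠ t) (ht' : i ≠ D.partner t) :
    D.OnArc t (i - 1) ↔ D.OnArc t i := by
  rw [OnArc, OnArc, sub_right_comm, Fin.lt_def, Fin.lt_def, fin_val_pred,
    if_neg (sub_ne_zero.2 ht)]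
  have hpartner : (i - t).val ≠ (D.partner t - t).val :=
    fun h => ht' (sub_left_injective (Fin.ext h))
  have hpos : (i - t).val ≠ 0 := fun h => sub_ne_zero.2 ht (Fin.ext h)
  omega

theorem not_onArc_pred_self (t : Pt N) : ¬ D.OnArc t (t - 1) := by
  rw [OnArc, sub_right_comm, sub_self, Fin.lt_def, fin_val_pred, if_pos rfl]
  omega

theorem onArc_pred_partner {t : Pt N} (ht : D.dir t ≠ 0) : D.OnArc t (D.partner t - 1) := by
  have hne : D.partner t - t ≠ 0 := sub_ne_zero.2 (D.partner_ne ht)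
  rw [OnArc, sub_right_comm, Fin.lt_def, fin_val_pred, if_neg hne]
  have hpos : (D.partner t - t).val ≠ 0 := fun h => hne (Fin.ext h)
  omega

theorem onArc_partner {t : Pt N} (ht : D.dir t ≠ 0) (e : Pt N) :
    D.OnArc (D.partner t) e ↔ ¬ D.OnArc t e := by
  have hne : (D.partner t).val ≠ t.val := fun h => D.partner_ne ht (Fin.ext h)
  simp only [OnArc, D.partner_partner, Fin.lt_def, fin_val_sub]
  split_ifs <;> omega

theorem ite_onArc_sub_ite_onArc_pred {t : Pt N} (ht : D.dir t ≠ 0) (x : ℚ) (i : Pt N) :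
    (if D.OnArc t i then x else 0) - (if D.OnArc t (i - 1) then x else 0) =
      (if i = t then x else 0) - (if D.partner i = t then x else 0) := by
  have hpartner : D.partner i = t ↔ i = D.partner t := D.partner_eq_comm
  by_cases hit : i = t
  · subst hit
    simp only [D.onArc_self ht, D.not_onArc_pred_self, D.partner_ne ht, if_true, if_false]
  by_cases hit' : i = D.partner t
  · subst hit'
    simp only [D.not_onArc_partner, D.onArc_pred_partner ht, D.partner_partner, hit, if_true,
      if_false]
  · simp only [D.onArc_pred hit hit', hpartner, hit, hit', if_false, sub_self]

end Arcs

/-! ### Colorings of the edges -/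

section Coloring

variable {N : ℕ} {K : Type*} [LinearOrder K]

/-- The rule at an arrow with colors `l`, `r` before and after its tail and `hl`, `hr` before and
after its head: either the color changes at neither end, or it increases at the tail and the colors
are those of the diagram smoothed at the arrow. -/
def Matches (l r hl hr : K) : Prop := (l = r ∧ hl = hr) ∨ (l < r ∧ hl = r ∧ hr = l)

/-- A coloring of the edges around the arrow with tail `t` that obeys the rule at this arrow. -/
def RuleAt (D : Naked N) (c : Pt N → K) (t : Pt N) : Prop :=
  Matches (c (t - 1)) (c t) (c (D.partner t - 1)) (c (D.partner t))

/-- A coloring of the edges of a diagram by a linearly ordered set that obeys the rule at each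
arrow. These colorings are the states of the model for the planar chain: the arrows at which the
color changes are the arrows of a subdiagram, and the colors number its regions. -/
def IsColoring (D : Naked N) (c : Pt N → K) : Prop := ∀ t, D.dir t = 1 → D.RuleAt c t

/-- The arrows at which the color changes, given by their tails. -/
def jumps (D : Naked N) (c : Pt N → K) : Finset (Pt N) := D.arrows.filter fun t => c (t - 1) ≠ c t

variable {D : Naked N} {c : Pt N → K}

theorem mem_jumps {t : Pt N} : t ∈ D.jumps c ↔ D.dir t = 1 ∧ c (t - 1) ≠ c t := by
  rw [jumps, Finset.mem_filter, D.mem_arrows]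

theorem tail_of_mem_jumps {t : Pt N} (ht : t ∈ D.jumps c) : D.dir t = 1 := (mem_jumps.1 ht).1

omit [LinearOrder K] in
theorem ne_zero_of_pred_ne {i : Pt N} (hi : c (i - 1) ≠ c i) : N ≠ 0 := by
  rintro rfl
  exact hi (congrArg c (Subsingleton.elim _ _))

namespace IsColoring

theorem of_mem_jumps (hc : D.IsColoring c) {t : Pt N} (ht : t ∈ D.jumps c) :
    c (t - 1) < c t ∧ c (D.partner t - 1) = c t ∧ c (D.partner t) = c (t - 1) :=
  (hc t (mem_jumps.1 ht).1).resolve_left fun h => (mem_jumps.1 ht).2 h.1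

theorem pred_eq_or_smooth (hc : D.IsColoring c) (i : Pt N) :
    (c (i - 1) = c i ∧ c (D.partner i - 1) = c (D.partner i)) ∨
    (c (D.partner i - 1) = c i ∧ c (D.partner i) = c (i - 1)) := by
  obtain rfl | hN := eq_or_ne N 0
  · exact Or.inl ⟨congrArg c (Subsingleton.elim _ _), congrArg c (Subsingleton.elim _ _)⟩
  rcases D.tail_or_tail_partner hN i with hi | hi
  · exact (hc i hi).imp_right And.right
  · have h := hc _ hi
    rw [RuleAt, D.partner_partner] at h
    exact h.imp And.symm fun h => ⟨h.2.2.symm, h.2.1.symm⟩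

theorem pred_eq_iff (hc : D.IsColoring c) (i : Pt N) :
    c (i - 1) = c i ↔ c (D.partner i - 1) = c (D.partner i) := by
  rcases hc.pred_eq_or_smooth i with h | h
  · exact iff_of_true h.1 h.2
  · rw [h.1, h.2, eq_comm]

theorem smooth_of_ne (hc : D.IsColoring c) {i : Pt N} (hi : c (i - 1) ≠ c i) :
    c (D.partner i - 1) = c i ∧ c (D.partner i) = c (i - 1) :=
  (hc.pred_eq_or_smooth i).resolve_left fun h => hi h.1

theorem mem_jumps_or_of_ne (hc : D.IsColoring c) {i : Pt N} (hi : c (i - 1) ≠ c i) :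
    i ∈ D.jumps c ∨ D.partner i ∈ D.jumps c := by
  refine (D.tail_or_tail_partner (ne_zero_of_pred_ne hi) i).imp
    (fun h => mem_jumps.2 ⟨h, hi⟩) fun h => mem_jumps.2 ⟨h, ?_⟩
  obtain ⟨h₁, h₂⟩ := hc.smooth_of_ne hi
  rw [h₁, h₂]
  exact hi.symm

theorem sub_pred_eq_ite_sub_ite (hc : D.IsColoring c) (φ : K → ℚ) (i : Pt N) :
    φ (c i) - φ (c (i - 1)) =
      (if i ∈ D.jumps c then φ (c i) - φ (c (i - 1)) else 0) -
        (if D.partner i ∈ D.jumps c then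
          φ (c (D.partner i)) - φ (c (D.partner i - 1)) else 0) := by
  by_cases hi : i ∈ D.jumps c
  · have hi' : D.partner i ∉ D.jumps c := fun h =>
      partner_ne_tail (tail_of_mem_jumps hi) (tail_of_mem_jumps h) rfl
    rw [if_pos hi, if_neg hi', sub_zero]
  by_cases hi' : D.partner i ∈ D.jumps c
  · obtain ⟨-, h₁, h₂⟩ := hc.of_mem_jumps hi'
    rw [D.partner_partner] at h₁ h₂
    rw [if_neg hi, if_pos hi', h₁, h₂]
    ring
  · have heq : c (i - 1) = c i := by
      by_contra h
      exact (hc.mem_jumps_or_of_ne h).elim hi hi'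
    rw [if_neg hi, if_neg hi', heq, sub_self, sub_zero]

/-- A discrete fundamental theorem of calculus: along the circle, a function of the color changes
exactly as the sum of its jumps over the arcs that contain the edge. -/
theorem sub_sum_jumps_eq (hc : D.IsColoring c) (φ : K → ℚ) (e f : Pt N) :
    φ (c e) - ∑ t ∈ D.jumps c, (if D.OnArc t e then φ (c t) - φ (c (t - 1)) else 0) =
      φ (c f) - ∑ t ∈ D.jumps c, (if D.OnArc t f then φ (c t) - φ (c (t - 1)) else 0) := by
  refine fin_cyclic_induction (P := fun i =>
    φ (c i) - ∑ t ∈ D.jumps c, (if D.OnArc t i then φ (c t) - φ (c (t - 1)) else 0) = _)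
    (j := f) rfl (fun i ih => ?_) e
  rw [← ih, sub_eq_sub_iff_sub_eq_sub, hc.sub_pred_eq_ite_sub_ite φ i, ← Finset.sum_sub_distrib,
    Finset.sum_congr rfl fun t ht =>
      D.ite_onArc_sub_ite_onArc_pred (dir_ne_zero_of_tail (tail_of_mem_jumps ht)) _ i,
    Finset.sum_sub_distrib, Finset.sum_ite_eq, Finset.sum_ite_eq]

theorem eq_of_forall_onArc_iff (hc : D.IsColoring c) {e f : Pt N}
    (h : ∀ t ∈ D.jumps c, D.OnArc t e ↔ D.OnArc t f) : c e = c f := by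
  have hφ := hc.sub_sum_jumps_eq (fun k => if k = c f then 1 else 0) e f
  rw [Finset.sum_congr rfl fun t ht => if_congr (h t ht) rfl rfl, sub_left_inj, if_pos rfl] at hφ
  by_contra hne
  exact zero_ne_one ((if_neg hne).symm.trans hφ)

end IsColoring

/-- The jumps of a function of the color. -/
def variation (D : Naked N) (c : Pt N → K) : (K → ℚ) →ₗ[ℚ] (D.jumps c → ℚ) where
  toFun φ t := φ (c t) - φ (c (t - 1))
  map_add' _ _ := funext fun _ => add_sub_add_comm _ _ _ _
  map_smul' _ _ := funext fun _ => (mul_sub _ _ _).symm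

theorem IsColoring.finrank_ker_variation_le (hc : D.IsColoring c) (hs : Function.Surjective c) :
    Module.finrank ℚ (LinearMap.ker (D.variation c)) ≤ 1 := by
  refine finrank_le_one ⟨fun _ => 1, funext fun _ => sub_self _⟩ fun φ =>
    ⟨φ.1 (c 0), Subtype.ext (funext fun k => ?_)⟩
  obtain ⟨e, rfl⟩ := hs k
  have hvar : ∀ t ∈ D.jumps c, φ.1 (c t) - φ.1 (c (t - 1)) = 0 :=
    fun t ht => congrFun (LinearMap.mem_ker.1 φ.2) ⟨t, ht⟩
  have hsum : ∀ f, ∑ t ∈ D.jumps c,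
      (if D.OnArc t f then φ.1 (c t) - φ.1 (c (t - 1)) else 0) = 0 := fun f =>
    Finset.sum_eq_zero fun t ht => by rw [hvar t ht, ite_self]
  have heq := hc.sub_sum_jumps_eq φ.1 0 e
  rw [hsum, hsum, sub_zero, sub_zero] at heq
  simpa using heq

variable [Fintype K]

theorem IsColoring.card_le_card_jumps_add_one (hc : D.IsColoring c) (hs : Function.Surjective c) :
    Fintype.card K ≤ (D.jumps c).card + 1 := by
  have hrank := (D.variation c).finrank_range_add_finrank_ker
  have hker := hc.finrank_ker_variation_le hs
  have hrange := (LinearMap.range (D.variation c)).finrank_le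
  simp only [Module.finrank_fintype_fun_eq_card, Fintype.card_coe] at hrank hrange
  omega

/-- A coloring with all colors and as few jumps as possible: the jumps are then the edges of a tree
whose vertices are the colors. -/
structure IsTreeColoring (D : Naked N) (c : Pt N → K) : Prop where
  coloring : D.IsColoring c
  surjective : Function.Surjective c
  card_jumps : (D.jumps c).card + 1 = Fintype.card K

namespace IsTreeColoring

theorem variation_surjective (hc : D.IsTreeColoring c) : Function.Surjective (D.variation c) := by
  have hrank := (D.variation c).finrank_range_add_finrank_ker
  have hker := hc.coloring.finrank_ker_variation_le hc.surjective
  have hrange := (LinearMap.range (D.variation c)).finrank_le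
  have hcard := hc.card_jumps
  refine LinearMap.range_eq_top.1 (Submodule.eq_top_of_finrank_eq ?_)
  simp only [Module.finrank_fintype_fun_eq_card, Fintype.card_coe] at hrank hrange ⊢
  omega

/-- Some function of the color jumps only at `t`, so that it is the indicator of the arc of `t` up
to a constant. -/
theorem onArc_iff (hc : D.IsTreeColoring c) {t : Pt N} (ht : t ∈ D.jumps c) {e f : Pt N}
    (h : c e = c f) : D.OnArc t e ↔ D.OnArc t f := by
  obtain ⟨φ, hφ⟩ := hc.variation_surjective (Pi.single ⟨t, ht⟩ 1)
  have hsum : ∀ g, ∑ t' ∈ D.jumps c,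
      (if D.OnArc t' g then φ (c t') - φ (c (t' - 1)) else 0) = if D.OnArc t g then 1 else 0 := by
    intro g
    have hjump : ∀ t' ∈ D.jumps c, φ (c t') - φ (c (t' - 1)) = if t' = t then 1 else 0 :=
      fun t' ht' => (congrFun hφ ⟨t', ht'⟩).trans (by simp [Pi.single_apply])
    rw [Finset.sum_eq_single_of_mem t ht fun t' ht' hne => by
      rw [hjump t' ht', if_neg hne, ite_self], hjump t ht, if_pos rfl]
  have heq := hc.coloring.sub_sum_jumps_eq φ e f
  rw [hsum, hsum, h, sub_right_inj] at heq
  by_contra hne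
  by_cases he : D.OnArc t e <;> simp_all

theorem eq_iff (hc : D.IsTreeColoring c) {e f : Pt N} :
    c e = c f ↔ ∀ t ∈ D.jumps c, D.OnArc t e ↔ D.OnArc t f :=
  ⟨fun h _ ht => hc.onArc_iff ht h, hc.coloring.eq_of_forall_onArc_iff⟩

theorem onArc_iff_of_pred_ne (hc : D.IsTreeColoring c) {i : Pt N} (hi : c (i - 1) ≠ c i)
    {e f : Pt N} (h : c e = c f) : D.OnArc i e ↔ D.OnArc i f := by
  rcases hc.coloring.mem_jumps_or_of_ne hi with ht | ht
  · exact hc.onArc_iff ht h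
  · have hdir := D.dir_ne_zero (ne_zero_of_pred_ne hi) i
    rw [← not_iff_not, ← D.onArc_partner hdir, ← D.onArc_partner hdir]
    exact hc.onArc_iff ht h

theorem not_onArc (hc : D.IsTreeColoring c) {i e : Pt N} (hi : c (i - 1) ≠ c i)
    (he : c e = c (i - 1)) : ¬ D.OnArc i e := by
  rw [hc.onArc_iff_of_pred_ne hi he]
  exact D.not_onArc_pred_self i

theorem jump_injective (hc : D.IsTreeColoring c) {t t' : Pt N} (ht : t ∈ D.jumps c)
    (ht' : t' ∈ D.jumps c) (hpred : c (t - 1) = c (t' - 1)) (hcolor : c t = c t') : t = t' := by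
  by_contra hne
  have hdir := tail_of_mem_jumps ht
  have harc := D.onArc_pred (Ne.symm hne) (partner_ne_tail hdir (tail_of_mem_jumps ht')).symm
  rw [← hc.onArc_iff ht hpred, ← hc.onArc_iff ht hcolor] at harc
  exact D.not_onArc_pred_self t (harc.2 (D.onArc_self (dir_ne_zero_of_tail hdir)))

theorem not_cross (hc : D.IsTreeColoring c) {i j : Pt N} (hi : c (i - 1) ≠ c i)
    (hj : c (j - 1) ≠ c j) : ¬ D.Cross i j := by
  rintro ⟨hne, hne', hcross⟩
  rw [← hc.onArc_iff_of_pred_ne hi (hc.coloring.smooth_of_ne hj).1, D.onArc_pred] at hcross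
  · exact hcross Iff.rfl
  · exact fun h => hne' (D.partner_eq_comm.1 h)
  · exact fun h => hne (D.partner_injective h)

end IsTreeColoring

end Coloring

end Naked

/-! ### States -/

namespace Naked

section Full

variable {N : ℕ} {K : Type*} [LinearOrder K] {D : Naked N} {c : Pt N → K}

theorem jumps_eq_arrows (h : (D.jumps c).card = N) : D.jumps c = D.arrows :=
  Finset.eq_of_subset_of_card_le (Finset.filter_subset _ _) (by rw [h, D.card_arrows])

theorem IsColoring.pred_ne (hc : D.IsColoring c) (h : (D.jumps c).card = N) (hN : N ≠ 0)
    (i : Pt N) : c (i - 1) ≠ c i := by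
  have hjump : ∀ {t}, D.dir t = 1 → t ∈ D.jumps c := fun ht =>
    jumps_eq_arrows h ▸ D.mem_arrows.2 ht
  rcases D.tail_or_tail_partner hN i with hi | hi
  · exact (mem_jumps.1 (hjump hi)).2
  · obtain ⟨hlt, hpred, hcolor⟩ := hc.of_mem_jumps (hjump hi)
    rw [D.partner_partner] at hpred hcolor
    rw [hpred, hcolor]
    exact hlt.ne'

theorem IsTreeColoring.planar [Fintype K] (hc : D.IsTreeColoring c) (h : (D.jumps c).card = N) :
    D.Planar := by
  intro i j hij
  have hN : N ≠ 0 := by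
    rintro rfl
    exact hij.1 (Subsingleton.elim _ _)
  exact hc.not_cross (hc.coloring.pred_ne h hN i) (hc.coloring.pred_ne h hN j) hij

theorem IsTreeColoring.eq_iff_sameRegion [Fintype K] (hc : D.IsTreeColoring c)
    (h : (D.jumps c).card = N) (e f : Pt N) : c e = c f ↔ D.SameRegion e f := by
  rw [hc.eq_iff, jumps_eq_arrows h]
  refine ⟨fun harc i => ?_, fun harc t _ => harc t⟩
  obtain rfl | hN := eq_or_ne N 0
  · rw [Subsingleton.elim e f]
  rcases D.tail_or_tail_partner hN i with hi | hi
  · exact harc i (D.mem_arrows.2 hi)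
  · have hpartner := harc _ (D.mem_arrows.2 hi)
    rwa [D.onArc_partner (D.dir_ne_zero hN i), D.onArc_partner (D.dir_ne_zero hN i),
      not_iff_not] at hpartner

end Full

section Planar

variable {N : ℕ} {D : Naked N}

theorem Planar.onArc_iff (h : D.Planar) {i j : Pt N} (hij : j ≠ i) (hij' : j ≠ D.partner i) :
    D.OnArc i j ↔ D.OnArc i (D.partner j) :=
  not_not.1 fun hcross => h i j ⟨hij, hij', hcross⟩

theorem Planar.sameRegion_pred_partner (h : D.Planar) {t : Pt N} (ht : D.dir t ≠ 0) :
    D.SameRegion (D.partner t - 1) t := by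
  intro i
  by_cases hti : t = i
  · subst hti
    exact iff_of_true (D.onArc_pred_partner ht) (D.onArc_self ht)
  by_cases hti' : D.partner t = i
  · subst hti'
    rw [D.onArc_partner ht, D.onArc_partner ht]
    exact iff_of_false (not_not.2 (D.onArc_pred_partner ht)) (not_not.2 (D.onArc_self ht))
  · rw [h.onArc_iff hti fun h' => hti' (D.partner_eq_comm.2 h')]
    exact D.onArc_pred hti' fun h' => hti (D.partner_injective h')

end Planar

end Naked

theorem Chain.isColoring {n : ℕ} (C : Chain n) : C.toNaked.IsColoring C.num := by
  intro t ht
  have hdir := Naked.dir_ne_zero_of_tail ht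
  have hhead := (C.num_eq _ _).2
    (C.planar.sameRegion_pred_partner (C.toNaked.dir_partner_ne_zero hdir))
  rw [C.partner_partner] at hhead
  exact Or.inr ⟨C.num_lt t ht, (C.num_eq _ _).2 (C.planar.sameRegion_pred_partner hdir), hhead.symm⟩

section ColorProd

variable {π : Type*} [Group π] {K : Type*} [DecidableEq K]

namespace Marking

/-- The conjugacy class of the product of the decorations of the edges of color `k`, in the order
of the circle. -/
def colorProd : {N : ℕ} → Marking π N → (Pt N → K) → K → ConjClasses π
  | 0, x, c, k => if c 0 = k then x else ConjClasses.mk 1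
  | N + 1, μ, c, k =>
    ConjClasses.mk ((List.finRange (size (N + 1))).map fun e => if c e = k then μ e else 1).prod

variable {N : ℕ}

theorem colorProd_of_ne (μ : Marking π N) {c : Pt N → K} {k : K} (h : ∀ e, c e ≠ k) :
    μ.colorProd c k = ConjClasses.mk 1 := by
  cases N with
  | zero => exact if_neg (h 0)
  | succ N => simp [colorProd, h]

theorem surjective_of_colorProd_ne {μ : Marking π N} {c : Pt N → K}
    (h : ∀ k, μ.colorProd c k ≠ ConjClasses.mk 1) : Function.Surjective c := fun k => by
  by_contra! hk
  exact h k (μ.colorProd_of_ne hk)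

theorem colorProd_of_at_eq_one (hN : N ≠ 0) (μ : Marking π N) {c : Pt N → K} {k : K}
    (h : ∀ e, c e = k → μ.at e = 1) : μ.colorProd c k = ConjClasses.mk 1 := by
  cases N with
  | zero => exact absurd rfl hN
  | succ N =>
    refine congrArg ConjClasses.mk (List.prod_eq_one ?_)
    simp only [List.mem_map, forall_exists_index, and_imp]
    rintro _ e - rfl
    exact ite_eq_right_iff.2 (h e)

theorem colorProd_congr (hN : N ≠ 0) (μ : Marking π N) {c c' : Pt N → K}
    (h : ∀ e, c e ≠ c' e → μ.at e = 1) (k : K) : μ.colorProd c k = μ.colorProd c' k := by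
  cases N with
  | zero => exact absurd rfl hN
  | succ N =>
    simp only [colorProd]
    congr 3
    funext e
    by_cases he : c e = c' e
    · rw [he]
    · rw [show μ e = 1 from h e he, ite_self, ite_self]

end Marking

theorem list_prod_map_filter {α M : Type*} [Monoid M] (l : List α) (p : α → Bool) (f : α → M) :
    ((l.filter p).map f).prod = (l.map fun x => if p x then f x else 1).prod := by
  induction l with
  | nil => rfl
  | cons a l ih => by_cases h : p a <;> simp [h, ih]

theorem RigidArrow.regionClass_eq_colorProd {N : ℕ} (A : RigidArrow π N) {c : Pt N → K}
    (h : ∀ e f, c e = c f ↔ A.SameRegion e f) (e : Pt N) :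
    A.regionClass e = A.mark.colorProd c (c e) := by
  cases N with
  | zero => exact (if_pos (congrArg c (Subsingleton.elim _ _))).symm
  | succ N =>
    change ConjClasses.mk _ = ConjClasses.mk _
    rw [Naked.regionEdges, list_prod_map_filter]
    refine conjClasses_prod_of_isRotated ?_
    convert (map_add_finRange_isRotated (size (N + 1)) e 0).map
      fun x => if decide (A.SameRegion e x) = true then A.mark.at x else 1 using 1
    rw [List.map_map]
    refine List.map_congr_left fun x _ => ?_
    simp only [Function.comp, zero_add, decide_eq_true_eq, ← h, eq_comm (a := c e)]
    rfl

end ColorProd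

section State

variable {π : Type*} [Group π] {K : Type*} [LinearOrder K]

/-- The product of the signs of the jumps. -/
def RigidGauss.weight {N : ℕ} (G : RigidGauss π N) (c : Pt N → K) : ℚ :=
  ∏ t ∈ G.jumps c, (G.writhe t : ℚ)

variable [Fintype K]

namespace RigidArrow

/-- A state: a coloring of the edges with as many jumps as a tree on the set of colors has edges,
such that the products of the decorations of the color classes are prescribed. -/
structure IsState {N : ℕ} (A : RigidArrow π N) (Γ : K → ConjClasses π) (c : Pt N → K) :
    Prop where
  coloring : A.IsColoring c
  card_jumps : (A.jumps c).card + 1 = Fintype.card K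
  colorProd : ∀ k, A.mark.colorProd c k = Γ k

theorem IsState.isTreeColoring {N : ℕ} {A : RigidArrow π N} {Γ : K → ConjClasses π}
    {c : Pt N → K} (h : A.IsState Γ c) (hΓ : ∀ k, Γ k ≠ ConjClasses.mk 1) :
    A.IsTreeColoring c where
  coloring := h.coloring
  surjective := Marking.surjective_of_colorProd_ne fun k => h.colorProd k ▸ hΓ k
  card_jumps := h.card_jumps

theorem IsState.exists_at_ne_one {N : ℕ} {A : RigidArrow π N} {Γ : K → ConjClasses π}
    {c : Pt N → K} (h : A.IsState Γ c) (hΓ : ∀ k, Γ k ≠ ConjClasses.mk 1) (hN : N ≠ 0) (k : K) :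
    ∃ e, c e = k ∧ A.mark.at e ≠ 1 := by
  by_contra! hk
  exact hΓ k (h.colorProd k ▸ Marking.colorProd_of_at_eq_one hN _ hk)

open Classical in
/-- The states of a diagram. -/
noncomputable def states {N : ℕ} (A : RigidArrow π N) (Γ : K → ConjClasses π) :
    Finset (Pt N → K) :=
  Finset.univ.filter fun c => A.IsState Γ c

theorem mem_states {N : ℕ} {A : RigidArrow π N} {Γ : K → ConjClasses π} {c : Pt N → K} :
    c ∈ A.states Γ ↔ A.IsState Γ c := by
  simp [states]

end RigidArrow

/-- The state sum, which computes the value of the arrow diagram formula on a diagram. -/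
noncomputable def RigidGauss.stateSum {N : ℕ} (G : RigidGauss π N) (Γ : K → ConjClasses π) : ℚ :=
  ∑ c ∈ G.states Γ, G.weight c

end State

section FullDegree

variable {π : Type*} [Group π] {n : ℕ}

theorem RigidArrow.IsState.card_jumps_fin {N : ℕ} {A : RigidArrow π N}
    {Γ : Fin (n + 1) → ConjClasses π} {c : Pt N → Fin (n + 1)} (h : A.IsState Γ c) :
    (A.jumps c).card = n := by
  simpa using h.card_jumps

theorem RigidArrow.IsState.planar {A : RigidArrow π n} {Γ : Fin (n + 1) → ConjClasses π}
    (hΓ : ∀ i, Γ i ≠ ConjClasses.mk 1) {c : Pt n → Fin (n + 1)} (h : A.IsState Γ c) :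
    A.Planar :=
  (h.isTreeColoring hΓ).planar h.card_jumps_fin

/-- The chain presentation given by a state of a diagram of degree `n`. -/
def RigidArrow.IsState.chain {A : RigidArrow π n} {Γ : Fin (n + 1) → ConjClasses π}
    (hΓ : ∀ i, Γ i ≠ ConjClasses.mk 1) {c : Pt n → Fin (n + 1)} (h : A.IsState Γ c) : Chain n where
  toNaked := A.toNaked
  planar := h.planar hΓ
  num := c
  num_eq := (h.isTreeColoring hΓ).eq_iff_sameRegion h.card_jumps_fin
  num_surjective := (h.isTreeColoring hΓ).surjective
  num_lt _ ht := (h.coloring.of_mem_jumps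
    (Naked.jumps_eq_arrows h.card_jumps_fin ▸ A.mem_arrows.2 ht)).1

theorem isState_num_of_chainDecoration_eq {A : PlanarArrow π n} {Γ : Fin (n + 1) → ConjClasses π}
    {C : Chain n} (h : chainDecoration Γ C = inducedDecoration π n A) : A.1.IsState Γ C.num := by
  have hnaked : C.toNaked = A.1.toNaked := congrArg Decorated.toNaked h
  have hlabel : ∀ e, Γ (C.num e) = A.1.regionClass e := congrFun (congrArg Decorated.label h)
  have hcoloring := C.isColoring
  have hregion := C.num_eq
  have hlt := C.num_lt
  rw [hnaked] at hcoloring hregion hlt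
  refine ⟨hcoloring, ?_, fun k => ?_⟩
  · rw [Naked.jumps, Finset.filter_true_of_mem, A.1.card_arrows, Fintype.card_fin]
    exact fun t ht => (hlt t (A.1.mem_arrows.1 ht)).ne
  · obtain ⟨e, rfl⟩ := C.num_surjective k
    rw [hlabel, A.1.regionClass_eq_colorProd hregion]

theorem chainDecoration_chain {A : PlanarArrow π n} {Γ : Fin (n + 1) → ConjClasses π}
    (hΓ : ∀ i, Γ i ≠ ConjClasses.mk 1) {c : Pt n → Fin (n + 1)} (h : A.1.IsState Γ c) :
    chainDecoration Γ (h.chain hΓ) = inducedDecoration π n A := by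
  refine Decorated.ext_naked rfl (funext fun e => ?_)
  change Γ (c e) = A.1.regionClass e
  rw [A.1.regionClass_eq_colorProd (h.chain hΓ).num_eq, ← h.colorProd]
  rfl

theorem card_chains_eq_card_states (A : PlanarArrow π n) {Γ : Fin (n + 1) → ConjClasses π}
    (hΓ : ∀ i, Γ i ≠ ConjClasses.mk 1) :
    Nat.card {C : Chain n // chainDecoration Γ C = inducedDecoration π n A} =
      (A.1.states Γ).card := by
  rw [← Nat.subtype_card (A.1.states Γ) fun _ => RigidArrow.mem_states]
  exact Nat.card_congr
    { toFun C := ⟨C.1.num, isState_num_of_chainDecoration_eq C.2⟩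
      invFun c := ⟨c.2.chain hΓ, chainDecoration_chain hΓ c.2⟩
      left_inv C := Subtype.ext (Chain.ext_naked (congrArg Decorated.toNaked C.2).symm rfl)
      right_inv _ := rfl }

end FullDegree

/-! ### Counting symmetries -/

section Aut

variable {K : Type*} [CommGroup K] {X Y : Type*} [MulAction K X] [MulAction K Y]

theorem diag_eq_iff {x y : X} : (diag x : Diag K X) = diag y ↔ ∃ k : K, k • y = x :=
  (@Quotient.eq'' _ (MulAction.orbitRel K X) x y).trans Iff.rfl

theorem autOrder_ne_zero [Finite K] (D : Diag K X) : autOrder D ≠ 0 := by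
  induction D using Quotient.inductionOn with
  | h x => exact Nat.card_pos.ne'

theorem mem_orbit_stabilizer_iff (f : X →[K] Y) {x x' : X} :
    x' ∈ MulAction.orbit (MulAction.stabilizer K (f x)) x ↔
      x' ∈ MulAction.orbit K x ∧ f x' = f x := by
  constructor
  · rintro ⟨k, rfl⟩
    exact ⟨⟨k.1, rfl⟩, (map_smul f k.1 x).trans k.2⟩
  · rintro ⟨⟨k, rfl⟩, hk⟩
    exact ⟨⟨k, (map_smul f k x).symm.trans hk⟩, rfl⟩

theorem card_stabilizer_stabilizer (f : X →[K] Y) (x : X) :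
    Nat.card (MulAction.stabilizer (MulAction.stabilizer K (f x)) x) =
      Nat.card (MulAction.stabilizer K x) :=
  Nat.card_congr
    { toFun k := ⟨k.1.1, k.2⟩
      invFun k := ⟨⟨k.1, (map_smul f k.1 x).symm.trans (congrArg f k.2)⟩, k.2⟩
      left_inv _ := rfl
      right_inv _ := rfl }

theorem autOrder_mul_fibreCount (f : X →[K] Y) (x : X) :
    autOrder (diag x : Diag K X) * fibreCount f (diag x) =
      Nat.card (MulAction.stabilizer K (f x)) := by
  rw [← Nat.card_congr (MulAction.orbitProdStabilizerEquivGroup (MulAction.stabilizer K (f x)) x),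
    Nat.card_prod, card_stabilizer_stabilizer, mul_comm]
  exact congrArg (· * _) (Nat.card_congr
    (Equiv.subtypeEquivRight fun _ => (mem_orbit_stabilizer_iff f).symm))

/-- The fibre of an equivariant map, as a set acted upon by the stabilizer of the base point. -/
def fibre (f : X →[K] Y) (y : Y) : SubMulAction (MulAction.stabilizer K y) X where
  carrier := {x | f x = y}
  smul_mem' k x hx := (map_smul f k.1 x).trans ((congrArg (k.1 • ·) hx).trans k.2)

theorem bijective_fibre_orbits (f : X →[K] Y) (y : Y) :
    Function.Bijective
      (Quotient.lift (fun x => ⟨diag x.1, congrArg diag x.2⟩)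
        (by
          rintro _ x ⟨k, rfl⟩
          exact Subtype.ext (diag_eq_iff.2 ⟨k.1, rfl⟩)) :
        MulAction.orbitRel.Quotient (MulAction.stabilizer K y) (fibre f y) →
          {Q : Diag K X // forget f Q = diag y}) := by
  constructor
  · rintro ⟨x, hx⟩ ⟨x', hx'⟩ h
    obtain ⟨k, hk⟩ := diag_eq_iff.1 (congrArg Subtype.val h)
    exact Quotient.sound ⟨⟨k, by
      rw [MulAction.mem_stabilizer_iff]
      nth_rw 1 [← hx']
      exact (map_smul f k x').symm.trans ((congrArg f hk).trans hx)⟩, Subtype.ext hk⟩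
  · rintro ⟨Q, hQ⟩
    induction Q using Quotient.inductionOn with
    | h x =>
      obtain ⟨k, hk⟩ := diag_eq_iff.1 hQ.symm
      exact ⟨Quotient.mk _ ⟨k • x, (map_smul f k x).trans hk⟩,
        Subtype.ext (diag_eq_iff.2 ⟨k, rfl⟩)⟩

theorem card_stabilizer_mul_card_forget (f : X →[K] Y) (y : Y)
    (hfree : ∀ (k : K) (x : X), k • x = x → k = 1) :
    Nat.card (MulAction.stabilizer K y) * Nat.card {Q : Diag K X // forget f Q = diag y} =
      Nat.card {x : X // f x = y} := by
  have hbot : ∀ x : fibre f y, MulAction.stabilizer (MulAction.stabilizer K y) x = ⊥ := fun x =>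
    (Subgroup.eq_bot_iff_forall _).2 fun k hk =>
      Subtype.ext (hfree k.1 x.1 (congrArg Subtype.val hk))
  rw [← Nat.card_eq_of_bijective _ (bijective_fibre_orbits f y), mul_comm, ← Nat.card_prod]
  exact (Nat.card_congr (MulAction.selfEquivOrbitsQuotientProd hbot)).symm

theorem forget_injective {f : X →[K] Y} (hf : Function.Injective f) :
    Function.Injective (forget f) := by
  intro P Q h
  induction P using Quotient.inductionOn with
  | h x =>
    induction Q using Quotient.inductionOn with
    | h x' =>
      obtain ⟨k, hk⟩ := diag_eq_iff.1 h
      exact diag_eq_iff.2 ⟨k, hf ((map_smul f k x').trans hk)⟩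

theorem autOrder_forget {f : X →[K] Y} (hf : Function.Injective f) (D : Diag K X) :
    autOrder (forget f D) = autOrder D := by
  induction D using Quotient.inductionOn with
  | h x =>
    refine Nat.card_congr (Equiv.subtypeEquivRight fun k => ?_)
    rw [MulAction.mem_stabilizer_iff, MulAction.mem_stabilizer_iff, ← map_smul, hf.eq_iff]

end Aut

/-- A rotation that preserves a chain presentation preserves the regions of all edges. Hence the
arrow at `0` and its image are not parallel unless they coincide, and planarity excludes that they
cross. -/
theorem Chain.eq_one_of_smul_eq {n : ℕ} {k : Rot n} {C : Chain n} (h : k • C = C) : k = 1 := by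
  by_contra hk
  have hn : n ≠ 0 := by
    rintro rfl
    exact hk (congrArg Multiplicative.ofAdd (Subsingleton.elim k.toAdd 0))
  have hpartner : C.partner (0 - k.toAdd) + k.toAdd = C.partner 0 :=
    congrFun (congrArg (fun C : Chain n => C.partner) h) 0
  have hdir : C.dir (0 - k.toAdd) = C.dir 0 := congrFun (congrArg (fun C : Chain n => C.dir) h) 0
  have hregion : ∀ i, C.SameRegion (i - k.toAdd) i := fun i =>
    (C.num_eq _ _).1 (congrFun (congrArg (fun C : Chain n => C.num) h) i)
  have hdir₀ := C.dir_ne_zero hn 0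
  refine C.planar 0 (0 - k.toAdd) ⟨fun h' => hk ?_, fun h' => ?_, fun h' => ?_⟩
  · rwa [zero_sub, neg_eq_zero] at h'
  · rw [h', C.dir_partner] at hdir
    revert hdir hdir₀
    cases C.dir 0 <;> decide
  · have hpartner' := h'.1 ((hregion 0 0).2 (C.onArc_self hdir₀))
    rw [eq_sub_of_add_eq hpartner] at hpartner'
    exact C.not_onArc_partner 0 ((hregion _ 0).1 hpartner')

section Pairing

variable {π : Type*} [Group π] {n : ℕ}

theorem planarChain_diag (Γ : Fin (n + 1) → ConjClasses π) (D : Decorated π n) :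
    planarChain Γ (diag D) =
      Nat.card {Q : Diag (Rot n) (Chain n) // forget (chainDecoration Γ) Q = diag D} := by
  classical
  have : Fintype (Diag (Rot n) (Chain n)) := Fintype.ofFinite _
  rw [planarChain, projection, Finsupp.lmapDomain_apply, Finsupp.mapDomain, Finsupp.sum_apply,
    Finsupp.sum_fintype _ _ (by simp), Nat.card_eq_fintype_card, Fintype.card_subtype]
  simp [universalChain, Finsupp.single_apply]

theorem planarIncl_injective : Function.Injective (planarIncl π n) := Subtype.val_injective

theorem liftedPlanarChain_planarIncl (Γ : Fin (n + 1) → ConjClasses π) (P : PlanarArrow π n) :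
    liftedPlanarChain Γ n (diag P.1) = fibreCount (inducedDecoration π n) (diag P) *
      planarChain Γ (diag (inducedDecoration π n P)) := by
  rw [liftedPlanarChain, DFinsupp.single_eq_same]
  exact (forget_injective planarIncl_injective).extend_apply _ _ (diag P)

theorem liftedPlanarChain_eq_zero (Γ : Fin (n + 1) → ConjClasses π) {A : RigidArrow π n}
    (hA : ¬ A.Planar) : liftedPlanarChain Γ n (diag A) = 0 := by
  rw [liftedPlanarChain, DFinsupp.single_eq_same]
  refine Function.extend_apply' _ _ _ ?_
  rintro ⟨P, hP⟩
  induction P using Quotient.inductionOn with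
  | h P =>
    obtain ⟨k, hk⟩ := diag_eq_iff.1 hP.symm
    exact hA (hk ▸ P.2.rotate k.toAdd)

theorem autOrder_mul_liftedPlanarChain {Γ : Fin (n + 1) → ConjClasses π}
    (hΓ : ∀ i, Γ i ≠ ConjClasses.mk 1) (A : RigidArrow π n) :
    (autOrder (diag A : ArrowDiagram π n) : ℚ) * liftedPlanarChain Γ n (diag A) =
      (A.states Γ).card := by
  by_cases hA : A.Planar
  · obtain ⟨P, rfl⟩ : ∃ P : PlanarArrow π n, P.1 = A := ⟨⟨A, hA⟩, rfl⟩
    have hcount := card_stabilizer_mul_card_forget (chainDecoration Γ) (inducedDecoration π n P)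
      fun k C => Chain.eq_one_of_smul_eq
    have haut : autOrder (diag P.1 : ArrowDiagram π n) = autOrder (diag P : Diag (Rot n) _) :=
      autOrder_forget planarIncl_injective (diag P)
    rw [card_chains_eq_card_states _ hΓ, ← autOrder_mul_fibreCount] at hcount
    rw [← hcount, liftedPlanarChain_planarIncl, planarChain_diag, haut]
    push_cast
    ring
  · rw [liftedPlanarChain_eq_zero Γ hA, mul_zero, eq_comm, Nat.cast_eq_zero, Finset.card_eq_zero]
    exact Finset.eq_empty_of_forall_notMem fun c hc =>
      hA ((RigidArrow.mem_states.1 hc).planar hΓ)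

theorem RigidArrow.IsState.weight_eq_sign {G : RigidGauss π n} {Γ : Fin (n + 1) → ConjClasses π}
    {c : Pt n → Fin (n + 1)} (h : G.IsState Γ c) : G.weight c = G.sign := by
  rw [RigidGauss.weight, Naked.jumps_eq_arrows h.card_jumps_fin, RigidGauss.sign, Naked.arrows,
    Finset.prod_filter]

theorem pairing_single_diag {m : ℕ} {Γ : Fin (n + 1) → ConjClasses π}
    (hΓ : ∀ i, Γ i ≠ ConjClasses.mk 1) (G : RigidGauss π m) :
    pairing (signedSymPres (liftedPlanarChain Γ)) (Finsupp.single ⟨m, diag G⟩ 1) =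
      if m = n then G.stateSum Γ else 0 := by
  rw [pairing, Finsupp.sum_single_index (by rw [mul_zero]), mul_one, signedSymPres,
    DFinsupp.mapRange_apply]
  by_cases h : m = n
  · subst h
    rw [if_pos rfl, RigidGauss.stateSum,
      Finset.sum_congr rfl fun c hc => (RigidArrow.mem_states.1 hc).weight_eq_sign,
      Finset.sum_const, nsmul_eq_mul, ← autOrder_mul_liftedPlanarChain hΓ]
    have haut : (autOrder (diag G : GaussDiagram π m) : ℚ) ≠ 0 :=
      Nat.cast_ne_zero.2 (autOrder_ne_zero _)
    have hsign : gaussSign (diag G : GaussDiagram π m) = G.sign := rfl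
    have hforget : forget (forgetSigns π m) (diag G) = diag G.toRigidArrow := rfl
    simp only [hsign, hforget]
    field_simp
  · rw [if_neg h, liftedPlanarChain, DFinsupp.single_eq_of_ne h]
    simp only [Pi.zero_apply, mul_zero]

end Pairing

/-! ### Collapsing a circle onto a subset -/

section Collapse

variable {N M : ℕ} [NeZero N] [NeZero M] {ι : Fin M → Fin N}

/-- The index of the last point of a subset of the circle that precedes, or is, a given point.
The subset is given by its increasing enumeration `ι`. -/
def collapse (ι : Fin M → Fin N) (e : Fin N) : Fin M :=
  Fin.ofNat M (Finset.univ.filter fun j => ι j ≤ e).card - 1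

theorem collapse_pred (ι : Fin M → Fin N) (i : Fin N) :
    collapse ι (i - 1) = Fin.ofNat M (Finset.univ.filter fun j => ι j < i).card - 1 := by
  rw [collapse]
  congr 1
  obtain rfl | hi := eq_or_ne i 0
  · have hle : ∀ j, ι j ≤ 0 - 1 := fun j => by
      rw [Fin.le_def, fin_val_pred, if_pos rfl]
      omega
    rw [Finset.filter_true_of_mem fun j _ => hle j,
      Finset.filter_false_of_mem fun j _ => Fin.not_lt_zero _]
    ext
    simp
  · have hlt : ∀ j, ι j ≤ i - 1 ↔ ι j < i := fun j => by
      have hpos : i.val ≠ 0 := fun h => hi (Fin.ext h)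
      rw [Fin.le_def, Fin.lt_def, fin_val_pred, if_neg hi]
      omega
    simp only [hlt]

omit [NeZero N] in
theorem collapse_apply (hι : StrictMono ι) (j : Fin M) : collapse ι (ι j) = j := by
  simp only [collapse, hι.le_iff_le, Finset.filter_ge_eq_Iic, Fin.card_Iic, ofNat_add,
    Fin.ofNat_val_eq_self]
  exact add_sub_cancel_right _ _

theorem collapse_apply_pred (hι : StrictMono ι) (j : Fin M) : collapse ι (ι j - 1) = j - 1 := by
  simp only [collapse_pred, hι.lt_iff_lt, Finset.filter_gt_eq_Iio, Fin.card_Iio,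
    Fin.ofNat_val_eq_self]

theorem collapse_pred_of_notMem {i : Fin N} (hi : i ∉ Set.range ι) :
    collapse ι (i - 1) = collapse ι i := by
  have hlt : ∀ j, ι j < i ↔ ι j ≤ i := fun j =>
    ⟨le_of_lt, fun h => h.lt_of_ne fun h' => hi ⟨j, h'⟩⟩
  simp only [collapse_pred, hlt]
  rfl

theorem fin_val_succ (j : Fin M) :
    (j + 1).val = if j.val + 1 = M then 0 else j.val + 1 := by
  have hj := j.isLt
  rw [Fin.val_add, Fin.val_one', Nat.add_mod_mod]
  split_ifs with h
  · rw [h, Nat.mod_self]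
  · exact Nat.mod_eq_of_lt (by omega)

omit [NeZero N] in
theorem sub_val_le_of_ne (hι : StrictMono ι) {j j' : Fin M} (h : j' ≠ j) :
    (ι (j + 1) - ι j).val ≤ (ι j' - ι j).val := by
  have hne : j'.val ≠ j.val := fun h' => h (Fin.ext h')
  have hsucc := fin_val_succ j
  have hlt := (ι (j + 1)).isLt
  have hafter : j.val < j'.val → (ι j).val < (ι j').val := fun h => hι h
  have hbefore : j'.val < j.val → (ι j').val < (ι j).val := fun h => hι h
  have hle : (j + 1).val ≤ j'.val → (ι (j + 1)).val ≤ (ι j').val := fun h => hι.monotone h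
  have hstep : j.val < (j + 1).val → (ι j).val < (ι (j + 1)).val := fun h => hι h
  rw [fin_val_sub, fin_val_sub]
  split_ifs at hsucc <;> split_ifs <;> omega

theorem collapse_add (hι : StrictMono ι) (j : Fin M) {x : ℕ} (hx : x < (ι (j + 1) - ι j).val) :
    collapse ι (ι j + Fin.ofNat N x) = j := by
  induction x with
  | zero => simpa using collapse_apply hι j
  | succ x ih =>
    have hpred : ι j + Fin.ofNat N x = ι j + Fin.ofNat N (x + 1) - 1 := by
      rw [ofNat_add, ← add_assoc]
      exact (add_sub_cancel_right _ _).symm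
    rw [← collapse_pred_of_notMem, ← hpred, ih (by omega)]
    rintro ⟨j', hj'⟩
    have hval : (ι j' - ι j).val = x + 1 := by
      rw [hj', add_sub_cancel_left]
      exact Nat.mod_eq_of_lt (hx.trans (Fin.isLt _))
    obtain rfl | hne := eq_or_ne j' j
    · rw [sub_self] at hval
      exact absurd hval (Nat.succ_ne_zero x).symm
    · have := sub_val_le_of_ne hι hne
      omega

omit [NeZero N] in
theorem sum_sub_val (hM : 2 ≤ M) (hι : StrictMono ι) : ∑ j, (ι (j + 1) - ι j).val = N := by
  have hgap : ∀ j, ((ι (j + 1) - ι j).val : ℤ) =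
      (ι (j + 1)).val - (ι j).val + if j + 1 = 0 then (N : ℤ) else 0 := by
    intro j
    have hsucc := fin_val_succ j
    have hjlt := (ι j).isLt
    rw [fin_val_sub]
    split_ifs at hsucc with hj
    · have hlt : (ι (j + 1)).val < (ι j).val := hι (by rw [Fin.lt_def]; omega)
      rw [if_neg hlt.not_ge, if_pos (Fin.ext hsucc)]
      omega
    · have hlt : (ι j).val < (ι (j + 1)).val := hι (by rw [Fin.lt_def]; omega)
      rw [if_pos hlt.le, if_neg fun h => by rw [h] at hsucc; simp at hsucc]
      omega
  have hshift := Equiv.sum_comp (Equiv.addRight (1 : Fin M)) fun j => ((ι j).val : ℤ)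
  have hwrap := Equiv.sum_comp (Equiv.addRight (1 : Fin M)) fun j => if j = 0 then (N : ℤ) else 0
  simp only [Equiv.coe_addRight, Finset.sum_ite_eq', Finset.mem_univ, if_true] at hshift hwrap
  zify
  rw [Finset.sum_congr rfl fun j _ => hgap j, Finset.sum_add_distrib, Finset.sum_sub_distrib,
    hshift, sub_self, zero_add]
  exact hwrap

section Product

variable {π : Type*} [Monoid π]

theorem prod_range_segments (F : ℕ → π) (gap : ℕ → ℕ) (M : ℕ) :
    ((List.range M).map fun J =>
      ((List.range (gap J)).map fun k => F (∑ i ∈ Finset.range J, gap i + k)).prod).prod =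
      ((List.range (∑ i ∈ Finset.range M, gap i)).map F).prod := by
  induction M with
  | zero => rfl
  | succ M ih =>
    rw [List.range_succ, List.map_append, List.prod_append, ih, Finset.sum_range_succ,
      List.range_add, List.map_append, List.prod_append, List.map_map]
    simp only [List.map_cons, List.map_nil, List.prod_singleton, Function.comp_def]

theorem map_finRange_eq_map_range {α : Type*} (f : Fin M → α) :
    (List.finRange M).map f = (List.range M).map fun j => f (Fin.ofNat M j) := by
  rw [← List.map_coe_finRange_eq_range, List.map_map]
  exact List.map_congr_left fun j _ => congrArg f (Fin.ofNat_val_eq_self j).symm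

theorem prod_segments (hM : 2 ≤ M) (hι : StrictMono ι) (F : Fin N → π) :
    ((List.finRange M).map fun j => ((List.range (ι (j + 1) - ι j).val).map fun k =>
      F (ι j + Fin.ofNat N k)).prod).prod =
      ((List.finRange N).map fun x => F (ι 0 + x)).prod := by
  set gap : ℕ → ℕ := fun J => (ι (Fin.ofNat M J + 1) - ι (Fin.ofNat M J)).val with hgap
  have hstart : ∀ J, ι (Fin.ofNat M J) = ι 0 + Fin.ofNat N (∑ i ∈ Finset.range J, gap i) := by
    intro J
    induction J with
    | zero => simp
    | succ J ih =>
      rw [Finset.sum_range_succ, ofNat_add (M := N), ← add_assoc, ← ih, hgap,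
        Fin.ofNat_val_eq_self, add_sub_cancel, ofNat_add]
      rfl
  have htotal : ∑ i ∈ Finset.range M, gap i = N := by
    rw [← sum_sub_val hM hι, Finset.sum_range]
    simp only [hgap, Fin.ofNat_val_eq_self]
  have hprod := prod_range_segments (fun k => F (ι 0 + Fin.ofNat N k)) gap M
  rw [htotal] at hprod
  rw [map_finRange_eq_map_range (M := N), ← hprod, map_finRange_eq_map_range (M := M)]
  exact congrArg List.prod (List.map_congr_left fun J _ => congrArg List.prod
    (List.map_congr_left fun k _ => by rw [ofNat_add, ← add_assoc, ← hstart]))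

end Product

theorem conjClasses_prod_collapse {π : Type*} [Group π] (hM : 2 ≤ M) (hι : StrictMono ι)
    (f : Fin N → π) (p : Fin M → Prop) [DecidablePred p] :
    ConjClasses.mk ((List.finRange N).map fun e => if p (collapse ι e) then f e else 1).prod =
      ConjClasses.mk ((List.finRange M).map fun j =>
        if p j then ((List.range (ι (j + 1) - ι j).val).map fun k =>
          f (ι j + Fin.ofNat N k)).prod else 1).prod := by
  set F : Fin N → π := fun e => if p (collapse ι e) then f e else 1 with hF
  have hsegment : ∀ j, (if p j then ((List.range (ι (j + 1) - ι j).val).map fun k =>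
      f (ι j + Fin.ofNat N k)).prod else 1) =
      ((List.range (ι (j + 1) - ι j).val).map fun k => F (ι j + Fin.ofNat N k)).prod := by
    intro j
    have hcollapse : ∀ x ∈ List.range (ι (j + 1) - ι j).val,
        F (ι j + Fin.ofNat N x) = if p j then f (ι j + Fin.ofNat N x) else 1 := fun x hx => by
      simp only [hF, collapse_add hι j (List.mem_range.1 hx)]
    rw [List.map_congr_left hcollapse]
    split_ifs
    · rfl
    · rw [List.map_const', List.prod_replicate, one_pow]
  simp only [hsegment]
  rw [prod_segments hM hι]
  have hrot := (map_add_finRange_isRotated N 0 (ι 0)).map F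
  simp only [List.map_map, Function.comp_def, zero_add] at hrot
  exact conjClasses_prod_of_isRotated hrot

end Collapse

/-! ### States of subdiagrams -/

section Subdiagram

variable {π : Type*} [Group π] {N M : ℕ}

/-- The diagram `H` is obtained from `G` by removing all arrows but those of `s`: `ι` embeds the
points of `H` and `ρ` sends an edge of `G` to the edge of `H` that contains it. -/
structure IsSubdiagram (G : RigidGauss π N) (s : Finset (Pt N)) (H : RigidGauss π M)
    (ι : Pt M → Pt N) (ρ : Pt N → Pt M) : Prop where
  injective : Function.Injective ι
  mem_ends : ∀ i, i ∈ G.ends s ↔ ∃ j, ι j = i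
  collapse : ∀ j, ρ (ι j) = j
  collapse_pred : ∀ j, ρ (ι j - 1) = j - 1
  collapse_of_notMem : ∀ i ∉ G.ends s, ρ (i - 1) = ρ i
  dir : ∀ j, H.dir j = G.dir (ι j)
  partner : ∀ j, ι (H.partner j) = G.partner (ι j)
  writhe : ∀ j, H.writhe j = G.writhe (ι j)
  colorProd : ∀ {K : Type} [DecidableEq K] (c : Pt M → K) (k : K),
    G.mark.colorProd (c ∘ ρ) k = H.mark.colorProd c k

variable {G : RigidGauss π N} {s : Finset (Pt N)}

theorem exists_isSubdiagram (hs : s ⊆ G.arrows) {m : ℕ} (hm : s.card = m + 1) :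
    ∃ ι ρ, IsSubdiagram G s (G.subAux s hs (m + 1) hm) ι ρ := by
  obtain ⟨t, ht⟩ : s.Nonempty := Finset.card_pos.1 (by omega)
  obtain ⟨N, rfl⟩ := Nat.exists_eq_succ_of_ne_zero (Naked.ne_zero_of_tail (G.mem_arrows.1 (hs ht)))
  set o : Pt (m + 1) ≃o G.ends s := (G.ends s).orderIsoOfFin (G.card_ends hs hm)
  have hmono : StrictMono fun j => (o j : Pt (N + 1)) := o.strictMono
  have hmem : ∀ i, i ∈ G.ends s ↔ ∃ j, (o j : Pt (N + 1)) = i := fun i =>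
    ⟨fun hi => ⟨o.symm ⟨i, hi⟩, congrArg Subtype.val (o.apply_symm_apply _)⟩, by
      rintro ⟨j, rfl⟩
      exact (o j).2⟩
  exact ⟨fun j => o j, collapse fun j => (o j : Pt (N + 1)),
    { injective := hmono.injective
      mem_ends := hmem
      collapse := collapse_apply hmono
      collapse_pred := collapse_apply_pred hmono
      collapse_of_notMem := fun i hi => collapse_pred_of_notMem fun h => hi ((hmem i).2 h)
      dir := fun _ => rfl
      partner := fun _ => congrArg Subtype.val (o.apply_symm_apply _)
      writhe := fun _ => rfl
      colorProd := fun c k => conjClasses_prod_collapse (by unfold size; omega) hmono G.mark.at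
        fun j => c j = k }⟩

theorem Naked.mem_ends_iff_of_tail (D : Naked N) (hs : s ⊆ D.arrows) {t : Pt N}
    (ht : D.dir t = 1) : t ∈ D.ends s ↔ t ∈ s := by
  refine ⟨fun h => (Finset.mem_union.1 h).resolve_right fun h' => ?_, Finset.mem_union_left _⟩
  obtain ⟨j, hj, hjt⟩ := Finset.mem_image.1 h'
  exact partner_ne_tail (D.mem_arrows.1 (hs hj)) ht hjt

theorem Naked.partner_mem_ends_iff (D : Naked N) {i : Pt N} :
    D.partner i ∈ D.ends s ↔ i ∈ D.ends s :=
  ⟨fun h => by simpa only [D.partner_partner] using D.partner_mem_ends s h, D.partner_mem_ends s⟩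

namespace IsSubdiagram

variable {H : RigidGauss π M} {ι : Pt M → Pt N} {ρ : Pt N → Pt M}
  {K : Type} [LinearOrder K]

theorem jumps_comp (h : IsSubdiagram G s H ι ρ) (c : Pt M → K) :
    G.jumps (c ∘ ρ) = (H.jumps c).image ι := by
  ext t
  simp only [Finset.mem_image, Naked.mem_jumps, h.dir, Function.comp_apply]
  constructor
  · rintro ⟨ht, hne⟩
    by_cases hts : t ∈ G.ends s
    · obtain ⟨j, rfl⟩ := (h.mem_ends t).1 hts
      rw [h.collapse, h.collapse_pred] at hne
      exact ⟨j, ⟨ht, hne⟩, rfl⟩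
    · exact absurd (congrArg c (h.collapse_of_notMem t hts)) hne
  · rintro ⟨j, ⟨ht, hne⟩, rfl⟩
    exact ⟨ht, by rwa [h.collapse, h.collapse_pred]⟩

theorem isColoring_comp (h : IsSubdiagram G s H ι ρ) (c : Pt M → K) :
    G.IsColoring (c ∘ ρ) ↔ H.IsColoring c := by
  constructor
  · intro hc j hj
    have hcj := hc (ι j) (by rw [← h.dir, hj])
    rw [Naked.RuleAt, ← h.partner] at hcj
    simpa only [Function.comp_apply, h.collapse, h.collapse_pred, Naked.RuleAt] using hcj
  · intro hc t ht
    by_cases hts : t ∈ G.ends s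
    · obtain ⟨j, rfl⟩ := (h.mem_ends t).1 hts
      rw [Naked.RuleAt, ← h.partner]
      simp only [Function.comp_apply, h.collapse, h.collapse_pred]
      exact hc j (by rw [h.dir, ht])
    · left
      simp only [Function.comp_apply, h.collapse_of_notMem t hts,
        h.collapse_of_notMem _ (mt G.partner_mem_ends_iff.1 hts), and_self]

theorem weight_comp (h : IsSubdiagram G s H ι ρ) (c : Pt M → K) :
    G.weight (c ∘ ρ) = H.weight c := by
  rw [RigidGauss.weight, h.jumps_comp, Finset.prod_image fun a _ b _ hab => h.injective hab]
  simp only [← h.writhe]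
  rfl

theorem comp_eq_of_jumps_subset (h : IsSubdiagram G s H ι ρ) {c : Pt N → K}
    (hc : G.IsColoring c) (hjumps : G.jumps c ⊆ s) : (c ∘ ι) ∘ ρ = c := by
  funext e
  refine fin_cyclic_induction (P := fun e => c (ι (ρ e)) = c e) (j := ι 0)
    (by rw [h.collapse]) (fun i ih => ?_) e
  by_cases hi : i ∈ G.ends s
  · obtain ⟨j, rfl⟩ := (h.mem_ends i).1 hi
    rw [h.collapse]
  · rw [← h.collapse_of_notMem i hi, ih]
    by_contra hne
    rcases hc.mem_jumps_or_of_ne hne with ht | ht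
    · exact hi (Finset.mem_union_left _ (hjumps ht))
    · exact hi (G.partner_mem_ends_iff.1 (Finset.mem_union_left _ (hjumps ht)))

variable [Fintype K] {Γ : K → ConjClasses π}

theorem isState_comp (h : IsSubdiagram G s H ι ρ) (c : Pt M → K) :
    G.IsState Γ (c ∘ ρ) ↔ H.IsState Γ c := by
  have hcard : (G.jumps (c ∘ ρ)).card = (H.jumps c).card := by
    rw [h.jumps_comp, Finset.card_image_of_injective _ h.injective]
  exact ⟨fun hc => ⟨(h.isColoring_comp c).1 hc.coloring, hcard ▸ hc.card_jumps,
      fun k => (h.colorProd c k).symm.trans (hc.colorProd k)⟩,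
    fun hc => ⟨(h.isColoring_comp c).2 hc.coloring, hcard.symm ▸ hc.card_jumps,
      fun k => (h.colorProd c k).trans (hc.colorProd k)⟩⟩

theorem stateSum_eq (h : IsSubdiagram G s H ι ρ) (hs : s ⊆ G.arrows) :
    H.stateSum Γ = ∑ c ∈ (G.states Γ).filter (fun c => G.jumps c ⊆ s), G.weight c := by
  refine Finset.sum_bij' (fun c _ => c ∘ ρ) (fun c _ => c ∘ ι) (fun c hc => ?_) (fun c hc => ?_)
    (fun c _ => funext fun j => congrArg c (h.collapse j)) (fun c hc => ?_)
    (fun c _ => (h.weight_comp c).symm)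
  · rw [Finset.mem_filter, RigidArrow.mem_states, h.isState_comp, h.jumps_comp]
    refine ⟨RigidArrow.mem_states.1 hc, fun t ht => ?_⟩
    obtain ⟨j, hj, rfl⟩ := Finset.mem_image.1 ht
    exact (G.mem_ends_iff_of_tail hs (h.dir j ▸ Naked.tail_of_mem_jumps hj)).1
      ((h.mem_ends _).2 ⟨j, rfl⟩)
  · rw [Finset.mem_filter, RigidArrow.mem_states] at hc
    rw [RigidArrow.mem_states, ← h.isState_comp, h.comp_eq_of_jumps_subset hc.1.coloring hc.2]
    exact hc.1
  · rw [Finset.mem_filter, RigidArrow.mem_states] at hc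
    exact h.comp_eq_of_jumps_subset hc.1.coloring hc.2

end IsSubdiagram

theorem Marking.colorProd_const {K : Type*} [DecidableEq K] (μ : Marking π N) (x k : K) :
    μ.colorProd (fun _ => x) k = if x = k then μ.total else ConjClasses.mk 1 := by
  cases N with
  | zero => rfl
  | succ N => by_cases h : x = k <;> simp [colorProd, total, h]

theorem Naked.jumps_const {K : Type*} [LinearOrder K] (D : Naked N) (x : K) :
    D.jumps (fun _ => x) = ∅ :=
  Finset.filter_false_of_mem fun _ _ => not_not.2 rfl

theorem Naked.isColoring_const {K : Type*} [LinearOrder K] (D : Naked N) (x : K) :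
    D.IsColoring fun _ => x :=
  fun _ _ => Or.inl ⟨rfl, rfl⟩

theorem stateSum_empty {K : Type*} [LinearOrder K] [Fintype K] {Γ : K → ConjClasses π}
    (G : RigidGauss π N) {H : RigidGauss π 0} (hH : H.mark = G.mark.total) :
    H.stateSum Γ = ∑ c ∈ (G.states Γ).filter (fun c => G.jumps c ⊆ ∅), G.weight c := by
  have hpoint : ∀ c : Pt 0 → K, (fun _ => c 0) = c := fun c =>
    funext fun e => congrArg c (Subsingleton.elim 0 e)
  have hstate : ∀ x : K, G.IsState Γ (fun _ => x) ↔ H.IsState Γ (fun _ => x) := by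
    have hprod : ∀ x k : K,
        G.mark.colorProd (fun _ => x) k = H.mark.colorProd (fun _ => x) k := fun x k => by
      rw [Marking.colorProd_const, ← hH]
      rfl
    refine fun x => ⟨fun h => ⟨H.isColoring_const x, ?_, fun k => hprod x k ▸ h.colorProd k⟩,
      fun h => ⟨G.isColoring_const x, ?_, fun k => hprod x k ▸ h.colorProd k⟩⟩
    · simpa only [Naked.jumps_const, Finset.card_empty] using h.card_jumps
    · simpa only [Naked.jumps_const, Finset.card_empty] using h.card_jumps
  have hconst : ∀ c : Pt N → K, G.IsState Γ c → G.jumps c ⊆ ∅ → (fun _ => c 0) = c :=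
    fun c hc hjumps => funext fun e => hc.coloring.eq_of_forall_onArc_iff fun t ht =>
      absurd (hjumps ht) (Finset.notMem_empty t)
  refine Finset.sum_bij' (fun c _ _ => c 0) (fun c _ _ => c 0) (fun c hc => ?_) (fun c hc => ?_)
    (fun c _ => hpoint c) (fun c hc => ?_) (fun c _ => ?_)
  · rw [RigidArrow.mem_states, ← hpoint c, ← hstate] at hc
    rw [Finset.mem_filter, RigidArrow.mem_states]
    exact ⟨hc, (G.jumps_const _).subset⟩
  · rw [Finset.mem_filter, RigidArrow.mem_states] at hc
    rw [RigidArrow.mem_states, ← hstate, hconst c hc.1 hc.2]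
    exact hc.1
  · rw [Finset.mem_filter, RigidArrow.mem_states] at hc
    exact hconst c hc.1 hc.2
  · rw [← hpoint c, RigidGauss.weight, RigidGauss.weight, Naked.jumps_const, Naked.jumps_const,
      Finset.prod_empty, Finset.prod_empty]

theorem stateSum_sub {K : Type} [LinearOrder K] [Fintype K] {Γ : K → ConjClasses π}
    (hs : s ⊆ G.arrows) : (G.sub s hs).stateSum Γ =
      ∑ c ∈ (G.states Γ).filter (fun c => G.jumps c ⊆ s), G.weight c := by
  have hsubAux : ∀ m (hm : s.card = m), (G.subAux s hs m hm).stateSum Γ =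
      ∑ c ∈ (G.states Γ).filter (fun c => G.jumps c ⊆ s), G.weight c := by
    rintro (_ | m) hm
    · obtain rfl := Finset.card_eq_zero.1 hm
      exact stateSum_empty G rfl
    · obtain ⟨ι, ρ, h⟩ := exists_isSubdiagram hs hm
      exact h.stateSum_eq hs
  exact hsubAux _ rfl

theorem pairing_finset_sum {α : Type*} (𝒢 : GaussSeries π) (T : Finset α) (f : α → GaussSpace π) :
    pairing 𝒢 (∑ a ∈ T, f a) = ∑ a ∈ T, pairing 𝒢 (f a) := by
  simp only [pairing]
  rw [Finsupp.sum_finsetSum_index] <;> intros <;> ring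

/-- A state contributes to the subdiagram of its jumps only. -/
theorem pairing_subdiagramSum {n : ℕ} {Γ : Fin (n + 1) → ConjClasses π}
    (hΓ : ∀ i, Γ i ≠ ConjClasses.mk 1) (G : RigidGauss π N) :
    pairing (signedSymPres (liftedPlanarChain Γ)) (subdiagramSum G) = G.stateSum Γ := by
  rw [subdiagramSum, pairing_finset_sum]
  simp only [pairing_single_diag hΓ, stateSum_sub]
  rw [Finset.sum_attach G.arrows.powerset fun s => if s.card = n then
    ∑ c ∈ (G.states Γ).filter (fun c => G.jumps c ⊆ s), G.weight c else 0,
    ← Finset.sum_filter, RigidGauss.stateSum,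
    ← Finset.sum_fiberwise_of_maps_to (g := fun c => G.jumps c)
      (t := G.arrows.powerset.filter fun s => s.card = n)]
  · refine Finset.sum_congr rfl fun s hs => ?_
    refine Finset.sum_congr (Finset.filter_congr fun c hc => ?_) fun _ _ => rfl
    have hcard := (Finset.mem_filter.1 hs).2
    have hjumps := (RigidArrow.mem_states.1 hc).card_jumps_fin
    exact ⟨fun h => Finset.eq_of_subset_of_card_le h (by omega), fun h => h.subset⟩
  · intro c hc
    rw [Finset.mem_filter, Finset.mem_powerset]
    exact ⟨Finset.filter_subset _ _, (RigidArrow.mem_states.1 hc).card_jumps_fin⟩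

end Subdiagram

/-! ### Rotations and conjugacy moves -/

section Rotation

variable {π : Type*} [Group π] {N : ℕ} {K : Type*}

theorem Marking.colorProd_rotate [DecidableEq K] (μ : Marking π N) (r : Pt N) (c : Pt N → K)
    (k : K) : (μ.rotate r).colorProd (fun e => c (e - r)) k = μ.colorProd c k := by
  cases N with
  | zero => simp only [colorProd, rotate, Subsingleton.elim (0 - r) 0]
  | succ N =>
    refine conjClasses_prod_of_isRotated ?_
    have hrot := (map_add_finRange_isRotated (size (N + 1)) (-r) 0).map
      fun e => if c e = k then μ e else 1
    simp only [List.map_map, Function.comp_def, zero_add, neg_add_eq_sub] at hrot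
    exact hrot

variable [LinearOrder K]

theorem Naked.jumps_rotate (D : Naked N) (r : Pt N) (c : Pt N → K) :
    (D.rotate r).jumps (fun e => c (e - r)) =
      (D.jumps c).map (Equiv.addRight r).toEmbedding := by
  ext t
  rw [Finset.mem_map_equiv, mem_jumps, mem_jumps, sub_right_comm]
  simp only [Equiv.addRight_symm, Equiv.coe_addRight, ← sub_eq_add_neg]
  rfl

theorem Naked.isColoring_rotate (D : Naked N) (r : Pt N) (c : Pt N → K) :
    (D.rotate r).IsColoring (fun e => c (e - r)) ↔ D.IsColoring c := by
  simp only [IsColoring, RuleAt, rotate, sub_right_comm _ (1 : Pt N) r, add_sub_cancel_right]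
  refine ⟨fun h t ht => ?_, fun h t => h (t - r)⟩
  have ht' := h (t + r)
  simp only [add_sub_cancel_right] at ht'
  exact ht' ht

variable [Fintype K] {Γ : K → ConjClasses π}

theorem RigidArrow.isState_smul (A : RigidArrow π N) (r : Rot N) (c : Pt N → K) :
    (r • A).IsState Γ (fun e => c (e - r.toAdd)) ↔ A.IsState Γ c := by
  have hjumps := congrArg Finset.card (A.jumps_rotate r.toAdd c)
  rw [Finset.card_map] at hjumps
  have hprod := A.mark.colorProd_rotate r.toAdd c
  exact ⟨fun h => ⟨(A.isColoring_rotate r.toAdd c).1 h.coloring, hjumps ▸ h.card_jumps,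
      fun k => (hprod k).symm.trans (h.colorProd k)⟩,
    fun h => ⟨(A.isColoring_rotate r.toAdd c).2 h.coloring,
      (congrArg (· + 1) hjumps).trans h.card_jumps,
      fun k => (hprod k).trans (h.colorProd k)⟩⟩

theorem stateSum_smul (G : RigidGauss π N) (r : Rot N) : (r • G).stateSum Γ = G.stateSum Γ := by
  symm
  refine Finset.sum_bij' (fun c _ e => c (e - r.toAdd)) (fun c _ e => c (e + r.toAdd))
    (fun c hc => ?_) (fun c hc => ?_) (fun c _ => by simp only [add_sub_cancel_right])
    (fun c _ => by simp only [sub_add_cancel]) (fun c _ => ?_)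
  · rw [RigidArrow.mem_states] at hc ⊢
    exact (G.isState_smul r c).2 hc
  · rw [RigidArrow.mem_states] at hc ⊢
    rw [← G.isState_smul r]
    simp only [sub_add_cancel]
    exact hc
  · change _ = ∏ t ∈ (G.toNaked.rotate r.toAdd).jumps _,
      ((G.writhe (t - r.toAdd) : SignType) : ℚ)
    rw [Naked.jumps_rotate, Finset.prod_map]
    simp only [Equiv.coe_toEmbedding, Equiv.coe_addRight, add_sub_cancel_right]
    rfl

end Rotation

section Conjugation

variable {π : Type*} [Group π] {N : ℕ} {K : Type*}

theorem prod_map_range_gauge (H f : ℕ → π) (n : ℕ) :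
    ((List.range n).map fun j => (H j)⁻¹ * f j * H (j + 1)).prod =
      (H 0)⁻¹ * ((List.range n).map f).prod * H n := by
  induction n with
  | zero => simp
  | succ n ih =>
    rw [List.range_succ, List.map_append, List.prod_append, ih, List.map_append, List.prod_append]
    simp only [List.map_cons, List.map_nil, List.prod_singleton]
    group

theorem Marking.colorProd_gauge [DecidableEq K] {μ μ' : Marking π (N + 1)} {c : Pt (N + 1) → K}
    {k : K} (H : Pt (N + 1) → π)
    (h : ∀ e, (if c e = k then μ' e else 1) = (H e)⁻¹ * (if c e = k then μ e else 1) * H (e + 1)) :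
    μ'.colorProd c k = μ.colorProd c k := by
  have hsucc : ∀ j, Fin.ofNat (size (N + 1)) j + 1 = Fin.ofNat _ (j + 1) := fun j => by
    rw [ofNat_add]
    rfl
  have hround : Fin.ofNat (size (N + 1)) (size (N + 1)) = Fin.ofNat _ 0 :=
    Fin.ext (Nat.mod_self _)
  have hprod := prod_map_range_gauge (fun j => H (Fin.ofNat _ j))
    (fun j => if c (Fin.ofNat _ j) = k then μ (Fin.ofNat _ j) else 1) (size (N + 1))
  simp only [colorProd, h, map_finRange_eq_map_range, hsucc]
  rw [hprod, hround, ConjClasses.mk_eq_mk_iff_isConj, isConj_iff]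
  exact ⟨H (Fin.ofNat _ 0), by group⟩

namespace RigidGauss

variable (G : RigidGauss π N) (w : π →* ℤˣ) (g : π)

theorem conjugate_partner_mark (i : Pt N) :
    (G.conjugate w (G.partner i) g).mark = (G.conjugate w i g).mark := by
  simp only [conjugate, G.partner_partner, or_comm]

theorem colorProd_conjugate_of_pred_eq_iff [DecidableEq K] {i : Pt N} {c : Pt N → K} {k : K}
    (hi : c (i - 1) = k ↔ c i = k)
    (hi' : c (G.partner i - 1) = k ↔ c (G.partner i) = k) :
    (G.conjugate w i g).mark.colorProd c k = G.mark.colorProd c k := by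
  cases N with
  | zero => rfl
  | succ N =>
    have hends : ∀ e, e = i ∨ e = G.partner i → (c (e - 1) = k ↔ c e = k) := by
      rintro e (rfl | rfl) <;> assumption
    refine Marking.colorProd_gauge
      (fun e => if (e = i ∨ e = G.partner i) ∧ c e = k then g else 1) fun e => ?_
    change (if c e = k then (if e = i ∨ e = G.partner i then g⁻¹ else 1) * G.mark e *
      (if e + 1 = i ∨ e + 1 = G.partner i then g else 1) else 1) = _
    have hnext := hends (e + 1)
    rw [add_sub_cancel_right] at hnext
    by_cases hc : c e = k <;> by_cases he : e = i ∨ e = G.partner i <;>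
      by_cases he' : e + 1 = i ∨ e + 1 = G.partner i <;>
      simp_all only [if_true, if_false, false_and, true_iff, false_iff, and_self, and_true,
        and_false, forall_const, inv_one, one_mul, mul_one]

end RigidGauss

variable [LinearOrder K] [Fintype K]

namespace RigidGauss

variable (G : RigidGauss π N) (w : π →* ℤˣ) (g : π)

theorem colorProd_conjugate_of_pred_eq {i : Pt N} {c : Pt N → K} (hc : G.IsTreeColoring c)
    (hi : c (i - 1) ≠ c i) :
    (G.conjugate w i g).mark.colorProd c (c (i - 1)) = G.mark.colorProd c (c (i - 1)) := by
  have hdir := G.dir_ne_zero (Naked.ne_zero_of_pred_ne hi) i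
  obtain ⟨N, rfl⟩ := Nat.exists_eq_succ_of_ne_zero (Naked.ne_zero_of_pred_ne hi)
  obtain ⟨hpred', hpartner⟩ := hc.coloring.smooth_of_ne hi
  refine Marking.colorProd_gauge
    (fun e => if G.OnArc i e ∨ e = G.partner i then g else 1) fun e => ?_
  change (if c e = c (i - 1) then (if e = i ∨ e = G.partner i then g⁻¹ else 1) * G.mark e *
    (if e + 1 = i ∨ e + 1 = G.partner i then g else 1) else 1) = _
  by_cases hnext : e + 1 = i
  · obtain rfl : e = i - 1 := eq_sub_of_add_eq hnext
    have hne : i - 1 ≠ i := fun h => hi (congrArg c h)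
    simp only [hnext, hne, G.onArc_self hdir, G.not_onArc_pred_self, true_or, false_or, if_true]
    split_ifs <;> simp
  by_cases hnext' : e + 1 = G.partner i
  · obtain rfl : e = G.partner i - 1 := eq_sub_of_add_eq hnext'
    simp [hpred', hi.symm, G.onArc_pred_partner hdir]
  have hstep : G.OnArc i e ↔ G.OnArc i (e + 1) := by
    have h := G.onArc_pred hnext hnext'
    rwa [add_sub_cancel_right] at h
  by_cases he : c e = c (i - 1)
  · have hne : e ≠ i := by
      rintro rfl
      exact hi he.symm
    simp only [hnext, hnext', he, ← hstep, hc.not_onArc hi he, hne, false_or, if_true, if_false]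
    split_ifs <;> simp
  · have hne : e ≠ G.partner i := by
      rintro rfl
      exact he hpartner
    by_cases harc : G.OnArc i (e + 1) <;> simp [hnext', he, hne, hstep, harc]

theorem colorProd_conjugate {c : Pt N → K} (hc : G.IsTreeColoring c) (i : Pt N) (k : K) :
    (G.conjugate w i g).mark.colorProd c k = G.mark.colorProd c k := by
  by_cases hi : c (i - 1) = c i
  · rcases hc.coloring.pred_eq_or_smooth i with ⟨-, h⟩ | ⟨h, h'⟩
    · exact G.colorProd_conjugate_of_pred_eq_iff w g (by rw [hi]) (by rw [h])
    · exact G.colorProd_conjugate_of_pred_eq_iff w g (by rw [hi]) (by rw [h, h', hi])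
  obtain ⟨hpred, hpartner⟩ := hc.coloring.smooth_of_ne hi
  obtain rfl | hk := eq_or_ne (c (i - 1)) k
  · exact G.colorProd_conjugate_of_pred_eq w g hc hi
  obtain rfl | hk' := eq_or_ne (c i) k
  · rw [← G.conjugate_partner_mark, ← hpred]
    exact G.colorProd_conjugate_of_pred_eq w g hc (by rw [hpred, hpartner]; exact Ne.symm hi)
  · exact G.colorProd_conjugate_of_pred_eq_iff w g (by simp only [hk, hk'])
      (by simp only [hpred, hpartner, hk, hk'])

theorem stateSum_conjugate {Γ : K → ConjClasses π} (hΓ : ∀ k, Γ k ≠ ConjClasses.mk 1)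
    {w : π →* ℤˣ} (hw : w g = 1) (i : Pt N) :
    (G.conjugate w i g).stateSum Γ = G.stateSum Γ := by
  have hnaked : (G.conjugate w i g).toNaked = G.toNaked := by
    refine Naked.ext rfl (funext fun j => if_neg ?_)
    rw [hw]
    exact fun h => absurd h.2 (by decide)
  have hstate : ∀ c : Pt N → K, (G.conjugate w i g).IsState Γ c ↔ G.IsState Γ c := fun c =>
    ⟨fun h => ⟨hnaked ▸ h.coloring, hnaked ▸ h.card_jumps, fun k =>
      (G.colorProd_conjugate w g (hnaked ▸ h.isTreeColoring hΓ) i k).symm.trans (h.colorProd k)⟩,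
    fun h => ⟨hnaked.symm ▸ h.coloring, hnaked.symm ▸ h.card_jumps, fun k =>
      (G.colorProd_conjugate w g (h.isTreeColoring hΓ) i k).trans (h.colorProd k)⟩⟩
  refine Finset.sum_congr (Finset.ext fun c => ?_) fun c _ => ?_
  · rw [RigidArrow.mem_states, RigidArrow.mem_states, hstate]
  · rw [weight, weight, hnaked]
    rfl

end RigidGauss

end Conjugation

/-! ### The first Reidemeister move -/

section R1

variable {N : ℕ}

theorem one_ne_zero_pt (hN : N ≠ 0) : (1 : Pt N) ≠ 0 := by
  intro h
  have hval := congrArg Fin.val h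
  have hsize := size_eq hN
  rw [Fin.val_one', Fin.val_zero, Nat.mod_eq_of_lt (by omega)] at hval
  exact one_ne_zero hval

theorem add_one_ne (hN : N ≠ 0) (e : Pt N) : e + 1 ≠ e := fun h =>
  one_ne_zero_pt hN (add_eq_left.1 h)

theorem val_one (hN : N ≠ 0) : (1 : Pt N).val = 1 := by
  have hsize := size_eq hN
  rw [Fin.val_one', Nat.mod_eq_of_lt (by omega)]

theorem Naked.onArc_iff_eq (D : Naked N) {e f : Pt N} (he : D.partner e = e + 1) (hN : N ≠ 0) :
    D.OnArc e f ↔ f = e := by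
  rw [OnArc, he, add_sub_cancel_left, Fin.lt_def, val_one hN, Nat.lt_one_iff,
    Fin.val_eq_zero_iff, sub_eq_zero]

variable {π : Type*} [Group π] {K : Type} [LinearOrder K] [Fintype K] {Γ : K → ConjClasses π}

/-- Otherwise the color class of the surrounded edge would consist of that edge alone. -/
theorem RigidArrow.IsState.pred_eq_of_isolated {A : RigidArrow π N} {c : Pt N → K}
    (hc : A.IsState Γ c) (hΓ : ∀ k, Γ k ≠ ConjClasses.mk 1) (hN : N ≠ 0) {e : Pt N}
    (he : A.partner e = e + 1) (hmark : A.mark.at e = 1) : c (e - 1) = c e := by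
  by_contra hne
  obtain ⟨f, hf, hmark'⟩ := hc.exists_at_ne_one hΓ hN (c e)
  have harc := (hc.isTreeColoring hΓ).onArc_iff_of_pred_ne hne hf
  rw [A.onArc_iff_eq he hN, A.onArc_iff_eq he hN] at harc
  exact hmark' (harc.2 rfl ▸ hmark)

theorem stateSum_remove_r1 (hΓ : ∀ k, Γ k ≠ ConjClasses.mk 1) (G : RigidGauss π N) {a : Pt N}
    (h : G.IsR1 a) : (G.remove {a}).stateSum Γ = G.stateSum Γ := by
  rw [RigidGauss.remove, stateSum_sub, RigidGauss.stateSum, Finset.filter_true_of_mem]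
  intro c hc t ht
  rw [RigidArrow.mem_states] at hc
  refine Finset.mem_sdiff.2 ⟨Finset.filter_subset _ _ ht, fun hta => ?_⟩
  obtain rfl := Finset.mem_singleton.1 hta
  obtain ⟨hdir, hne⟩ := Naked.mem_jumps.1 ht
  have hN := Naked.ne_zero_of_tail hdir
  rcases h.2 with ⟨hpartner, hmark⟩ | ⟨hpartner, hmark⟩
  · exact hne (hc.pred_eq_of_isolated hΓ hN hpartner hmark)
  · refine hne ((hc.coloring.pred_eq_iff t).2 ?_)
    exact hc.pred_eq_of_isolated hΓ hN ((G.partner_partner t).trans hpartner) hmark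

end R1

/-! ### Exchanging the ends of edges -/

section EdgeEnds

variable {N : ℕ}

/-- The points `x` and `y` are the two ends of the edge `e`, in some order. -/
def EdgeEnds (e x y : Pt N) : Prop := (x = e ∧ y = e + 1) ∨ (y = e ∧ x = e + 1)

namespace EdgeEnds

variable {e x y : Pt N}

theorem symm (h : EdgeEnds e x y) : EdgeEnds e y x := Or.symm h

theorem left_eq (h : EdgeEnds e x y) : x = e ∨ x = e + 1 := h.imp And.left And.right

theorem of_ne (hxy : x ≠ y) (hx : x = e ∨ x = e + 1) (hy : y = e ∨ y = e + 1) :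
    EdgeEnds e x y := by
  rcases hx with rfl | rfl <;> rcases hy with rfl | rfl
  exacts [absurd rfl hxy, Or.inl ⟨rfl, rfl⟩, Or.inr ⟨rfl, rfl⟩, absurd rfl hxy]

end EdgeEnds

end EdgeEnds

section Flip

variable {N : ℕ} {E : Finset (Pt N)}

/-- The permutation of the points that exchanges the ends of the edges in `E`, provided that these
edges are disjoint. -/
def swapPoint (E : Finset (Pt N)) (i : Pt N) : Pt N :=
  if i ∈ E then i + 1 else if i - 1 ∈ E then i - 1 else i

theorem swapPoint_of_mem {e : Pt N} (he : e ∈ E) : swapPoint E e = e + 1 := if_pos he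

theorem swapPoint_add_one (hE : ∀ e ∈ E, e + 1 ∉ E) {e : Pt N} (he : e ∈ E) :
    swapPoint E (e + 1) = e := by
  rw [swapPoint, if_neg (hE e he), add_sub_cancel_right, if_pos he]

theorem swapPoint_of_notMem {e : Pt N} (he : e ∉ E) (he' : e - 1 ∉ E) : swapPoint E e = e := by
  rw [swapPoint, if_neg he, if_neg he']

theorem swapPoint_swapPoint (hE : ∀ e ∈ E, e + 1 ∉ E) (i : Pt N) :
    swapPoint E (swapPoint E i) = i := by
  by_cases hi : i ∈ E
  · rw [swapPoint_of_mem hi, swapPoint_add_one hE hi]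
  by_cases hi' : i - 1 ∈ E
  · have hpred := swapPoint_add_one hE hi'
    rw [sub_add_cancel] at hpred
    rw [hpred, swapPoint_of_mem hi', sub_add_cancel]
  · rw [swapPoint_of_notMem hi hi', swapPoint_of_notMem hi hi']

theorem swapPoint_injective (hE : ∀ e ∈ E, e + 1 ∉ E) : Function.Injective (swapPoint E) :=
  Function.LeftInverse.injective (swapPoint_swapPoint hE)

theorem swapPoint_surjective (hE : ∀ e ∈ E, e + 1 ∉ E) : Function.Surjective (swapPoint E) :=
  Function.RightInverse.surjective (swapPoint_swapPoint hE)

theorem EdgeEnds.swapPoint_eq {e x y : Pt N} (h : EdgeEnds e x y) (hE : ∀ e ∈ E, e + 1 ∉ E)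
    (he : e ∈ E) : swapPoint E x = y := by
  rcases h with ⟨rfl, rfl⟩ | ⟨rfl, rfl⟩
  · exact swapPoint_of_mem he
  · exact swapPoint_add_one hE he

theorem sub_one_notMem (hE : ∀ e ∈ E, e + 1 ∉ E) {e : Pt N} (he : e ∈ E) : e - 1 ∉ E :=
  fun h => hE _ h (by rwa [sub_add_cancel])

variable {K : Type*}

/-- A coloring is tame on `E` if the color of each edge in `E` is that of a neighbor. -/
def IsTame (E : Finset (Pt N)) (c : Pt N → K) : Prop :=
  ∀ e ∈ E, c (e - 1) = c e ∨ c e = c (e + 1)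

theorem EdgeEnds.pred_eq_or_eq_iff {e x y : Pt N} (h : EdgeEnds e x y) {c : Pt N → K} :
    (c (e - 1) = c e ∨ c e = c (e + 1)) ↔ (c (x - 1) = c x ∨ c (y - 1) = c y) := by
  rcases h with ⟨rfl, rfl⟩ | ⟨rfl, rfl⟩
  · rw [add_sub_cancel_right]
  · rw [add_sub_cancel_right, or_comm]

variable [LinearOrder K] {c : Pt N → K}

/-- The coloring that carries the jumps at the ends of the edges in `E` to the other ends: where a
tame coloring gives an edge the color of one neighbor, it gives it that of the other. -/
def flipColor (E : Finset (Pt N)) (c : Pt N → K) (e : Pt N) : K :=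
  if e ∈ E then (if c e = c (e - 1) then c (e + 1) else c (e - 1)) else c e

theorem flipColor_of_notMem {e : Pt N} (he : e ∉ E) : flipColor E c e = c e := if_neg he

theorem flipColor_swapPoint (hE : ∀ e ∈ E, e + 1 ∉ E) (hc : IsTame E c) (i : Pt N) :
    (flipColor E c (swapPoint E i - 1) = c (i - 1) ∧ flipColor E c (swapPoint E i) = c i) ∨
    (c (i - 1) = c i ∧ flipColor E c (swapPoint E i - 1) = flipColor E c (swapPoint E i)) := by
  by_cases hi : i ∈ E
  · rw [swapPoint_of_mem hi, add_sub_cancel_right, flipColor_of_notMem (hE i hi), flipColor,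
      if_pos hi]
    by_cases hpred : c i = c (i - 1)
    · rw [if_pos hpred]
      exact Or.inr ⟨hpred.symm, rfl⟩
    · rw [if_neg hpred]
      exact Or.inl ⟨rfl, ((hc i hi).resolve_left (Ne.symm hpred)).symm⟩
  by_cases hi' : i - 1 ∈ E
  · have htame := hc _ hi'
    have hswap : swapPoint E i = i - 1 := by rw [swapPoint, if_neg hi, if_pos hi']
    rw [sub_add_cancel] at htame
    rw [hswap, flipColor_of_notMem (sub_one_notMem hE hi'), flipColor, if_pos hi', sub_add_cancel]
    by_cases hpred : c (i - 1) = c (i - 1 - 1)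
    · rw [if_pos hpred]
      exact Or.inl ⟨hpred.symm, rfl⟩
    · rw [if_neg hpred]
      exact Or.inr ⟨htame.resolve_left (Ne.symm hpred), rfl⟩
  · rw [swapPoint_of_notMem hi hi', flipColor_of_notMem hi, flipColor_of_notMem hi']
    exact Or.inl ⟨rfl, rfl⟩

theorem flipColor_flipColor (hE : ∀ e ∈ E, e + 1 ∉ E) (hc : IsTame E c) :
    flipColor E (flipColor E c) = c := by
  funext e
  by_cases he : e ∈ E
  · rw [flipColor, if_pos he, flipColor_of_notMem (hE e he),
      flipColor_of_notMem (sub_one_notMem hE he), flipColor, if_pos he]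
    by_cases hpred : c e = c (e - 1)
    · rw [if_pos hpred, hpred]
      exact ite_eq_right_iff.2 id
    · rw [if_neg hpred, if_pos rfl]
      exact ((hc e he).resolve_left (Ne.symm hpred)).symm
  · rw [flipColor_of_notMem he, flipColor_of_notMem he]

theorem isTame_flipColor (hE : ∀ e ∈ E, e + 1 ∉ E) : IsTame E (flipColor E c) := by
  intro e he
  rw [flipColor_of_notMem (hE e he), flipColor_of_notMem (sub_one_notMem hE he), flipColor,
    if_pos he]
  split_ifs
  exacts [Or.inr rfl, Or.inl rfl]

variable {π : Type*} [Group π]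

/-- The arrow diagram `A'` is obtained from `A` by exchanging the ends of the edges in `E`, which
are disjoint and decorated by `1`. -/
structure IsSwap (E : Finset (Pt N)) (A A' : RigidArrow π N) : Prop where
  sparse : ∀ e ∈ E, e + 1 ∉ E
  partner : ∀ i, A'.partner (swapPoint E i) = swapPoint E (A.partner i)
  dir : ∀ i, A'.dir (swapPoint E i) = A.dir i
  mark : A'.mark = A.mark
  mark_eq_one : ∀ e ∈ E, A.mark.at e = 1

namespace IsSwap

variable {A A' : RigidArrow π N}

theorem symm (h : IsSwap E A A') : IsSwap E A' A where
  sparse := h.sparse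
  partner i := by
    rw [← swapPoint_swapPoint h.sparse (A.partner _), ← h.partner, swapPoint_swapPoint h.sparse]
  dir i := by rw [← h.dir, swapPoint_swapPoint h.sparse]
  mark := h.mark.symm
  mark_eq_one := h.mark ▸ h.mark_eq_one

theorem isColoring_flipColor (h : IsSwap E A A') (hc : IsTame E c) (hcol : A.IsColoring c) :
    A'.IsColoring (flipColor E c) := by
  intro t ht
  obtain ⟨t, rfl⟩ := swapPoint_surjective h.sparse t
  rw [h.dir] at ht
  rw [Naked.RuleAt, h.partner]
  have htail := flipColor_swapPoint h.sparse hc t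
  have hhead := flipColor_swapPoint h.sparse hc (A.partner t)
  rcases hcol t ht with hflat | hjump
  · left
    constructor
    · rcases htail with htail | htail
      · rw [htail.1, htail.2, hflat.1]
      · exact htail.2
    · rcases hhead with hhead | hhead
      · rw [hhead.1, hhead.2, hflat.2]
      · exact hhead.2
  · right
    have htail := htail.resolve_right fun h => hjump.1.ne h.1
    have hhead := hhead.resolve_right fun h => hjump.1.ne (by rw [← hjump.2.1, ← hjump.2.2, h.1])
    rw [htail.1, htail.2, hhead.1, hhead.2]
    exact hjump

theorem swapPoint_mem_jumps_flipColor (h : IsSwap E A A') (hc : IsTame E c) {t : Pt N} :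
    swapPoint E t ∈ A'.jumps (flipColor E c) ↔ t ∈ A.jumps c := by
  rw [Naked.mem_jumps, Naked.mem_jumps, h.dir]
  rcases flipColor_swapPoint h.sparse hc t with heq | hflat
  · rw [heq.1, heq.2]
  · exact and_congr_right fun _ => iff_of_false (not_not.2 hflat.2) (not_not.2 hflat.1)

theorem jumps_flipColor (h : IsSwap E A A') (hc : IsTame E c) :
    A'.jumps (flipColor E c) = (A.jumps c).image (swapPoint E) := by
  ext t
  obtain ⟨t, rfl⟩ := swapPoint_surjective h.sparse t
  rw [h.swapPoint_mem_jumps_flipColor hc, (swapPoint_injective h.sparse).mem_finset_image]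

theorem isState_flipColor [Fintype K] {Γ : K → ConjClasses π} (h : IsSwap E A A')
    (hc : IsTame E c) (hN : N ≠ 0) (hs : A.IsState Γ c) : A'.IsState Γ (flipColor E c) where
  coloring := h.isColoring_flipColor hc hs.coloring
  card_jumps := by
    rw [h.jumps_flipColor hc, Finset.card_image_of_injective _ (swapPoint_injective h.sparse),
      hs.card_jumps]
  colorProd k := by
    rw [h.mark, ← hs.colorProd k]
    refine Marking.colorProd_congr hN _ (fun e he => ?_) k
    exact h.mark_eq_one e (by_contra fun heE => he (flipColor_of_notMem heE))

theorem weight_flipColor {G G' : RigidGauss π N} (h : IsSwap E G.toRigidArrow G'.toRigidArrow)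
    (hc : IsTame E c) :
    G'.weight (flipColor E c) = ∏ t ∈ G.jumps c, (G'.writhe (swapPoint E t) : ℚ) := by
  rw [RigidGauss.weight, h.jumps_flipColor hc,
    Finset.prod_image (swapPoint_injective h.sparse).injOn]

end IsSwap

end Flip

/-! ### The second Reidemeister move -/

section R2

variable {N : ℕ} {π : Type*} [Group π] {G : RigidGauss π N} {a b q : Pt N}

theorem swapPoint_pair_of_ne {e f x y x' y' i : Pt N} (h : EdgeEnds e x y)
    (h' : EdgeEnds f x' y') (hx : i ≠ x) (hy : i ≠ y) (hx' : i ≠ x') (hy' : i ≠ y') :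
    swapPoint {e, f} i = i := by
  have hne : ∀ {e x y : Pt N}, EdgeEnds e x y → i ≠ x → i ≠ y → i ≠ e ∧ i - 1 ≠ e := by
    rintro e x y (⟨rfl, rfl⟩ | ⟨rfl, rfl⟩) hx hy
    exacts [⟨hx, fun h => hy (sub_eq_iff_eq_add.1 h)⟩, ⟨hy, fun h => hx (sub_eq_iff_eq_add.1 h)⟩]
  obtain ⟨he, he'⟩ := hne h hx hy
  obtain ⟨hf, hf'⟩ := hne h' hx' hy'
  refine swapPoint_of_notMem ?_ ?_ <;> simp only [Finset.mem_insert, Finset.mem_singleton, not_or]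
  exacts [⟨he, hf⟩, ⟨he', hf'⟩]

theorem Naked.onArc_add_one (D : Naked N) {a f : Pt N} (h : D.partner a = D.partner (a + 1) + 1)
    (hf : D.OnArc a f) (hfa : f ≠ a) (hfq : f ≠ D.partner (a + 1)) : D.OnArc (a + 1) f := by
  have hx : f - a ≠ 0 := sub_ne_zero.2 hfa
  have hlast : D.partner (a + 1) - a = D.partner a - a - 1 := by rw [h]; abel
  have hne : f - a ≠ D.partner a - a - 1 := fun h => hfq (sub_left_inj.1 (h.trans hlast.symm))
  rw [OnArc, Fin.lt_def] at hf
  have hz : D.partner a - a ≠ 0 := fun h => by simp [h] at hf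
  rw [OnArc, sub_add_eq_sub_sub, sub_add_eq_sub_sub, hlast, Fin.lt_def]
  rw [Ne, Fin.ext_iff, fin_val_pred, if_neg hz] at hne
  have hx' := Fin.val_ne_zero_iff.2 hx
  have hz' : D.partner a - a - 1 ≠ 0 := fun h => by
    have hval := congrArg Fin.val h
    rw [fin_val_pred, if_neg hz, Fin.val_zero] at hval
    omega
  rw [fin_val_pred, if_neg hx, fin_val_pred, if_neg hz', fin_val_pred, if_neg hz]
  omega

namespace RigidGauss.IsR2

theorem edgeEnds (h : G.IsR2 a b) : EdgeEnds a a b := Or.inl ⟨rfl, h.2.2.2.2.1.1⟩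

theorem exists_edgeEnds_partner (h : G.IsR2 a b) :
    ∃ q, EdgeEnds q (G.partner a) (G.partner b) ∧ G.mark.at q = 1 := by
  rcases h.2.2.2.2.2 with ⟨hb, hmark⟩ | ⟨ha, hmark⟩
  · exact ⟨_, Or.inl ⟨rfl, hb⟩, hmark⟩
  · exact ⟨_, Or.inr ⟨rfl, ha⟩, hmark⟩

theorem dir_left (h : G.IsR2 a b) : G.dir a = 1 := G.mem_arrows.1 h.1

theorem dir_right (h : G.IsR2 a b) : G.dir b = 1 := G.mem_arrows.1 h.2.1

theorem sparse (h : G.IsR2 a b) (hq : EdgeEnds q (G.partner a) (G.partner b)) :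
    ∀ e ∈ ({a, q} : Finset (Pt N)), e + 1 ∉ ({a, q} : Finset (Pt N)) := by
  have hN := Naked.ne_zero_of_tail h.dir_left
  obtain ⟨-, rfl⟩ | ⟨-, heq⟩ := h.edgeEnds
  · have hhead : ∀ {t}, G.dir t = 1 → q ≠ t ∧ q + 1 ≠ t := fun ht => by
      rcases hq with ⟨h₁, h₂⟩ | ⟨h₁, h₂⟩ <;> rw [← h₂, ← h₁]
      exacts [⟨Naked.partner_ne_tail h.dir_left ht, Naked.partner_ne_tail h.dir_right ht⟩,
        ⟨Naked.partner_ne_tail h.dir_right ht, Naked.partner_ne_tail h.dir_left ht⟩]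
    simp only [Finset.mem_insert, Finset.mem_singleton, forall_eq_or_imp, forall_eq, not_or]
    exact ⟨⟨add_one_ne hN a, (hhead h.dir_right).1.symm⟩, (hhead h.dir_left).2, add_one_ne hN q⟩
  · exact absurd heq.symm (add_one_ne hN a)

theorem isSwap (h : G.IsR2 a b) (hq : EdgeEnds q (G.partner a) (G.partner b))
    (hmark : G.mark.at q = 1) : IsSwap {a, q} G.toRigidArrow G.toRigidArrow := by
  have hE := h.sparse hq
  have ha := h.edgeEnds.swapPoint_eq hE (Finset.mem_insert_self a _)
  have hb := h.edgeEnds.symm.swapPoint_eq hE (Finset.mem_insert_self a _)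
  have hqE : q ∈ ({a, q} : Finset (Pt N)) := Finset.mem_insert_of_mem (Finset.mem_singleton_self q)
  have hpa := hq.swapPoint_eq hE hqE
  have hpb := hq.symm.swapPoint_eq hE hqE
  have hends : ∀ i, (i = a ∨ i = b ∨ i = G.partner a ∨ i = G.partner b) ∨
      (swapPoint {a, q} i = i ∧ swapPoint {a, q} (G.partner i) = G.partner i) := fun i => by
    by_contra! hi
    obtain ⟨⟨h₁, h₂, h₃, h₄⟩, hi⟩ := hi
    refine hi (swapPoint_pair_of_ne h.edgeEnds hq h₁ h₂ h₃ h₄)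
      (swapPoint_pair_of_ne h.edgeEnds hq ?_ ?_ ?_ ?_)
    exacts [mt G.partner_eq_comm.1 h₃, mt G.partner_eq_comm.1 h₄, G.partner_injective.ne h₁,
      G.partner_injective.ne h₂]
  refine ⟨hE, fun i => ?_, fun i => ?_, rfl, ?_⟩
  · rcases hends i with (rfl | rfl | rfl | rfl) | ⟨hi, hi'⟩
    · rw [ha, hpa]
    · rw [hb, hpb]
    · rw [hpa, G.partner_partner, G.partner_partner, ha]
    · rw [hpb, G.partner_partner, G.partner_partner, hb]
    · rw [hi, hi']
  · rcases hends i with (rfl | rfl | rfl | rfl) | ⟨hi, -⟩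
    · rw [ha, h.dir_left, h.dir_right]
    · rw [hb, h.dir_left, h.dir_right]
    · rw [hpa, G.dir_partner, G.dir_partner, h.dir_left, h.dir_right]
    · rw [hpb, G.dir_partner, G.dir_partner, h.dir_left, h.dir_right]
    · rw [hi]
  · simp only [Finset.mem_insert, Finset.mem_singleton, forall_eq_or_imp, forall_eq]
    exact ⟨h.2.2.2.2.1.2, hmark⟩

variable {K : Type} [LinearOrder K] {c : Pt N → K}

theorem isTame (h : G.IsR2 a b) (hq : EdgeEnds q (G.partner a) (G.partner b))
    (hc : G.IsColoring c) (hab : ¬ (a ∈ G.jumps c ∧ b ∈ G.jumps c)) : IsTame {a, q} c := by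
  have hflat : c (a - 1) = c a ∨ c (b - 1) = c b := by
    by_contra! hne
    exact hab ⟨Naked.mem_jumps.2 ⟨h.dir_left, hne.1⟩, Naked.mem_jumps.2 ⟨h.dir_right, hne.2⟩⟩
  intro e he
  rcases Finset.mem_insert.1 he with rfl | he
  · rwa [h.edgeEnds.pred_eq_or_eq_iff]
  · obtain rfl := Finset.mem_singleton.1 he
    rwa [hq.pred_eq_or_eq_iff, ← hc.pred_eq_iff, ← hc.pred_eq_iff]

theorem weight_flipColor (h : G.IsR2 a b) (hq : EdgeEnds q (G.partner a) (G.partner b))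
    (hmark : G.mark.at q = 1) (hc : IsTame {a, q} c) (hab : a ∈ G.jumps c ↔ b ∉ G.jumps c) :
    G.weight (flipColor {a, q} c) = - G.weight c := by
  have hswap := h.isSwap hq hmark
  have ha := h.edgeEnds.swapPoint_eq hswap.sparse (Finset.mem_insert_self a _)
  have hb := h.edgeEnds.symm.swapPoint_eq hswap.sparse (Finset.mem_insert_self a _)
  obtain ⟨x, hx, hother, hsign⟩ : ∃ x ∈ G.jumps c, (∀ t ∈ G.jumps c, t ≠ x → t ≠ a ∧ t ≠ b) ∧
      (G.writhe (swapPoint {a, q} x) : ℚ) = - G.writhe x := by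
    by_cases hmem : a ∈ G.jumps c
    · refine ⟨a, hmem, fun t ht hta => ⟨hta, ?_⟩, ?_⟩
      · rintro rfl
        exact hab.1 hmem ht
      · rw [ha, h.2.2.2.1, SignType.coe_neg, neg_neg]
    · refine ⟨b, not_not.1 (mt hab.2 hmem), fun t ht htb => ⟨?_, htb⟩, ?_⟩
      · rintro rfl
        exact hmem ht
      · rw [hb, h.2.2.2.1, SignType.coe_neg]
  rw [hswap.weight_flipColor hc, RigidGauss.weight, ← Finset.mul_prod_erase _ _ hx,
    ← Finset.mul_prod_erase _ (fun t => (G.writhe t : ℚ)) hx, hsign, neg_mul]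
  congr 2
  refine Finset.prod_congr rfl fun t ht => ?_
  obtain ⟨htx, ht⟩ := Finset.mem_erase.1 ht
  obtain ⟨hta, htb⟩ := hother t ht htx
  have hdir := Naked.tail_of_mem_jumps ht
  rw [swapPoint_pair_of_ne h.edgeEnds hq hta htb (Naked.partner_ne_tail h.dir_left hdir).symm
    (Naked.partner_ne_tail h.dir_right hdir).symm]

theorem mem_jumps_flipColor_iff (h : G.IsR2 a b)
    (hswap : IsSwap {a, q} G.toRigidArrow G.toRigidArrow) (hc : IsTame {a, q} c) :
    (a ∈ G.jumps (flipColor {a, q} c) ↔ b ∈ G.jumps c) ∧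
      (b ∈ G.jumps (flipColor {a, q} c) ↔ a ∈ G.jumps c) := by
  rw [← hswap.swapPoint_mem_jumps_flipColor hc, ← hswap.swapPoint_mem_jumps_flipColor hc,
    h.edgeEnds.swapPoint_eq hswap.sparse (Finset.mem_insert_self a _),
    h.edgeEnds.symm.swapPoint_eq hswap.sparse (Finset.mem_insert_self a _)]
  exact ⟨Iff.rfl, Iff.rfl⟩

variable [Fintype K] {Γ : K → ConjClasses π}

/-- If the arrows are parallel, the color would increase along a cycle of length two. If they are
antiparallel, the color class of the edge between the tails would consist of trivially decorated
edges. -/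
theorem not_mem_jumps_and_mem_jumps (h : G.IsR2 a b) (hΓ : ∀ k, Γ k ≠ ConjClasses.mk 1)
    (hc : G.IsState Γ c) : ¬ (a ∈ G.jumps c ∧ b ∈ G.jumps c) := by
  rintro ⟨ha, hb⟩
  have hN := Naked.ne_zero_of_tail h.dir_left
  obtain ⟨hlt, -, hpartner⟩ := hc.coloring.of_mem_jumps ha
  obtain ⟨hlt', hpred', -⟩ := hc.coloring.of_mem_jumps hb
  obtain ⟨-, -, -, -, ⟨rfl, hmark⟩, ⟨hq, -⟩ | ⟨hq, hmark'⟩⟩ := h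
  · rw [hq, add_sub_cancel_right, hpartner] at hpred'
    rw [add_sub_cancel_right, ← hpred'] at hlt'
    exact lt_asymm hlt hlt'
  · obtain ⟨f, hf, hne⟩ := hc.exists_at_ne_one hΓ hN (c a)
    have htree := hc.isTreeColoring hΓ
    have harc : G.OnArc a f :=
      (htree.onArc_iff ha hf).2 (G.onArc_self (G.dir_ne_zero hN a))
    have harc' : ¬ G.OnArc (a + 1) f :=
      htree.not_onArc hlt'.ne (by rw [hf, add_sub_cancel_right])
    have hfa : f ≠ a := fun h => hne (h ▸ hmark)
    have hfq : f ≠ G.partner (a + 1) := fun h => hne (h ▸ hmark')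
    exact harc' (G.onArc_add_one hq harc hfa hfq)

end RigidGauss.IsR2

variable {K : Type} [LinearOrder K] [Fintype K] {Γ : K → ConjClasses π}

theorem stateSum_remove_r2 (hΓ : ∀ k, Γ k ≠ ConjClasses.mk 1) (h : G.IsR2 a b) :
    (G.remove {a, b}).stateSum Γ = G.stateSum Γ := by
  classical
  obtain ⟨q, hq, hmark⟩ := h.exists_edgeEnds_partner
  have hswap := h.isSwap hq hmark
  have hN := Naked.ne_zero_of_tail h.dir_left
  have hsubset : ∀ c : Pt N → K, ¬ G.jumps c ⊆ G.arrows \ {a, b} ↔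
      a ∈ G.jumps c ∨ b ∈ G.jumps c := fun c => by
    rw [Finset.subset_sdiff, Finset.disjoint_insert_right, Finset.disjoint_singleton_right,
      and_iff_right (show G.jumps c ⊆ G.arrows from Finset.filter_subset _ _), not_and_or, not_not,
      not_not]
  rw [RigidGauss.remove, stateSum_sub, RigidGauss.stateSum,
    ← Finset.sum_filter_add_sum_filter_not (G.states Γ) (fun c => G.jumps c ⊆ G.arrows \ {a, b}),
    left_eq_add]
  simp only [hsubset]
  have hmem : ∀ c ∈ (G.states Γ).filter (fun c => a ∈ G.jumps c ∨ b ∈ G.jumps c),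
      G.IsState Γ c ∧ (a ∈ G.jumps c ↔ b ∉ G.jumps c) ∧ IsTame {a, q} c := fun c hc => by
    obtain ⟨hs, hor⟩ := Finset.mem_filter.1 hc
    rw [RigidArrow.mem_states] at hs
    have hnot := h.not_mem_jumps_and_mem_jumps hΓ hs
    exact ⟨hs, ⟨fun ha hb => hnot ⟨ha, hb⟩, hor.resolve_right⟩, h.isTame hq hs.coloring hnot⟩
  refine Finset.sum_involution (fun c _ => flipColor {a, q} c) ?_ ?_ ?_ ?_
  · intro c hc
    obtain ⟨-, hab, htame⟩ := hmem c hc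
    rw [h.weight_flipColor hq hmark htame hab, add_neg_cancel]
  · intro c hc _ hfix
    obtain ⟨-, hab, htame⟩ := hmem c hc
    have hexchange := (h.mem_jumps_flipColor_iff hswap htame).1
    rw [hfix] at hexchange
    exact iff_not_self (hexchange.symm.trans hab)
  · intro c hc
    obtain ⟨hs, -, htame⟩ := hmem c hc
    rw [Finset.mem_filter, RigidArrow.mem_states, (h.mem_jumps_flipColor_iff hswap htame).1,
      (h.mem_jumps_flipColor_iff hswap htame).2, or_comm]
    exact ⟨hswap.isState_flipColor htame hN hs, (Finset.mem_filter.1 hc).2⟩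
  · exact fun c hc => flipColor_flipColor hswap.sparse (hmem c hc).2.2

end R2

/-! ### The rules at the arrows of a triangle -/

section LocalRules

/-- The colors around an edge: those of the preceding edge, of the edge itself and of the following
edge. -/
structure EdgeColors (K : Type*) where
  left : K
  mid : K
  right : K

namespace EdgeColors

variable {K : Type*}

/-- The color before one of the ends of the edge, the first one if `first` holds. -/
def before (t : EdgeColors K) (first : Prop) [Decidable first] : K :=
  if first then t.left else t.mid

/-- The color after one of the ends of the edge, the first one if `first` holds. -/
def after (t : EdgeColors K) (first : Prop) [Decidable first] : K :=
  if first then t.mid else t.right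

/-- The color changes at one of the ends of the edge, the first one if `first` holds. -/
def IsJump (t : EdgeColors K) (first : Prop) [Decidable first] : Prop :=
  t.before first ≠ t.after first

/-- The colors around an edge whose own color is replaced by `v`. -/
def recolor (t : EdgeColors K) (v : K) : EdgeColors K := ⟨t.left, v, t.right⟩

end EdgeColors

variable {K : Type*} [LinearOrder K]

/-- The rules at three arrows, from a top to a middle edge, from the top to a bottom edge, and from
the middle to the bottom edge, in terms of the colors around these edges. The first arrow ends
second at the top edge iff `τ`, the first arrow ends first at the middle edge iff `μ`, and the third
arrow ends first at the bottom edge iff `β`. -/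
structure LocalRules (τ μ β : Prop) [Decidable τ] [Decidable μ] [Decidable β]
    (t m b : EdgeColors K) : Prop where
  top_mid : Naked.Matches (t.before ¬τ) (t.after ¬τ) (m.before μ) (m.after μ)
  top_bot : Naked.Matches (t.before τ) (t.after τ) (b.before ¬β) (b.after ¬β)
  mid_bot : Naked.Matches (m.before ¬μ) (m.after ¬μ) (b.before β) (b.after β)

/-- The colors next to the edges fit together if these are passed in the order top, middle, bottom,
and the color that is not next to the top edge lies between the other two. -/
def PosBetween (t m b : EdgeColors K) : Prop :=
  (t.left = b.right ∧ t.right = m.left ∧ m.right = b.left) ∧ t.left < m.right ∧ m.right < t.right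

/-- As `PosBetween`, but the color that is not next to the top edge is the largest one. -/
def PosAbove (t m b : EdgeColors K) : Prop :=
  (t.left = b.right ∧ t.right = m.left ∧ m.right = b.left) ∧ t.left < t.right ∧ t.right < m.right

/-- As `PosBetween`, for the opposite cyclic order of the edges. -/
def NegBetween (t m b : EdgeColors K) : Prop :=
  (t.right = b.left ∧ b.right = m.left ∧ m.right = t.left) ∧ t.left < m.left ∧ m.left < t.right

/-- As `NegBetween`, but the color that is not next to the top edge is the smallest one. -/
def NegBelow (t m b : EdgeColors K) : Prop :=
  (t.right = b.left ∧ b.right = m.left ∧ m.right = t.left) ∧ m.left < t.left ∧ t.left < t.right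

variable {τ μ β : Prop} [Decidable τ] [Decidable μ] [Decidable β] {t m b : EdgeColors K}

theorem localRules_iff : LocalRules τ μ β t m b ↔
    Naked.Matches (t.before ¬τ) (t.after ¬τ) (m.before μ) (m.after μ) ∧
    Naked.Matches (t.before τ) (t.after τ) (b.before ¬β) (b.after ¬β) ∧
    Naked.Matches (m.before ¬μ) (m.after ¬μ) (b.before β) (b.after β) :=
  ⟨fun h => ⟨h.1, h.2, h.3⟩, fun h => ⟨h.1, h.2.1, h.2.2⟩⟩

theorem localRules_isJump_top_iff :
    (LocalRules τ μ β t m b ∧ t.IsJump ¬τ ∧ t.IsJump τ ∧ ¬ m.IsJump ¬μ) ↔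
      (if τ then PosBetween else NegBetween) t m b ∧
        t.mid = (if τ then b.left else m.left) ∧ m.mid = (if μ then m.right else m.left) ∧
        b.mid = (if β then b.left else b.right) := by
  rw [localRules_iff]
  by_cases hτ : τ <;> by_cases hμ : μ <;> by_cases hβ : β <;>
    simp only [hτ, hμ, hβ, Naked.Matches, EdgeColors.IsJump, EdgeColors.before, EdgeColors.after,
      PosBetween, NegBetween, not_true, not_false_eq_true, if_true, if_false] <;> grind

theorem localRules_isJump_mid_iff :
    (LocalRules τ μ β t m b ∧ t.IsJump ¬τ ∧ m.IsJump ¬μ ∧ ¬ t.IsJump τ ∧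
        ¬ (t.before (¬τ) = m.before (¬μ) ∧ t.after (¬τ) = m.after (¬μ))) ↔
      (if μ then PosBetween t m b ∨ PosAbove t m b else NegBetween t m b ∨ NegBelow t m b) ∧
        t.mid = (if τ then t.left else t.right) ∧ m.mid = (if μ then t.left else t.right) ∧
        b.mid = (if β then b.right else b.left) := by
  rw [localRules_iff]
  by_cases hτ : τ <;> by_cases hμ : μ <;> by_cases hβ : β <;>
    simp only [hτ, hμ, hβ, Naked.Matches, EdgeColors.IsJump, EdgeColors.before, EdgeColors.after,
      PosBetween, NegBetween, PosAbove, NegBelow, not_true, not_false_eq_true, if_true,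
      if_false] <;> grind

theorem localRules_isJump_bot_iff :
    (LocalRules τ μ β t m b ∧ t.IsJump τ ∧ m.IsJump ¬μ ∧ ¬ t.IsJump ¬τ) ↔
      (if β then PosAbove else NegBelow) t m b ∧
        t.mid = (if τ then t.right else t.left) ∧ m.mid = (if μ then m.left else m.right) ∧
        b.mid = (if β then m.left else t.left) := by
  rw [localRules_iff]
  by_cases hτ : τ <;> by_cases hμ : μ <;> by_cases hβ : β <;>
    simp only [hτ, hμ, hβ, Naked.Matches, EdgeColors.IsJump, EdgeColors.before, EdgeColors.after,
      PosAbove, NegBelow, not_true, not_false_eq_true, if_true, if_false] <;> grind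

theorem LocalRules.of_three_jumps (h : LocalRules τ μ β t m b) (ha : t.IsJump ¬τ)
    (hb : t.IsJump τ) (hd : m.IsJump ¬μ) :
    (t.before (¬τ) = m.before (¬μ) ∧ t.after (¬τ) = m.after (¬μ)) ∨
    ∃ v, LocalRules τ μ β (t.recolor v) (m.recolor v) (b.recolor v) ∧ ¬ (t.recolor v).IsJump τ := by
  rw [localRules_iff] at h
  simp only [localRules_iff]
  by_cases hτ : τ <;> by_cases hμ : μ <;> by_cases hβ : β <;>
    simp only [hτ, hμ, hβ, Naked.Matches, EdgeColors.IsJump, EdgeColors.before, EdgeColors.after,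
      EdgeColors.recolor, not_true, not_false_eq_true, if_true, if_false] at h ha hb hd ⊢ <;>
    first
    | (exfalso; grind)
    | (left; grind)
    | (right; refine ⟨t.left, ?_⟩; grind)
    | (right; refine ⟨t.right, ?_⟩; grind)

end LocalRules

/-! ### States of a diagram with a distinguished set of edges -/

section Patch

variable {N : ℕ} {E : Finset (Pt N)} {K : Type*} [LinearOrder K]

/-- The point `i` is an end of an edge in `E`. -/
def IsEnd (E : Finset (Pt N)) (i : Pt N) : Prop := i ∈ E ∨ i - 1 ∈ E

instance : DecidablePred (IsEnd E) := fun _ => instDecidableOr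

theorem swapPoint_of_not_isEnd {i : Pt N} (hi : ¬ IsEnd E i) : swapPoint E i = i := by
  rw [IsEnd, not_or] at hi
  exact swapPoint_of_notMem hi.1 hi.2

namespace Naked

variable {D : Naked N} {c c' : Pt N → K}

/-- The jumps at the arrows with tails at the edges in `E`. -/
def innerJumps (D : Naked N) (E : Finset (Pt N)) (c : Pt N → K) : Finset (Pt N) :=
  (D.jumps c).filter (IsEnd E)

/-- The jumps at the arrows with tails away from the edges in `E`. -/
def outerJumps (D : Naked N) (E : Finset (Pt N)) (c : Pt N → K) : Finset (Pt N) :=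
  (D.jumps c).filter fun t => ¬ IsEnd E t

theorem mem_innerJumps {t : Pt N} : t ∈ D.innerJumps E c ↔ t ∈ D.jumps c ∧ IsEnd E t :=
  Finset.mem_filter

theorem mem_outerJumps {t : Pt N} : t ∈ D.outerJumps E c ↔ t ∈ D.jumps c ∧ ¬ IsEnd E t :=
  Finset.mem_filter

theorem card_innerJumps_add_card_outerJumps (D : Naked N) (E : Finset (Pt N)) (c : Pt N → K) :
    (D.innerJumps E c).card + (D.outerJumps E c).card = (D.jumps c).card :=
  Finset.card_filter_add_card_filter_not _

theorem outerJumps_congr (h : ∀ e ∉ E, c e = c' e) : D.outerJumps E c = D.outerJumps E c' := by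
  ext t
  rw [mem_outerJumps, mem_outerJumps, mem_jumps, mem_jumps]
  refine and_congr_left fun ht => ?_
  rw [IsEnd, not_or] at ht
  rw [h _ ht.1, h _ ht.2]

end Naked

variable {π : Type*} [Group π]

theorem RigidGauss.weight_eq_mul (G : RigidGauss π N) (E : Finset (Pt N)) (c : Pt N → K) :
    G.weight c = (∏ t ∈ G.innerJumps E c, (G.writhe t : ℚ)) *
      ∏ t ∈ G.outerJumps E c, (G.writhe t : ℚ) :=
  (Finset.prod_filter_mul_prod_filter_not _ _ _).symm

/-- The edges in `E` are disjoint, decorated by `1`, and only joined to each other by arrows. -/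
structure IsPatch (E : Finset (Pt N)) (A : RigidArrow π N) : Prop where
  sparse : ∀ e ∈ E, e + 1 ∉ E
  mark_eq_one : ∀ e ∈ E, A.mark.at e = 1
  isEnd_partner : ∀ i, IsEnd E (A.partner i) ↔ IsEnd E i

/-- A coloring of the edges outside `E` that may become a state with two jumps at the edges in `E`
once these are colored. It is encoded as a coloring of all edges by giving each edge in `E` the
color of the preceding edge. -/
structure RigidArrow.IsOuter [Fintype K] (A : RigidArrow π N) (E : Finset (Pt N))
    (Γ : K → ConjClasses π) (c : Pt N → K) : Prop where
  eq_pred : ∀ e ∈ E, c e = c (e - 1)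
  rule : ∀ t, A.dir t = 1 → ¬ IsEnd E t → A.RuleAt c t
  card_jumps : (A.outerJumps E c).card + 3 = Fintype.card K
  colorProd : ∀ k, A.mark.colorProd c k = Γ k

open Classical in
/-- The sum of the weights of the colorings outside `E` with the property `P`. -/
noncomputable def RigidGauss.outerSum [Fintype K] (G : RigidGauss π N) (E : Finset (Pt N))
    (Γ : K → ConjClasses π) (P : (Pt N → K) → Prop) : ℚ :=
  ∑ c with G.IsOuter E Γ c ∧ P c, ∏ t ∈ G.outerJumps E c, (G.writhe t : ℚ)

theorem outerSum_or [Fintype K] (G : RigidGauss π N) (Γ : K → ConjClasses π)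
    {P Q : (Pt N → K) → Prop} (h : ∀ c, P c → ¬ Q c) :
    G.outerSum E Γ (fun c => P c ∨ Q c) = G.outerSum E Γ P + G.outerSum E Γ Q := by
  classical
  rw [RigidGauss.outerSum, RigidGauss.outerSum, RigidGauss.outerSum, ← Finset.sum_union]
  · simp only [and_or_left, Finset.filter_or]
  · exact Finset.disjoint_filter.2 fun c _ hP hQ => h c hP.2 hQ.2

namespace IsPatch

variable {A : RigidArrow π N} {c c' : Pt N → K}

theorem ruleAt_congr (h : IsPatch E A) (hcc : ∀ e ∉ E, c e = c' e) {t : Pt N}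
    (ht : ¬ IsEnd E t) : A.RuleAt c t ↔ A.RuleAt c' t := by
  have hhead := mt (h.isEnd_partner t).1 ht
  rw [IsEnd, not_or] at ht hhead
  rw [Naked.RuleAt, Naked.RuleAt, hcc _ ht.1, hcc _ ht.2, hcc _ hhead.1, hcc _ hhead.2]

omit [LinearOrder K] in
theorem colorProd_congr [DecidableEq K] (h : IsPatch E A) (hcc : ∀ e ∉ E, c e = c' e) (k : K) :
    A.mark.colorProd c k = A.mark.colorProd c' k := by
  obtain rfl | hN := eq_or_ne N 0
  · rw [funext fun e => hcc e fun he => h.sparse e he (by rwa [Subsingleton.elim (e + 1) e])]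
  · exact Marking.colorProd_congr hN _
      (fun e he => h.mark_eq_one e (by_contra fun heE => he (hcc e heE))) k

variable [Fintype K] {Γ : K → ConjClasses π}

theorem isOuter_of_isState (h : IsPatch E A) (hs : A.IsState Γ c)
    (hinner : (A.innerJumps E c).card = 2) (hcc : ∀ e ∉ E, c e = c' e)
    (hpred : ∀ e ∈ E, c' e = c' (e - 1)) : A.IsOuter E Γ c' where
  eq_pred := hpred
  rule t ht hE := (h.ruleAt_congr hcc hE).1 (hs.coloring t ht)
  card_jumps := by
    have hcard := A.card_innerJumps_add_card_outerJumps E c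
    have hjumps := hs.card_jumps
    rw [← Naked.outerJumps_congr hcc]
    omega
  colorProd k := (h.colorProd_congr hcc k).symm.trans (hs.colorProd k)

theorem isState_of_isOuter (h : IsPatch E A) (hs : A.IsOuter E Γ c')
    (hinner : (A.innerJumps E c).card = 2) (hcc : ∀ e ∉ E, c e = c' e)
    (hrule : ∀ t, A.dir t = 1 → IsEnd E t → A.RuleAt c t) : A.IsState Γ c where
  coloring t ht := by
    by_cases hE : IsEnd E t
    · exact hrule t ht hE
    · exact (h.ruleAt_congr hcc hE).2 (hs.rule t ht hE)
  card_jumps := by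
    have hcard := A.card_innerJumps_add_card_outerJumps E c
    have hjumps := hs.card_jumps
    rw [← Naked.outerJumps_congr hcc] at hjumps
    omega
  colorProd k := (h.colorProd_congr hcc k).trans (hs.colorProd k)

theorem sum_weight_eq {G : RigidGauss π N} (h : IsPatch E G.toRigidArrow) {J : Finset (Pt N)}
    (hJ : J.card = 2) {P : (Pt N → K) → Prop} {u : (Pt N → K) → Pt N → K}
    (hP : ∀ c c' : Pt N → K, (∀ e ∉ E, c e = c' e) → (P c ↔ P c'))
    (hu : ∀ c c' : Pt N → K, (∀ e ∉ E, c e = c' e) → u c = u c')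
    (hto : ∀ c, G.IsState Γ c → G.innerJumps E c = J → P c ∧ ∀ e ∈ E, c e = u c e)
    (hfrom : ∀ c, P c → (∀ e ∈ E, c e = u c e) →
      G.innerJumps E c = J ∧ ∀ t, G.dir t = 1 → IsEnd E t → G.RuleAt c t) :
    ∑ c ∈ G.states Γ with G.innerJumps E c = J, G.weight c =
      (∏ t ∈ J, (G.writhe t : ℚ)) * G.outerSum E Γ P := by
  classical
  have hflat : ∀ c : Pt N → K, ∀ e ∉ E, E.piecewise (fun e => c (e - 1)) c e = c e :=
    fun c e he => Finset.piecewise_eq_of_notMem _ _ _ he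
  have hfill : ∀ c : Pt N → K, ∀ e ∉ E, E.piecewise (u c) c e = c e :=
    fun c e he => Finset.piecewise_eq_of_notMem _ _ _ he
  rw [RigidGauss.outerSum, Finset.mul_sum]
  refine Finset.sum_bij' (fun c _ => E.piecewise (fun e => c (e - 1)) c)
    (fun c _ => E.piecewise (u c) c) (fun c hc => ?_) (fun c hc => ?_) (fun c hc => ?_)
    (fun c hc => ?_) fun c hc => ?_
  · obtain ⟨hs, hinner⟩ := Finset.mem_filter.1 hc
    rw [RigidArrow.mem_states] at hs
    refine Finset.mem_filter.2 ⟨Finset.mem_univ _,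
      h.isOuter_of_isState hs (hinner ▸ hJ) (fun e he => (hflat c e he).symm) fun e he => ?_,
      (hP _ _ (hflat c)).2 (hto c hs hinner).1⟩
    rw [Finset.piecewise_eq_of_mem _ _ _ he, hflat c _ (sub_one_notMem h.sparse he)]
  · obtain ⟨-, hs, hPc⟩ := Finset.mem_filter.1 hc
    obtain ⟨hinner, hrule⟩ := hfrom _ ((hP _ _ (hfill c)).2 hPc) fun e he => by
      rw [Finset.piecewise_eq_of_mem _ _ _ he, hu _ _ (hfill c)]
    exact Finset.mem_filter.2 ⟨RigidArrow.mem_states.2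
      (h.isState_of_isOuter hs (hinner ▸ hJ) (hfill c) hrule), hinner⟩
  · obtain ⟨hs, hinner⟩ := Finset.mem_filter.1 hc
    have hfill' := (hto c (RigidArrow.mem_states.1 hs) hinner).2
    funext e
    by_cases he : e ∈ E
    · rw [Finset.piecewise_eq_of_mem _ _ _ he, hu _ _ (hflat c), hfill' e he]
    · rw [hfill _ e he, hflat c e he]
  · obtain ⟨-, hs, -⟩ := Finset.mem_filter.1 hc
    funext e
    by_cases he : e ∈ E
    · rw [Finset.piecewise_eq_of_mem _ _ _ he, hfill c _ (sub_one_notMem h.sparse he),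
        hs.eq_pred e he]
    · rw [hflat _ e he, hfill c e he]
  · rw [G.weight_eq_mul E, (Finset.mem_filter.1 hc).2, Naked.outerJumps_congr (hflat c)]

end IsPatch

namespace IsSwap

theorem outerJumps_eq {A A' : RigidArrow π N} (h : IsSwap E A A') (c : Pt N → K) :
    A'.outerJumps E c = A.outerJumps E c := by
  ext t
  rw [Naked.mem_outerJumps, Naked.mem_outerJumps, Naked.mem_jumps, Naked.mem_jumps]
  refine and_congr_left fun ht => ?_
  rw [← h.dir t, swapPoint_of_not_isEnd ht]

variable [Fintype K] {Γ : K → ConjClasses π}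

theorem isOuter_iff {A A' : RigidArrow π N} (h : IsSwap E A A') (hA : IsPatch E A)
    (c : Pt N → K) : A'.IsOuter E Γ c ↔ A.IsOuter E Γ c := by
  have hrule : ∀ t, ¬ IsEnd E t → ((A'.dir t = 1 → A'.RuleAt c t) ↔
      (A.dir t = 1 → A.RuleAt c t)) := fun t ht => by
    have hpartner := h.partner t
    rw [swapPoint_of_not_isEnd ht, swapPoint_of_not_isEnd (mt (hA.isEnd_partner t).1 ht)]
      at hpartner
    rw [Naked.RuleAt, Naked.RuleAt, hpartner, ← h.dir t, swapPoint_of_not_isEnd ht]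
  constructor <;> intro hs
  · exact ⟨hs.eq_pred, fun t ht hE => (hrule t hE).1 (fun ht => hs.rule t ht hE) ht,
      h.outerJumps_eq c ▸ hs.card_jumps, h.mark ▸ hs.colorProd⟩
  · exact ⟨hs.eq_pred, fun t ht hE => (hrule t hE).2 (fun ht => hs.rule t ht hE) ht,
      h.outerJumps_eq c ▸ hs.card_jumps, h.mark ▸ hs.colorProd⟩

variable {G G' : RigidGauss π N}

theorem outerSum_eq (h : IsSwap E G.toRigidArrow G'.toRigidArrow)
    (hG : IsPatch E G.toRigidArrow) (hw : ∀ i, G'.writhe (swapPoint E i) = G.writhe i)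
    (P : (Pt N → K) → Prop) : G'.outerSum E Γ P = G.outerSum E Γ P := by
  classical
  rw [RigidGauss.outerSum, RigidGauss.outerSum]
  refine Finset.sum_congr ?_ fun c _ => Finset.prod_congr (h.outerJumps_eq c) fun t ht => ?_
  · ext c
    rw [Finset.mem_filter, Finset.mem_filter, h.isOuter_iff hG]
  · rw [← hw t, swapPoint_of_not_isEnd (Naked.mem_outerJumps.1 ht).2]

open Classical in
theorem sum_isTame_eq (h : IsSwap E G.toRigidArrow G'.toRigidArrow) (hN : N ≠ 0)
    (hw : ∀ i, G'.writhe (swapPoint E i) = G.writhe i) :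
    ∑ c ∈ G'.states Γ with IsTame E c, G'.weight c =
      ∑ c ∈ G.states Γ with IsTame E c, G.weight c := by
  refine (Finset.sum_bij' (fun c _ => flipColor E c) (fun c _ => flipColor E c)
    (fun c hc => ?_) (fun c hc => ?_) (fun c hc => ?_) (fun c hc => ?_) fun c hc => ?_).symm
  · obtain ⟨hs, hc⟩ := Finset.mem_filter.1 hc
    exact Finset.mem_filter.2 ⟨RigidArrow.mem_states.2
      (h.isState_flipColor hc hN (RigidArrow.mem_states.1 hs)), isTame_flipColor h.sparse⟩
  · obtain ⟨hs, hc⟩ := Finset.mem_filter.1 hc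
    exact Finset.mem_filter.2 ⟨RigidArrow.mem_states.2
      (h.symm.isState_flipColor hc hN (RigidArrow.mem_states.1 hs)), isTame_flipColor h.sparse⟩
  · exact flipColor_flipColor h.sparse (Finset.mem_filter.1 hc).2
  · exact flipColor_flipColor h.sparse (Finset.mem_filter.1 hc).2
  · rw [h.weight_flipColor (Finset.mem_filter.1 hc).2, RigidGauss.weight]
    simp only [hw]

end IsSwap

end Patch

/-! ### Triangles -/

section Around

variable {N : ℕ} {K : Type*}

/-- The colors around the edge `e`. -/
def around (c : Pt N → K) (e : Pt N) : EdgeColors K := ⟨c (e - 1), c e, c (e + 1)⟩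

theorem around_eq_recolor {E : Finset (Pt N)} (hE : ∀ e ∈ E, e + 1 ∉ E) {c c' : Pt N → K}
    (hcc : ∀ e ∉ E, c e = c' e) {e : Pt N} (he : e ∈ E) :
    around c e = (around c' e).recolor (c e) := by
  rw [around, hcc _ (hE e he), hcc _ (sub_one_notMem hE he)]
  rfl

theorem around_piecewise {E : Finset (Pt N)} (hE : ∀ e ∈ E, e + 1 ∉ E) (f c : Pt N → K)
    {e : Pt N} (he : e ∈ E) : around (E.piecewise f c) e = (around c e).recolor (f e) := by
  rw [around_eq_recolor hE (c := E.piecewise f c) (c' := c)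
    (fun e he => Finset.piecewise_eq_of_notMem _ _ _ he) he, Finset.piecewise_eq_of_mem _ _ _ he]

namespace EdgeEnds

variable {e x y : Pt N}

theorem right_eq_iff (h : EdgeEnds e x y) (hN : N ≠ 0) : y = e ↔ ¬ x = e := by
  have hne := add_one_ne hN e
  rcases h with ⟨rfl, rfl⟩ | ⟨rfl, rfl⟩
  · exact iff_of_false hne (not_not.2 rfl)
  · exact iff_of_true rfl hne

theorem eq_or_pred_eq_iff (h : EdgeEnds e x y) {i : Pt N} :
    (e = i ∨ e = i - 1) ↔ (i = x ∨ i = y) := by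
  rw [eq_comm, eq_sub_iff_add_eq, @eq_comm _ (e + 1)]
  rcases h with ⟨rfl, rfl⟩ | ⟨rfl, rfl⟩
  exacts [Iff.rfl, or_comm]

theorem ne_of_sparse {E : Finset (Pt N)} {f z w : Pt N} (h : EdgeEnds e x y)
    (h' : EdgeEnds f z w) (hE : ∀ e ∈ E, e + 1 ∉ E) (he : e ∈ E) (hf : f ∈ E) (hef : e ≠ f) :
    x ≠ z := by
  rintro rfl
  rcases h.left_eq with rfl | rfl <;> rcases h'.left_eq with hx | hx
  · exact hef hx
  · exact hE f hf (hx ▸ he)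
  · exact hE e he (hx ▸ hf)
  · exact hef (add_right_cancel hx)

theorem before_left (h : EdgeEnds e x y) (c : Pt N → K) :
    (around c e).before (x = e) = c (x - 1) := by
  rcases h.left_eq with rfl | rfl
  · exact if_pos rfl
  · rw [EdgeColors.before, add_sub_cancel_right]
    split_ifs with hx
    · rw [around, ← hx, add_sub_cancel_right, hx]
    · rfl

theorem after_left (h : EdgeEnds e x y) (c : Pt N → K) :
    (around c e).after (x = e) = c x := by
  rw [EdgeColors.after]
  split_ifs with hx
  · exact hx ▸ rfl
  · rw [h.left_eq.resolve_left hx]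
    rfl

theorem before_right (h : EdgeEnds e x y) (hN : N ≠ 0) (c : Pt N → K) :
    (around c e).before (¬ x = e) = c (y - 1) := by
  simp only [← h.right_eq_iff hN, h.symm.before_left]

theorem after_right (h : EdgeEnds e x y) (hN : N ≠ 0) (c : Pt N → K) :
    (around c e).after (¬ x = e) = c y := by
  simp only [← h.right_eq_iff hN, h.symm.after_left]

end EdgeEnds

end Around

section Triangle

variable {N : ℕ} {π : Type*} [Group π]

/-- The disjoint edges `p`, `q` and `r` are decorated by `1` and form a triangle: the arrow with
tail `a` leads from `p` to `q`, the arrow with tail `b` from `p` to `r`, and the arrow with tail `d`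
from `q` to `r`. -/
structure Triangle (A : RigidArrow π N) (p q r a b d : Pt N) : Prop where
  dir_a : A.dir a = 1
  dir_b : A.dir b = 1
  dir_d : A.dir d = 1
  sparse : ∀ e ∈ ({p, q, r} : Finset (Pt N)), e + 1 ∉ ({p, q, r} : Finset (Pt N))
  p_ne_q : p ≠ q
  p_ne_r : p ≠ r
  q_ne_r : q ≠ r
  mark_eq_one : ∀ e ∈ ({p, q, r} : Finset (Pt N)), A.mark.at e = 1
  top : EdgeEnds p b a
  mid : EdgeEnds q (A.partner a) d
  bot : EdgeEnds r (A.partner d) (A.partner b)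

namespace Triangle

variable {A : RigidArrow π N} {p q r a b d : Pt N} (h : Triangle A p q r a b d)

include h

theorem size_ne_zero : N ≠ 0 := Naked.ne_zero_of_tail h.dir_a

theorem isEnd_iff {i : Pt N} : IsEnd {p, q, r} i ↔
    (i = b ∨ i = a) ∨ (i = A.partner a ∨ i = d) ∨ (i = A.partner d ∨ i = A.partner b) := by
  rw [← h.top.eq_or_pred_eq_iff, ← h.mid.eq_or_pred_eq_iff, ← h.bot.eq_or_pred_eq_iff, IsEnd]
  simp only [Finset.mem_insert, Finset.mem_singleton]
  tauto

theorem isPatch : IsPatch {p, q, r} A where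
  sparse := h.sparse
  mark_eq_one := h.mark_eq_one
  isEnd_partner i := by
    simp only [h.isEnd_iff, A.partner_eq_comm, A.partner_partner]
    tauto

theorem isEnd_tail_iff {t : Pt N} (ht : A.dir t = 1) :
    IsEnd {p, q, r} t ↔ t = a ∨ t = b ∨ t = d := by
  have hhead : ∀ {s}, A.dir s = 1 → t ≠ A.partner s := fun hs => (A.partner_ne_tail hs ht).symm
  simp only [h.isEnd_iff, hhead h.dir_a, hhead h.dir_b, hhead h.dir_d, or_false, false_or]
  tauto

theorem a_ne_b : a ≠ b := by
  rintro rfl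
  exact iff_not_self (h.top.right_eq_iff h.size_ne_zero)

theorem a_ne_d : a ≠ d := by
  refine h.top.symm.ne_of_sparse h.mid.symm h.sparse ?_ ?_ h.p_ne_q <;>
    simp only [Finset.mem_insert, true_or, or_true]

theorem b_ne_d : b ≠ d := by
  refine h.top.ne_of_sparse h.mid.symm h.sparse ?_ ?_ h.p_ne_q <;>
    simp only [Finset.mem_insert, true_or, or_true]

variable {K : Type*} (c : Pt N → K)

theorem localRules_iff [LinearOrder K] :
    LocalRules (b = p) (A.partner a = q) (A.partner d = r) (around c p) (around c q) (around c r) ↔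
      A.RuleAt c a ∧ A.RuleAt c b ∧ A.RuleAt c d := by
  have hN := h.size_ne_zero
  rw [GaussKnot.localRules_iff, h.top.before_left, h.top.after_left, h.top.before_right hN,
    h.top.after_right hN, h.mid.before_left, h.mid.after_left, h.mid.before_right hN,
    h.mid.after_right hN, h.bot.before_left, h.bot.after_left, h.bot.before_right hN,
    h.bot.after_right hN]
  rfl

omit c in
theorem around_eq_recolor {c c' : Pt N → K}
    (hcc : ∀ e ∉ ({p, q, r} : Finset (Pt N)), c e = c' e) :
    around c p = (around c' p).recolor (c p) ∧ around c q = (around c' q).recolor (c q) ∧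
      around c r = (around c' r).recolor (c r) := by
  have haround := fun e => GaussKnot.around_eq_recolor h.sparse hcc (e := e)
  simp only [Finset.mem_insert, Finset.mem_singleton, forall_eq_or_imp, forall_eq] at haround
  exact haround

theorem ruleAt_of_localRules [LinearOrder K] (hrules : LocalRules (b = p) (A.partner a = q)
    (A.partner d = r) (around c p) (around c q) (around c r)) {t : Pt N} (ht : A.dir t = 1)
    (hE : IsEnd {p, q, r} t) : A.RuleAt c t := by
  obtain ⟨ha, hb, hd⟩ := (h.localRules_iff c).1 hrules
  obtain rfl | rfl | rfl := (h.isEnd_tail_iff ht).1 hE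
  exacts [ha, hb, hd]

theorem localRules_of_isColoring [LinearOrder K] (hc : A.IsColoring c) :
    LocalRules (b = p) (A.partner a = q) (A.partner d = r) (around c p) (around c q) (around c r) :=
  (h.localRules_iff c).2 ⟨hc a h.dir_a, hc b h.dir_b, hc d h.dir_d⟩

theorem isJump_a_iff : (around c p).IsJump (¬ b = p) ↔ c (a - 1) ≠ c a := by
  rw [EdgeColors.IsJump, h.top.before_right h.size_ne_zero, h.top.after_right h.size_ne_zero]

theorem isJump_b_iff : (around c p).IsJump (b = p) ↔ c (b - 1) ≠ c b := by
  rw [EdgeColors.IsJump, h.top.before_left, h.top.after_left]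

theorem isJump_d_iff : (around c q).IsJump (¬ A.partner a = q) ↔ c (d - 1) ≠ c d := by
  rw [EdgeColors.IsJump, h.mid.before_right h.size_ne_zero, h.mid.after_right h.size_ne_zero]

theorem mem_innerJumps_iff [LinearOrder K] {t : Pt N} : t ∈ A.innerJumps {p, q, r} c ↔
    (t = a ∨ t = b ∨ t = d) ∧ c (t - 1) ≠ c t := by
  rw [Naked.mem_innerJumps, Naked.mem_jumps]
  constructor
  · exact fun ht => ⟨(h.isEnd_tail_iff ht.1.1).1 ht.2, ht.1.2⟩
  · intro ht
    have hdir : A.dir t = 1 := by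
      obtain ⟨rfl | rfl | rfl, -⟩ := ht
      exacts [h.dir_a, h.dir_b, h.dir_d]
    exact ⟨⟨hdir, ht.2⟩, (h.isEnd_tail_iff hdir).2 ht.1⟩

theorem innerJumps_eq_ab_iff [LinearOrder K] : A.innerJumps {p, q, r} c = {a, b} ↔
    c (a - 1) ≠ c a ∧ c (b - 1) ≠ c b ∧ ¬ c (d - 1) ≠ c d := by
  simp only [Finset.ext_iff, h.mem_innerJumps_iff, Finset.mem_insert, Finset.mem_singleton]
  grind [h.a_ne_d, h.b_ne_d]

theorem innerJumps_eq_ad_iff [LinearOrder K] : A.innerJumps {p, q, r} c = {a, d} ↔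
    c (a - 1) ≠ c a ∧ c (d - 1) ≠ c d ∧ ¬ c (b - 1) ≠ c b := by
  simp only [Finset.ext_iff, h.mem_innerJumps_iff, Finset.mem_insert, Finset.mem_singleton]
  grind [h.a_ne_b, h.b_ne_d]

theorem innerJumps_eq_bd_iff [LinearOrder K] : A.innerJumps {p, q, r} c = {b, d} ↔
    c (b - 1) ≠ c b ∧ c (d - 1) ≠ c d ∧ ¬ c (a - 1) ≠ c a := by
  simp only [Finset.ext_iff, h.mem_innerJumps_iff, Finset.mem_insert, Finset.mem_singleton]
  grind [h.a_ne_b, h.a_ne_d]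

variable {c} [LinearOrder K] [Fintype K] {Γ : K → ConjClasses π}

theorem jump_b_of_recolor (hΓ : ∀ k, Γ k ≠ ConjClasses.mk 1) (hs : A.IsState Γ c)
    {c' : Pt N → K} (hcc : ∀ e ∉ ({p, q, r} : Finset (Pt N)), c e = c' e)
    (hrules : LocalRules (b = p) (A.partner a = q) (A.partner d = r) (around c' p) (around c' q)
      (around c' r))
    (hinner : A.innerJumps {p, q, r} c = {a, b, d}) : (around c' p).IsJump (b = p) := by
  by_contra hb
  rw [h.isJump_b_iff, not_not] at hb
  have hsurj : Function.Surjective c' := Marking.surjective_of_colorProd_ne fun k => by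
    rw [← h.isPatch.colorProd_congr hcc, hs.colorProd]
    exact hΓ k
  have hcol : A.IsColoring c' := fun t ht => by
    by_cases hE : IsEnd {p, q, r} t
    · exact h.ruleAt_of_localRules c' hrules ht hE
    · exact (h.isPatch.ruleAt_congr hcc hE).1 (hs.coloring t ht)
  have hsub : A.innerJumps {p, q, r} c' ⊆ {a, d} := fun t ht => by
    obtain ⟨rfl | rfl | rfl, hjump⟩ := (h.mem_innerJumps_iff c').1 ht
    exacts [Finset.mem_insert_self _ _, absurd hb hjump,
      Finset.mem_insert_of_mem (Finset.mem_singleton_self _)]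
  have hle := hcol.card_le_card_jumps_add_one hsurj
  have htwo := (Finset.card_le_card hsub).trans Finset.card_le_two
  have hthree := Finset.card_eq_three.2 ⟨a, b, d, h.a_ne_b, h.a_ne_d, h.b_ne_d, hinner⟩
  have hcard := A.card_innerJumps_add_card_outerJumps {p, q, r} c
  have hcard' := A.card_innerJumps_add_card_outerJumps {p, q, r} c'
  have hjumps := hs.card_jumps
  rw [Naked.outerJumps_congr hcc] at hcard
  omega

theorem colors_a_ne_colors_d (hΓ : ∀ k, Γ k ≠ ConjClasses.mk 1) (hs : A.IsState Γ c)
    (hja : c (a - 1) ≠ c a) (hjd : c (d - 1) ≠ c d) :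
    ¬ ((around c p).before (¬ b = p) = (around c q).before (¬ A.partner a = q) ∧
      (around c p).after (¬ b = p) = (around c q).after (¬ A.partner a = q)) := by
  rw [h.top.before_right h.size_ne_zero, h.mid.before_right h.size_ne_zero,
    h.top.after_right h.size_ne_zero, h.mid.after_right h.size_ne_zero]
  exact fun hcolors => h.a_ne_d ((hs.isTreeColoring hΓ).jump_injective
    (Naked.mem_jumps.2 ⟨h.dir_a, hja⟩) (Naked.mem_jumps.2 ⟨h.dir_d, hjd⟩) hcolors.1 hcolors.2)

/-- With three jumps, either two of them would separate the same colors, or one of them could be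
avoided by recoloring the three edges, which leaves too few jumps for a surjective coloring. -/
theorem pred_d_eq_of_jumps (hΓ : ∀ k, Γ k ≠ ConjClasses.mk 1) (hs : A.IsState Γ c)
    (hja : c (a - 1) ≠ c a) (hjb : c (b - 1) ≠ c b) : c (d - 1) = c d := by
  by_contra hjd
  have hinner : A.innerJumps {p, q, r} c = {a, b, d} := by
    ext t
    rw [h.mem_innerJumps_iff]
    simp only [Finset.mem_insert, Finset.mem_singleton]
    refine and_iff_left_of_imp ?_
    rintro (rfl | rfl | rfl)
    exacts [hja, hjb, hjd]
  obtain hcolors | ⟨v, hrules, hb⟩ :=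
    (h.localRules_of_isColoring c hs.coloring).of_three_jumps ((h.isJump_a_iff c).2 hja)
      ((h.isJump_b_iff c).2 hjb) ((h.isJump_d_iff c).2 hjd)
  · exact h.colors_a_ne_colors_d hΓ hs hja hjd hcolors
  · have haround := fun e => around_piecewise h.sparse (fun _ => v) c (e := e)
    simp only [Finset.mem_insert, Finset.mem_singleton, forall_eq_or_imp, forall_eq] at haround
    rw [← haround.1, ← haround.2.1, ← haround.2.2] at hrules
    rw [← haround.1] at hb
    exact hb (h.jump_b_of_recolor hΓ hs
      (fun e he => (Finset.piecewise_eq_of_notMem _ _ _ he).symm) hrules hinner)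

end Triangle

/-- The sum of the weights of the colorings outside the edges `p`, `q` and `r` such that the colors
around these edges have the property `R`. -/
noncomputable def RigidGauss.triangleSum {K : Type*} [LinearOrder K] [Fintype K]
    (G : RigidGauss π N) (p q r : Pt N) (Γ : K → ConjClasses π)
    (R : EdgeColors K → EdgeColors K → EdgeColors K → Prop) : ℚ :=
  G.outerSum {p, q, r} Γ fun c => R (around c p) (around c q) (around c r)

namespace Triangle

variable {G : RigidGauss π N} {p q r a b d : Pt N} (h : Triangle G.toRigidArrow p q r a b d)
  {K : Type*} [LinearOrder K] [Fintype K] {Γ : K → ConjClasses π}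

include h

theorem sum_weight_eq {x y : Pt N} (hxy : x ≠ y)
    {R : EdgeColors K → EdgeColors K → EdgeColors K → Prop}
    {fill : EdgeColors K → EdgeColors K → EdgeColors K → K × K × K}
    (hR : ∀ t m b i j k, R (t.recolor i) (m.recolor j) (b.recolor k) ↔ R t m b)
    (hfill : ∀ t m b i j k, fill (t.recolor i) (m.recolor j) (b.recolor k) = fill t m b)
    (hto : ∀ c, G.IsState Γ c → G.innerJumps {p, q, r} c = {x, y} →
      R (around c p) (around c q) (around c r) ∧
        (c p, c q, c r) = fill (around c p) (around c q) (around c r))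
    (hfrom : ∀ c, R (around c p) (around c q) (around c r) →
      (c p, c q, c r) = fill (around c p) (around c q) (around c r) →
      G.innerJumps {p, q, r} c = {x, y} ∧ LocalRules (b = p) (G.partner a = q) (G.partner d = r)
        (around c p) (around c q) (around c r)) :
    ∑ c ∈ G.states Γ with G.innerJumps {p, q, r} c = {x, y}, G.weight c =
      G.writhe x * G.writhe y * G.triangleSum p q r Γ R := by
  have hedges : ∀ (c : Pt N → K) (z : K × K × K), (∀ e ∈ ({p, q, r} : Finset (Pt N)),
      c e = if e = p then z.1 else if e = q then z.2.1 else z.2.2) ↔ (c p, c q, c r) = z :=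
    fun c z => by
      simp only [Finset.mem_insert, Finset.mem_singleton, forall_eq_or_imp, forall_eq, if_true,
        if_neg h.p_ne_q.symm, if_neg h.p_ne_r.symm, if_neg h.q_ne_r.symm, Prod.ext_iff]
  rw [← Finset.prod_pair (f := fun t => (G.writhe t : ℚ)) hxy, RigidGauss.triangleSum]
  refine h.isPatch.sum_weight_eq (Finset.card_pair hxy)
    (u := fun c e => if e = p then (fill (around c p) (around c q) (around c r)).1 else
      if e = q then (fill (around c p) (around c q) (around c r)).2.1 else
        (fill (around c p) (around c q) (around c r)).2.2)
    (fun c c' hcc => ?_) (fun c c' hcc => ?_) (fun c hs hinner => ?_) fun c hRc hc => ?_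
  · obtain ⟨hp, hq, hr⟩ := h.around_eq_recolor hcc
    rw [hp, hq, hr, hR]
  · obtain ⟨hp, hq, hr⟩ := h.around_eq_recolor hcc
    rw [hp, hq, hr, hfill]
  · rw [hedges]
    exact hto c hs hinner
  · obtain ⟨hinner, hrules⟩ := hfrom c hRc ((hedges _ _).1 hc)
    exact ⟨hinner, fun t => h.ruleAt_of_localRules c hrules⟩

theorem sum_top_eq (Γ : K → ConjClasses π) :
    ∑ c ∈ G.states Γ with G.innerJumps {p, q, r} c = {a, b}, G.weight c =
      G.writhe a * G.writhe b *
        G.triangleSum p q r Γ (if b = p then PosBetween else NegBetween) := by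
  refine h.sum_weight_eq h.a_ne_b
    (fill := fun _ m z => (if b = p then z.left else m.left,
      if G.partner a = q then m.right else m.left, if G.partner d = r then z.left else z.right))
    (fun _ _ _ _ _ _ => ?_) (fun _ _ _ _ _ _ => rfl) (fun c hs hinner => ?_) fun c hR hc => ?_
  · split_ifs <;> rfl
  · rw [h.innerJumps_eq_ab_iff, ← h.isJump_a_iff, ← h.isJump_b_iff, ← h.isJump_d_iff] at hinner
    have hcolors := localRules_isJump_top_iff.1
      ⟨h.localRules_of_isColoring c hs.coloring, hinner⟩
    rw [Prod.mk.injEq, Prod.mk.injEq]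
    exact hcolors
  · rw [Prod.mk.injEq, Prod.mk.injEq] at hc
    obtain ⟨hrules, hjumps⟩ := localRules_isJump_top_iff.2 ⟨hR, hc⟩
    rw [h.innerJumps_eq_ab_iff, ← h.isJump_a_iff, ← h.isJump_b_iff, ← h.isJump_d_iff]
    exact ⟨hjumps, hrules⟩

theorem sum_mid_eq (hΓ : ∀ k, Γ k ≠ ConjClasses.mk 1) :
    ∑ c ∈ G.states Γ with G.innerJumps {p, q, r} c = {a, d}, G.weight c =
      G.writhe a * G.writhe d * if G.partner a = q
        then G.triangleSum p q r Γ PosBetween + G.triangleSum p q r Γ PosAbove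
        else G.triangleSum p q r Γ NegBetween + G.triangleSum p q r Γ NegBelow := by
  have hsum : ∑ c ∈ G.states Γ with G.innerJumps {p, q, r} c = {a, d}, G.weight c =
      G.writhe a * G.writhe d * G.triangleSum p q r Γ fun t m z => if G.partner a = q
        then PosBetween t m z ∨ PosAbove t m z else NegBetween t m z ∨ NegBelow t m z := by
    refine h.sum_weight_eq h.a_ne_d
      (fill := fun t _ z => (if b = p then t.left else t.right,
        if G.partner a = q then t.left else t.right, if G.partner d = r then z.right else z.left))
      (fun _ _ _ _ _ _ => ?_) (fun _ _ _ _ _ _ => rfl) (fun c hs hinner => ?_) fun c hR hc => ?_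
    · split_ifs <;> rfl
    · obtain ⟨hja, hjd, hjb⟩ := (h.innerJumps_eq_ad_iff c).1 hinner
      have hcolors := localRules_isJump_mid_iff.1
        ⟨h.localRules_of_isColoring c hs.coloring, (h.isJump_a_iff c).2 hja,
          (h.isJump_d_iff c).2 hjd, mt (h.isJump_b_iff c).1 hjb,
          h.colors_a_ne_colors_d hΓ hs hja hjd⟩
      rw [Prod.mk.injEq, Prod.mk.injEq]
      exact hcolors
    · rw [Prod.mk.injEq, Prod.mk.injEq] at hc
      obtain ⟨hrules, hja, hjd, hjb, -⟩ := localRules_isJump_mid_iff.2 ⟨hR, hc⟩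
      rw [h.innerJumps_eq_ad_iff, ← h.isJump_a_iff, ← h.isJump_b_iff, ← h.isJump_d_iff]
      exact ⟨⟨hja, hjd, hjb⟩, hrules⟩
  rw [hsum]
  congr 1
  split_ifs
  · exact outerSum_or G Γ fun c hbetween habove => lt_asymm hbetween.2.2 habove.2.2
  · exact outerSum_or G Γ fun c hbetween hbelow => lt_asymm hbetween.2.1 hbelow.2.1

theorem sum_bot_eq (Γ : K → ConjClasses π) :
    ∑ c ∈ G.states Γ with G.innerJumps {p, q, r} c = {b, d}, G.weight c =
      G.writhe b * G.writhe d *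
        G.triangleSum p q r Γ (if G.partner d = r then PosAbove else NegBelow) := by
  refine h.sum_weight_eq h.b_ne_d
    (fill := fun t m _ => (if b = p then t.right else t.left,
      if G.partner a = q then m.left else m.right, if G.partner d = r then m.left else t.left))
    (fun _ _ _ _ _ _ => ?_) (fun _ _ _ _ _ _ => rfl) (fun c hs hinner => ?_) fun c hR hc => ?_
  · split_ifs <;> rfl
  · rw [h.innerJumps_eq_bd_iff, ← h.isJump_a_iff, ← h.isJump_b_iff, ← h.isJump_d_iff] at hinner
    have hcolors := localRules_isJump_bot_iff.1
      ⟨h.localRules_of_isColoring c hs.coloring, hinner⟩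
    rw [Prod.mk.injEq, Prod.mk.injEq]
    exact hcolors
  · rw [Prod.mk.injEq, Prod.mk.injEq] at hc
    obtain ⟨hrules, hjumps⟩ := localRules_isJump_bot_iff.2 ⟨hR, hc⟩
    rw [h.innerJumps_eq_bd_iff, ← h.isJump_a_iff, ← h.isJump_b_iff, ← h.isJump_d_iff]
    exact ⟨hjumps, hrules⟩

omit [Fintype K] in
theorem isTame_iff {c : Pt N → K} (hc : G.IsColoring c) : IsTame {p, q, r} c ↔
    (c (b - 1) = c b ∨ c (a - 1) = c a) ∧ (c (a - 1) = c a ∨ c (d - 1) = c d) ∧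
      (c (d - 1) = c d ∨ c (b - 1) = c b) := by
  simp only [IsTame, Finset.mem_insert, Finset.mem_singleton, forall_eq_or_imp, forall_eq]
  rw [h.top.pred_eq_or_eq_iff, h.mid.pred_eq_or_eq_iff, h.bot.pred_eq_or_eq_iff,
    ← hc.pred_eq_iff a, ← hc.pred_eq_iff d, ← hc.pred_eq_iff b]

open Classical in
theorem stateSum_eq (hΓ : ∀ k, Γ k ≠ ConjClasses.mk 1) :
    G.stateSum Γ = (∑ c ∈ G.states Γ with IsTame {p, q, r} c, G.weight c) +
      (∑ c ∈ G.states Γ with G.innerJumps {p, q, r} c = {a, b}, G.weight c) +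
      (∑ c ∈ G.states Γ with G.innerJumps {p, q, r} c = {a, d}, G.weight c) +
      ∑ c ∈ G.states Γ with G.innerJumps {p, q, r} c = {b, d}, G.weight c := by
  simp only [RigidGauss.stateSum, Finset.sum_filter, ← Finset.sum_add_distrib]
  refine Finset.sum_congr rfl fun c hc => ?_
  have hs := RigidArrow.mem_states.1 hc
  have hthree := h.pred_d_eq_of_jumps hΓ hs
  simp only [h.innerJumps_eq_ab_iff, h.innerJumps_eq_ad_iff, h.innerJumps_eq_bd_iff,
    h.isTame_iff hs.coloring]
  by_cases hja : c (a - 1) = c a <;> by_cases hjb : c (b - 1) = c b <;>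
    by_cases hjd : c (d - 1) = c d <;> simp_all

end Triangle

end Triangle

/-! ### The third Reidemeister move -/

section CyclicOrder

variable {N : ℕ}

theorem Naked.cross_add_one_iff (D : Naked N) (hN : N ≠ 0) {e : Pt N}
    (he : D.partner e ≠ e + 1) :
    D.Cross e (e + 1) ↔ D.partner e - e < D.partner (e + 1) - e := by
  have hself : D.OnArc e (e + 1) := by
    rw [← D.onArc_pred (add_one_ne hN e) he.symm, add_sub_cancel_right]
    exact D.onArc_self (D.dir_ne_zero hN e)
  have hne : D.partner e - e ≠ D.partner (e + 1) - e := fun h =>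
    add_one_ne hN e (D.partner_injective (sub_left_injective h)).symm
  rw [Naked.Cross, iff_true_left hself, Naked.OnArc, not_lt]
  exact ⟨fun h => lt_of_le_of_ne h.2.2 hne, fun h => ⟨add_one_ne hN e, he.symm, h.le⟩⟩

theorem val_add_one_sub {e f : Pt N} (hne : f + 1 ≠ e) :
    (f + 1 - e).val = (f - e).val + 1 := by
  have hpred := fin_val_pred (f + 1 - e)
  rw [if_neg (sub_ne_zero.2 hne), sub_right_comm, add_sub_cancel_right] at hpred
  have hpos : (f + 1 - e).val ≠ 0 := fun h => sub_ne_zero.2 hne (Fin.ext h)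
  omega

theorem sub_lt_sub_iff_of_ends {E : Finset (Pt N)} (hE : ∀ e ∈ E, e + 1 ∉ E) {e f g x y : Pt N}
    (he : e ∈ E) (hf : f ∈ E) (hg : g ∈ E) (hfg : f ≠ g) (hx : x = f ∨ x = f + 1)
    (hy : y = g ∨ y = g + 1) : x - e < y - e ↔ f - e < g - e := by
  have hval : ∀ z w : Pt N, z ≠ w → (z - e).val ≠ (w - e).val := fun z w h h' =>
    h (sub_left_injective (Fin.ext h'))
  have hf' := val_add_one_sub fun h : f + 1 = e => hE f hf (h ▸ he)
  have hg' := val_add_one_sub fun h : g + 1 = e => hE g hg (h ▸ he)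
  have hne := hval _ _ hfg
  have hne' := hval _ _ fun h : f + 1 = g => hE f hf (h ▸ hg)
  have hne'' := hval _ _ fun h : g + 1 = f => hE g hg (h ▸ hf)
  rw [Fin.lt_def, Fin.lt_def]
  rcases hx with rfl | rfl <;> rcases hy with rfl | rfl <;> omega

theorem sub_lt_sub_rotate {M : ℕ} {p q r : Fin M} (hpq : p ≠ q) (hpr : p ≠ r) (hqr : q ≠ r) :
    q - p < r - p ↔ r - q < p - q := by
  have hpq' := Fin.val_ne_of_ne hpq
  have hpr' := Fin.val_ne_of_ne hpr
  have hqr' := Fin.val_ne_of_ne hqr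
  simp only [Fin.lt_def, fin_val_sub]
  split_ifs <;> omega

variable {e x y : Pt N}

theorem EdgeEnds.cross_iff {D : Naked N} (h : EdgeEnds e x y) (hxy : D.partner x ≠ y)
    {E : Finset (Pt N)} (hE : ∀ e ∈ E, e + 1 ∉ E) {f g : Pt N} (he : e ∈ E) (hf : f ∈ E)
    (hg : g ∈ E) (hfg : f ≠ g) (hx : D.partner x = f ∨ D.partner x = f + 1)
    (hy : D.partner y = g ∨ D.partner y = g + 1) :
    D.Cross e (e + 1) ↔ ¬ (x = e ↔ g - e < f - e) := by
  have hN : N ≠ 0 := by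
    rintro rfl
    exact hfg (Subsingleton.elim _ _)
  rcases h with ⟨rfl, rfl⟩ | ⟨rfl, rfl⟩
  · have hne : f - x ≠ g - x := fun h => hfg (sub_left_injective h)
    rw [D.cross_add_one_iff hN hxy, sub_lt_sub_iff_of_ends hE he hf hg hfg hx hy, iff_true_left rfl,
      not_lt, hne.le_iff_lt]
  · rw [D.cross_add_one_iff hN fun h => hxy (D.partner_eq_comm.2 h.symm),
      sub_lt_sub_iff_of_ends hE he hg hf hfg.symm hy hx, iff_false_left (add_one_ne hN y), not_not]

theorem EdgeEnds.heads_eq {D : Naked N} (h : EdgeEnds e x y) :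
    D.heads e = (if D.dir x = -1 then 1 else 0) + (if D.dir y = -1 then 1 else 0) := by
  rcases h with ⟨rfl, rfl⟩ | ⟨rfl, rfl⟩
  exacts [rfl, add_comm _ _]

theorem Naked.dir_eq_one_of_heads_eq_zero {D : Naked N} (hN : N ≠ 0) (he : D.heads e = 0)
    (hx : x = e ∨ x = e + 1) : D.dir x = 1 := by
  rw [Naked.heads, Nat.add_eq_zero_iff] at he
  have hneg : D.dir x ≠ -1 := by rcases hx with rfl | rfl <;> simp_all
  have hzero := D.dir_ne_zero hN x
  revert hneg hzero
  cases D.dir x <;> decide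

theorem Naked.dir_eq_neg_one_of_heads_eq_two {D : Naked N} (he : D.heads e = 2)
    (hx : x = e ∨ x = e + 1) : D.dir x = -1 := by
  by_contra hneg
  rw [Naked.heads] at he
  rcases hx with rfl | rfl <;> rw [if_neg hneg] at he <;> split_ifs at he <;>
    omega

theorem EdgeEnds.edgeWrithe_mul_eps {π : Type*} [Group π] {G : RigidGauss π N}
    (h : EdgeEnds e x y) {O : Prop} [Decidable O] (hcross : G.Cross e (e + 1) ↔ ¬ (x = e ↔ O)) :
    ((G.edgeWrithe e * G.eps e : ℤ) : ℚ) =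
      G.writhe x * G.writhe y * (if x = e ↔ O then -1 else 1) * (-1) ^ G.heads e := by
  have hwrithe : G.edgeWrithe e = G.writhe x * G.writhe y := by
    rcases h with ⟨rfl, rfl⟩ | ⟨rfl, rfl⟩
    exacts [rfl, mul_comm _ _]
  rw [hwrithe, Naked.eps]
  simp only [hcross, ite_not]
  push_cast
  rw [← mul_assoc]

end CyclicOrder

section Exchange

variable {N : ℕ} {π : Type*} [Group π] {p q r a b d : Pt N}

namespace Triangle

theorem of_isSwap {A A' : RigidArrow π N} (h : Triangle A p q r a b d)
    (hswap : IsSwap {p, q, r} A A') :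
    Triangle A' p q r (swapPoint {p, q, r} a) (swapPoint {p, q, r} b)
      (swapPoint {p, q, r} d) := by
  have hp : p ∈ ({p, q, r} : Finset (Pt N)) := by simp
  have hq : q ∈ ({p, q, r} : Finset (Pt N)) := by simp
  have hr : r ∈ ({p, q, r} : Finset (Pt N)) := by simp
  exact
    { dir_a := (hswap.dir a).trans h.dir_a
      dir_b := (hswap.dir b).trans h.dir_b
      dir_d := (hswap.dir d).trans h.dir_d
      sparse := h.sparse
      p_ne_q := h.p_ne_q
      p_ne_r := h.p_ne_r
      q_ne_r := h.q_ne_r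
      mark_eq_one := hswap.mark ▸ h.mark_eq_one
      top := by
        rw [h.top.swapPoint_eq h.sparse hp, h.top.symm.swapPoint_eq h.sparse hp]
        exact h.top.symm
      mid := by
        rw [hswap.partner, h.mid.swapPoint_eq h.sparse hq, h.mid.symm.swapPoint_eq h.sparse hq]
        exact h.mid.symm
      bot := by
        rw [hswap.partner, hswap.partner, h.bot.swapPoint_eq h.sparse hr,
          h.bot.symm.swapPoint_eq h.sparse hr]
        exact h.bot.symm }

variable {G G' : RigidGauss π N} (h : Triangle G.toRigidArrow p q r a b d)

include h

theorem edgeWrithe_mul_eps_top : ((G.edgeWrithe p * G.eps p : ℤ) : ℚ) =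
    G.writhe a * G.writhe b * (if b = p ↔ q - p < r - p then -1 else 1) := by
  rw [h.top.edgeWrithe_mul_eps (h.top.cross_iff (G.partner_ne_tail h.dir_b h.dir_a) h.sparse
    (by simp) (by simp) (by simp) h.q_ne_r.symm h.bot.symm.left_eq h.mid.left_eq),
    h.top.heads_eq, h.dir_a, h.dir_b, mul_comm (G.writhe a : ℚ)]
  exact mul_one _

theorem edgeWrithe_mul_eps_mid : ((G.edgeWrithe q * G.eps q : ℤ) : ℚ) =
    -(G.writhe a * G.writhe d * (if G.partner a = q ↔ q - p < r - p then -1 else 1)) := by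
  have hdir : G.dir (G.partner a) = -1 := by rw [G.dir_partner, h.dir_a]
  have hne : G.partner (G.partner a) ≠ d := by
    rw [G.partner_partner]
    exact h.a_ne_d
  have hcross := h.mid.cross_iff hne h.sparse (f := p) (g := r) (by simp) (by simp) (by simp)
    h.p_ne_r (by rw [G.partner_partner]; exact h.top.symm.left_eq) h.bot.left_eq
  rw [← sub_lt_sub_rotate h.p_ne_q h.p_ne_r h.q_ne_r] at hcross
  rw [h.mid.edgeWrithe_mul_eps hcross, h.mid.heads_eq, hdir, h.dir_d, G.writhe_partner]
  exact mul_neg_one _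

theorem edgeWrithe_mul_eps_bot : ((G.edgeWrithe r * G.eps r : ℤ) : ℚ) =
    G.writhe b * G.writhe d * (if G.partner d = r ↔ q - p < r - p then -1 else 1) := by
  have hdir_b : G.dir (G.partner b) = -1 := by rw [G.dir_partner, h.dir_b]
  have hdir_d : G.dir (G.partner d) = -1 := by rw [G.dir_partner, h.dir_d]
  have hne : G.partner (G.partner d) ≠ G.partner b := by
    rw [G.partner_partner]
    exact (G.partner_ne_tail h.dir_b h.dir_d).symm
  have hcross := h.bot.cross_iff hne h.sparse (f := q) (g := p) (by simp) (by simp) (by simp)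
    h.p_ne_q.symm (by rw [G.partner_partner]; exact h.mid.symm.left_eq)
    (by rw [G.partner_partner]; exact h.top.left_eq)
  rw [← sub_lt_sub_rotate h.q_ne_r h.p_ne_q.symm h.p_ne_r.symm,
    ← sub_lt_sub_rotate h.p_ne_q h.p_ne_r h.q_ne_r] at hcross
  rw [h.bot.edgeWrithe_mul_eps hcross, h.bot.heads_eq, hdir_b, hdir_d, G.writhe_partner,
    G.writhe_partner, mul_comm (G.writhe d : ℚ)]
  norm_num

end Triangle

theorem exchange_identity {T M B O : Prop} [Decidable T] [Decidable M] [Decidable B] [Decidable O]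
    {x y z : ℚ} (hxy : x * (if T ↔ O then -1 else 1) = -(y * (if M ↔ O then -1 else 1)))
    (hyz : -(y * (if M ↔ O then -1 else 1)) = z * (if B ↔ O then -1 else 1)) (s t s' t' : ℚ) :
    x * (if ¬ T then s else s') + y * (if ¬ M then s + t else s' + t') +
        z * (if ¬ B then t else t') =
      x * (if T then s else s') + y * (if M then s + t else s' + t') +
        z * (if B then t else t') := by
  by_cases hT : T <;> by_cases hM : M <;> by_cases hB : B <;> by_cases hO : O <;>
    simp only [hT, hM, hB, hO, if_true, if_false, not_true, not_false_iff, iff_true, iff_false,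
      iff_self] at hxy hyz ⊢ <;>
    first
      | linear_combination (s - s') * hxy - (t - t') * hyz
      | linear_combination (s' - s) * hxy - (t' - t) * hyz

namespace Triangle

variable {G G' : RigidGauss π N} {K : Type*} [LinearOrder K] [Fintype K] {Γ : K → ConjClasses π}

theorem stateSum_eq_of_isSwap (h : Triangle G.toRigidArrow p q r a b d)
    (hswap : IsSwap {p, q, r} G.toRigidArrow G'.toRigidArrow)
    (hw : ∀ i, G'.writhe (swapPoint {p, q, r} i) = G.writhe i)
    (hpq : G.edgeWrithe p * G.eps p = G.edgeWrithe q * G.eps q)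
    (hqr : G.edgeWrithe q * G.eps q = G.edgeWrithe r * G.eps r)
    (hΓ : ∀ k, Γ k ≠ ConjClasses.mk 1) : G'.stateSum Γ = G.stateSum Γ := by
  have hN := h.size_ne_zero
  have h' := h.of_isSwap hswap
  have htriangle : ∀ R, G'.triangleSum p q r Γ R = G.triangleSum p q r Γ R :=
    fun R => hswap.outerSum_eq h.isPatch hw _
  have hb : swapPoint {p, q, r} b = p ↔ ¬ b = p := by
    rw [h.top.swapPoint_eq h.sparse (by simp), h.top.right_eq_iff hN]
  have ha : G'.partner (swapPoint {p, q, r} a) = q ↔ ¬ G.partner a = q := by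
    rw [hswap.partner, h.mid.swapPoint_eq h.sparse (by simp), h.mid.right_eq_iff hN]
  have hd : G'.partner (swapPoint {p, q, r} d) = r ↔ ¬ G.partner d = r := by
    rw [hswap.partner, h.bot.swapPoint_eq h.sparse (by simp), h.bot.right_eq_iff hN]
  rw [h'.stateSum_eq hΓ, h.stateSum_eq hΓ, h'.sum_top_eq, h'.sum_mid_eq hΓ, h'.sum_bot_eq,
    h.sum_top_eq, h.sum_mid_eq hΓ, h.sum_bot_eq, hswap.sum_isTame_eq hN hw]
  simp only [hw, ha, hb, hd, htriangle, apply_ite (G.triangleSum p q r Γ), add_assoc]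
  congr 1
  simp only [← add_assoc]
  refine exchange_identity (O := q - p < r - p) ?_ ?_ _ _ _ _
  · rw [← h.edgeWrithe_mul_eps_top, ← h.edgeWrithe_mul_eps_mid, hpq]
  · rw [← h.edgeWrithe_mul_eps_mid, ← h.edgeWrithe_mul_eps_bot, hqr]

end Triangle

end Exchange

namespace RigidGauss

variable {N : ℕ} {π : Type*} [Group π] {G : RigidGauss π N}

theorem isSwap_permute {E : Finset (Pt N)} (hE : ∀ e ∈ E, e + 1 ∉ E)
    (hmark : ∀ e ∈ E, G.mark.at e = 1) {σ : Equiv.Perm (Pt N)} (hσ : ∀ i, σ i = swapPoint E i) :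
    IsSwap E G.toRigidArrow (G.permute σ).toRigidArrow where
  sparse := hE
  partner i := by simp [permute, ← hσ]
  dir i := by simp [permute, ← hσ]
  mark := rfl
  mark_eq_one := hmark

namespace IsR3

variable {e : Fin 3 → Pt N} (h : G.IsR3 e)

include h

theorem injective : Function.Injective e := fun k l hkl =>
  congrArg Prod.fst (h.1 (a₁ := (k, false)) (a₂ := (l, false)) (by simpa using hkl))

theorem add_one_ne (k l : Fin 3) : e k + 1 ≠ e l := fun hkl => by
  have := h.1 (a₁ := (k, true)) (a₂ := (l, false)) (by simpa using hkl)
  simp at this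

theorem ends_ne {k l : Fin 3} (hkl : k ≠ l) {x y : Pt N} (hx : x = e k ∨ x = e k + 1)
    (hy : y = e l ∨ y = e l + 1) : x ≠ y := by
  have hne := h.injective.ne hkl
  rcases hx with rfl | rfl <;> rcases hy with rfl | rfl
  exacts [hne, (h.add_one_ne l k).symm, h.add_one_ne k l, fun h => hne (add_right_cancel h)]

theorem comp (σ : Equiv.Perm (Fin 3)) : G.IsR3 (e ∘ σ) :=
  ⟨h.1.comp (σ.injective.prodMap Function.injective_id), fun k => h.2.1 (σ k),
    fun _ _ hkl => h.2.2.1 _ _ (σ.injective.ne hkl), fun _ _ => h.2.2.2.1 _ _,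
    fun _ _ hkl => h.2.2.2.2 _ _ (σ.injective.ne hkl)⟩

theorem exists_perm_heads_eq : ∃ σ : Equiv.Perm (Fin 3), ∀ k, G.heads (e (σ k)) = k := by
  have hlt : ∀ k, G.heads (e k) < 3 := fun k => by
    unfold Naked.heads
    split_ifs <;> omega
  have hinj : Function.Injective fun k => (⟨G.heads (e k), hlt k⟩ : Fin 3) := fun k l hkl => by
    by_contra hne
    exact h.2.2.2.2 k l hne (Fin.ext_iff.1 hkl)
  let τ := Equiv.ofBijective _ (Finite.injective_iff_bijective.1 hinj)
  exact ⟨τ.symm, fun k => Fin.ext_iff.1 (τ.apply_symm_apply k)⟩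

theorem swapEnds_apply (i : Pt N) : swapEnds e i = swapPoint (Finset.univ.image e) i := by
  have hne : ∀ k l, k ≠ l → e k ≠ e l := fun k l => h.injective.ne
  simp only [swapEnds, Equiv.Perm.mul_apply, Equiv.swap_apply_def, swapPoint, Finset.mem_image,
    Finset.mem_univ, true_and, Fin.exists_fin_succ]
  grind [h.add_one_ne]

theorem exists_triangle (hheads : ∀ k, G.heads (e k) = k) :
    ∃ a b d, Triangle G.toRigidArrow (e 0) (e 1) (e 2) a b d := by
  have hN : N ≠ 0 := by
    rintro rfl
    exact h.add_one_ne 0 0 (Subsingleton.elim _ _)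
  obtain ⟨a, ha, ha'⟩ := h.2.2.1 0 1 (by decide)
  obtain ⟨b, hb, hb'⟩ := h.2.2.1 0 2 (by decide)
  obtain ⟨d, hd, hd'⟩ := h.2.2.1 1 2 (by decide)
  have hdir_a := Naked.dir_eq_one_of_heads_eq_zero hN (hheads 0) ha
  have hdir_b := Naked.dir_eq_one_of_heads_eq_zero hN (hheads 0) hb
  have hdir_d : G.dir d = 1 := by
    have hhead := Naked.dir_eq_neg_one_of_heads_eq_two (hheads 2) hd'
    rwa [G.dir_partner, neg_inj] at hhead
  refine ⟨a, b, d, hdir_a, hdir_b, hdir_d, ?_, h.injective.ne (by decide),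
    h.injective.ne (by decide), h.injective.ne (by decide), ?_, .of_ne ?_ hb ha,
    .of_ne (G.partner_ne_tail hdir_a hdir_d) ha' hd, .of_ne ?_ hd' hb'⟩
  · simp [h.add_one_ne]
  · simp [h.2.1]
  · rintro rfl
    exact h.ends_ne (by decide) hb' ha' rfl
  · exact fun hbd => h.ends_ne (by decide) hb hd (G.partner_injective hbd).symm

theorem stateSum_permute {K : Type*} [LinearOrder K] [Fintype K] {Γ : K → ConjClasses π}
    (hΓ : ∀ k, Γ k ≠ ConjClasses.mk 1) : (G.permute (swapEnds e)).stateSum Γ = G.stateSum Γ := by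
  obtain ⟨σ, hheads⟩ := h.exists_perm_heads_eq
  obtain ⟨a, b, d, htriangle⟩ := (h.comp σ).exists_triangle hheads
  have hedges : ({e (σ 0), e (σ 1), e (σ 2)} : Finset (Pt N)) = Finset.univ.image e := by
    rw [← Finset.image_univ_equiv σ, Finset.image_image]
    simp [Fin.univ_succ]
  have hswap : ∀ i, swapEnds e i = swapPoint {e (σ 0), e (σ 1), e (σ 2)} i := fun i => by
    rw [h.swapEnds_apply, hedges]
  refine htriangle.stateSum_eq_of_isSwap (isSwap_permute htriangle.sparse htriangle.mark_eq_one
    hswap) (fun i => ?_) (h.2.2.2.1 _ _) (h.2.2.2.1 _ _) hΓ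
  rw [Function.comp_apply, Function.comp_apply, Function.comp_apply, ← hswap]
  simp [permute]

end IsR3

end RigidGauss

theorem stateSum_move {π : Type*} [Group π] {K : Type} [LinearOrder K] [Fintype K]
    {Γ : K → ConjClasses π} (hΓ : ∀ k, Γ k ≠ ConjClasses.mk 1) {w : π →* ℤˣ} (hw : ∀ g, w g = 1)
    {x y : Σ n : ℕ, RigidGauss π n} (h : Move w x y) : x.2.stateSum Γ = y.2.stateSum Γ := by
  cases h with
  | rotate G k => exact (stateSum_smul G k).symm
  | r1 G a h => exact (stateSum_remove_r1 hΓ G h).symm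
  | r2 G a b h => exact (stateSum_remove_r2 hΓ h).symm
  | r3 G e h => exact (h.stateSum_permute hΓ).symm
  | conj G i _ g => exact (RigidGauss.stateSum_conjugate G g hΓ (hw g) i).symm

end GaussKnot

theorem mainTheorem6 {π : Type*} [Group π] (w : π →* ℤˣ) (hw : ∀ g, w g = 1)
    (n : ℕ) (Γ : Fin (n + 1) → ConjClasses π) (hΓ : ∀ i, Γ i ≠ ConjClasses.mk 1) :
    GaussKnot.IsArrowDiagramFormula w
      (GaussKnot.signedSymPres (GaussKnot.liftedPlanarChain Γ)) :=
  ⟨⟨Quot.lift (fun x => x.2.stateSum Γ) fun _ _ h => GaussKnot.stateSum_move hΓ hw h,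
    fun _ G => (GaussKnot.pairing_subdiagramSum hΓ G).symm⟩, _, rfl⟩
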